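/- **Setting.** Let $n\ge 5$ be an odd integer and $a,b\in\mathbb C$. Let $\mathcal{GN}(a,b)$ be the complex vector space with basis $$c,\qquad x_i^k\ (1\le k\le n,\ 1\le i\le k+1),\qquad y_i^k\ (1\le k\le n,\ k\ne 2,\ 1\le i\le k+1),$$ where we write $x_i=x_i^1$, $y_i=y_i^1$, $z_i=x_i^2$, with the antisymmetric bilinear product whose only nonzero products of basis vectors are, up to antisymmetry (in each line $j$ and $i$ run over all lower indices of the two vectors on the left, and a vector $y^{n-1}_m$ with $m$ outside $1\le m\le n$ is read as $0$; its coefficient is then $0$ as well): - $[x_1,x_2]=[y_1,y_2]=c$, $\ [x_j,y_i]=z_{i+j-1}$; - $[x_j,x_i^q]=x_{i+j-1}^{q+1}$ for $2\le q\le n-1$; - $[y_j,z_i]=y_{i+j-1}^3$, $\ [y_j,y_i^q]=y_{i+j-1}^{q+1}$ for $3\le q\le n-2$, $\ [y_j,x_i^{n-1}]=y_{i+j-1}^n$; - $[x_j^p,x_i^{n-p}]=(-1)^{p-1}y_{i+j-1}^n$ for $2\le p\le \frac{n-1}2$; - $[x_j,y_i^n]=a\,(i-1-(j-1)n)\,y_{i+j-2}^{n-1}$,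 $\ [y_j,x_i^n]=-b\,(i-1-(j-1)n)\,y_{i+j-2}^{n-1}$; - $[x_j^p,x_i^{n-p+1}]=\frac{(p-1)a+b}{p}(-1)^p\big((i-1)p-(j-1)(n-p+1)\big)\,y_{i+j-2}^{n-1}$ for $2\le p\le\frac{n+1}2$. The Lie algebra $\mathfrak{sl}_2$ over $\mathbb C$, with standard basis $e,f,h$, acts on $\mathcal{GN}(a,b)$ by $[\mathfrak{sl}_2,c]=0$ and, for $v\in\{x,y\}$, $$[h,v_i^k]=(k+2-2i)v_i^k,\qquad [e,v_i^k]=(i-1)v_{i-1}^k,\qquad [f,v_i^k]=(k+1-i)v_{i+1}^k .$$ Let $k\ge1$, let $a_i,b_i\in\mathbb C$ with $(a_i,b_i)\ne(0,0)$ for $1\le i\le k$, and put $N_i=\mathcal{GN}(a_i,b_i)$ (all with the same $n$). For $j\ne t$ let $\varphi_{j,t}\colon N_j\to\operatorname{End}(N_t)$ be the linear map sending each basis vector of $N_j$ to $\operatorname{ad}$ of the basis vector of $N_t$ of the same name; in particular it sends the generators $x_i,y_i$ of $N_j$ to $\operatorname{ad}x_i,\operatorname{ad}y_i$. For each choice of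 signs $*\in\{\ltimes,\rtimes\}$ let $$L=\mathfrak{sl}_2\mathcal G(a_i,b_i)=\mathfrak{sl}_2\ltimes\Big(N_1*\big(N_2*\cdots*(N_{k-1}*N_k)\big)\Big).$$ Here $\mathfrak{sl}_2$ acts on every $N_i$ as above. In $N_i\rtimes(N_{i+1}*\cdots)$ each $N_j$ with $j>i$ acts on $N_i$ through $\varphi_{j,i}$. In $N_i\ltimes(N_{i+1}*\cdots)$ the factor $N_i$ acts on each $N_j$ with $j>i$ through $\varphi_{i,j}$. Thus $L$ is an algebra with antisymmetric product $[\cdot,\cdot]$. **Theorem.** For every such $L$: 1. every derivation of $L$ is inner: if $D\colon L\to L$ is linear and $D[u,v]=[Du,v]+[u,Dv]$ for all $u,v\in L$, then there is $w\in L$ with $Du=[w,u]$ for all $u\in L$; 2. $L$ is perfect: $L=[L,L]$; 3. $L$ has nonzero center: there is $z\ne0$ in $L$ with $[z,u]=0$ for all $u\in L$; 4. $L$ satisfies the Jacobi identity if and only if $a_i=b_i$ for all $i$. In that case $L$ is a perfect Lie algebra with nonzero center, all of whose derivations are inner, and $H^1(L,L)=0$. -/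

import Mathlib

noncomputable section

namespace SatoType

/-- Symbols for the basis vectors of `𝒢𝒩(a,b)`: `c`, `x k i` for `x_i^k` and `y k i` for `y_i^k`.
The vector `x_i` is `x 1 i`, the vector `y_i` is `y 1 i`, and `z_i` is `x 2 i`. -/
inductive Sym : Type
  | c : Sym
  | x (k i : ℕ) : Sym
  | y (k i : ℕ) : Sym

/-- The symbols that really occur: `c`; `x_i^k` with `1 ≤ k ≤ n`, `1 ≤ i ≤ k + 1`; and
`y_i^k` with the same ranges, except that there is no `y_i^2`. -/
def Sym.Valid (n : ℕ) : Sym → Prop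
  | .c => True
  | .x k i => 1 ≤ k ∧ k ≤ n ∧ 1 ≤ i ∧ i ≤ k + 1
  | .y k i => 1 ≤ k ∧ k ≤ n ∧ k ≠ 2 ∧ 1 ≤ i ∧ i ≤ k + 1

/-- The basis of the nilpotent algebra. -/
abbrev Idx (n : ℕ) : Type := {s : Sym // s.Valid n}

/-- The underlying vector space `𝒰 ⊕ 𝒰² ⊕ ⋯ ⊕ 𝒰ⁿ` of `𝒢𝒩(a,b)`. -/
abbrev GN (n : ℕ) : Type := Idx n →₀ ℂ

open Classical in
/-- The basis vector of a symbol, with the convention that a symbol out of range is `0`. -/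
def vec (n : ℕ) (s : Sym) : GN n :=
  if h : s.Valid n then Finsupp.single ⟨s, h⟩ 1 else 0

/-- The nonzero products of basis vectors of `𝒢𝒩(a,b)`, each unordered pair of
basis vectors being listed in one order only. -/
def half (n : ℕ) (a b : ℂ) : Sym → Sym → GN n
  | .x p j, .x q i =>
      if p = 1 ∧ q = 1 then
        -- `[x₁, x₂] = c`
        if j = 1 ∧ i = 2 then vec n .c else 0
      else if p = 1 ∧ 2 ≤ q ∧ q ≤ n - 1 then
        -- `[x_j, x_i^q] = x_{i+j-1}^{q+1}`
        vec n (.x (q + 1) (i + j - 1))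
      else if 2 ≤ p ∧ p < q ∧ p + q = n then
        -- `[x_j^p, x_i^{n-p}] = (-1)^{p-1} y_{i+j-1}^n`
        (-1 : ℂ) ^ (p - 1) • vec n (.y n (i + j - 1))
      else if 2 ≤ p ∧ (p < q ∨ p = q ∧ j < i) ∧ p + q = n + 1 then
        -- `[x_j^p, x_i^{n-p+1}] = ((p-1)a+b)/p · (-1)^p ((i-1)p - (j-1)(n-p+1)) y_{i+j-2}^{n-1}`
        ((((p : ℂ) - 1) * a + b) / p *
            ((-1 : ℂ) ^ p * (((i : ℂ) - 1) * p - ((j : ℂ) - 1) * ((n : ℂ) - p + 1)))) •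
          vec n (.y (n - 1) (i + j - 2))
      else 0
  | .x p j, .y q i =>
      if p = 1 ∧ q = 1 then
        -- `[x_j, y_i] = z_{i+j-1}`
        vec n (.x 2 (i + j - 1))
      else if p = 1 ∧ q = n then
        -- `[x_j, y_i^n] = a (i-1-(j-1)n) y_{i+j-2}^{n-1}`
        (a * ((i : ℂ) - 1 - ((j : ℂ) - 1) * n)) • vec n (.y (n - 1) (i + j - 2))
      else 0
  | .y p j, .x q i =>
      if p = 1 ∧ q = 2 then
        -- `[y_j, z_i] = y_{i+j-1}^3`
        vec n (.y 3 (i + j - 1))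
      else if p = 1 ∧ q = n - 1 then
        -- `[y_j, x_i^{n-1}] = y_{i+j-1}^n`
        vec n (.y n (i + j - 1))
      else if p = 1 ∧ q = n then
        -- `[y_j, x_i^n] = -b (i-1-(j-1)n) y_{i+j-2}^{n-1}`
        (-b * ((i : ℂ) - 1 - ((j : ℂ) - 1) * n)) • vec n (.y (n - 1) (i + j - 2))
      else 0
  | .y p j, .y q i =>
      if p = 1 ∧ q = 1 then
        -- `[y₁, y₂] = c`
        if j = 1 ∧ i = 2 then vec n .c else 0
      else if p = 1 ∧ 3 ≤ q ∧ q ≤ n - 2 then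
        -- `[y_j, y_i^q] = y_{i+j-1}^{q+1}`
        vec n (.y (q + 1) (i + j - 1))
      else 0
  | _, _ => 0

/-- The bracket of `𝒢𝒩(a,b)`: the antisymmetric bilinear extension of the products above. -/
def br (n : ℕ) (a b : ℂ) : GN n →ₗ[ℂ] GN n →ₗ[ℂ] GN n :=
  Finsupp.linearCombination ℂ fun s : Idx n =>
    Finsupp.linearCombination ℂ fun t : Idx n => half n a b s.1 t.1 - half n a b t.1 s.1

/-- `[h, v_i^k] = (k + 2 - 2 i) v_i^k` and `[h, c] = 0`. -/
def actH (n : ℕ) : GN n →ₗ[ℂ] GN n :=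
  Finsupp.linearCombination ℂ fun s : Idx n =>
    match s.1 with
    | .c => 0
    | .x k i => ((k : ℂ) + 2 - 2 * i) • vec n (.x k i)
    | .y k i => ((k : ℂ) + 2 - 2 * i) • vec n (.y k i)

/-- `[e, v_i^k] = (i - 1) v_{i-1}^k` and `[e, c] = 0`. -/
def actE (n : ℕ) : GN n →ₗ[ℂ] GN n :=
  Finsupp.linearCombination ℂ fun s : Idx n =>
    match s.1 with
    | .c => 0
    | .x k i => ((i : ℂ) - 1) • vec n (.x k (i - 1))
    | .y k i => ((i : ℂ) - 1) • vec n (.y k (i - 1))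

/-- `[f, v_i^k] = (k + 1 - i) v_{i+1}^k` and `[f, c] = 0`. -/
def actF (n : ℕ) : GN n →ₗ[ℂ] GN n :=
  Finsupp.linearCombination ℂ fun s : Idx n =>
    match s.1 with
    | .c => 0
    | .x k i => ((k : ℂ) + 1 - i) • vec n (.x k (i + 1))
    | .y k i => ((k : ℂ) + 1 - i) • vec n (.y k (i + 1))

/-- The Lie algebra `sl₂` over `ℂ`. -/
abbrev SL2 : Type := LieAlgebra.SpecialLinear.sl (Fin 2) ℂ

/-- The action of `sl₂` on `𝒢𝒩(a,b)`: the matrix `A = A₀₀ h + A₀₁ e + A₁₀ f` acts as above. -/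
def act (n : ℕ) (A : SL2) : GN n →ₗ[ℂ] GN n :=
  A.1 0 0 • actH n + A.1 0 1 • actE n + A.1 1 0 • actF n

/-- The two kinds of semidirect products: in `G₁ ⋉ G₂` the left factor acts on the right one,
in `G₁ ⋊ G₂` the right factor acts on the left one. -/
inductive SemiDir : Type
  | ltimes : SemiDir
  | rtimes : SemiDir

/-- In `N₀ * (N₁ * (⋯ * N_{k-1}))`, where `star i` is the sign between `N_i` and the bracket
`(N_{i+1} * ⋯)` that follows it (so that `star (k-1)` is not used), the factor `N_j` acts on
the factor `N_t` (`j ≠ t`) if `t < j` and the sign after `N_t` is `⋊`, or if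
`j < t` and the sign after `N_j` is `⋉`. -/
def Acts {k : ℕ} (star : Fin k → SemiDir) (j t : Fin k) : Prop :=
  (t < j ∧ star t = .rtimes) ∨ (j < t ∧ star j = .ltimes)

open Classical in
/-- The bracket of the iterated semidirect product `N₀ * (N₁ * (⋯ * N_{k-1}))`, `N_i = 𝒢𝒩(a_i,b_i)`,
where the factor `N_j`, if it acts on `N_t`, does so through the map `φ_{j,t}` that sends a
basis vector of `N_j` to `ad` of the basis vector of `N_t` of the same name. -/
def nilBr (n : ℕ) {k : ℕ} (star : Fin k → SemiDir) (a b : Fin k → ℂ) (F G : Fin k → GN n) :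
    Fin k → GN n :=
  fun t => br n (a t) (b t) (F t) (G t) +
    ∑ j with Acts star j t, (br n (a t) (b t) (F j) (G t) - br n (a t) (b t) (G j) (F t))

/-- The vector space `sl₂ ⊕ N₀ ⊕ ⋯ ⊕ N_{k-1}`. -/
def SlG (n : ℕ) {k : ℕ} (_star : Fin k → SemiDir) (_a _b : Fin k → ℂ) : Type :=
  SL2 × (Fin k → GN n)

variable {n k : ℕ} {star : Fin k → SemiDir} {a b : Fin k → ℂ}

instance : AddCommGroup (SlG n star a b) := inferInstanceAs (AddCommGroup (SL2 × (Fin k → GN n)))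

instance : Module ℂ (SlG n star a b) := inferInstanceAs (Module ℂ (SL2 × (Fin k → GN n)))

/-- The product of `sl₂ ⋉ (N₀ * (N₁ * (⋯ * N_{k-1})))`. -/
instance : Bracket (SlG n star a b) (SlG n star a b) where
  bracket u v :=
    (⁅u.1, v.1⁆, fun t => act n u.1 (v.2 t) - act n v.1 (u.2 t) + nilBr n star a b u.2 v.2 t)

section Proofs

theorem vec_of_valid {s : Sym} (h : s.Valid n) : vec n s = Finsupp.single ⟨s, h⟩ 1 := by
  simp [vec, h]

theorem br_vec {s t : Sym} (hs : s.Valid n) (ht : t.Valid n) (a b : ℂ) :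
    br n a b (vec n s) (vec n t) = half n a b s t - half n a b t s := by
  simp [br, vec_of_valid hs, vec_of_valid ht]

theorem vec_of_not_valid {s : Sym} (h : ¬ s.Valid n) : vec n s = 0 := by
  simp [vec, h]

theorem hom_ext {M : Type*} [AddCommMonoid M] [Module ℂ M] {f g : GN n →ₗ[ℂ] M}
    (h : ∀ s : Sym, s.Valid n → f (vec n s) = g (vec n s)) : f = g := by
  refine Finsupp.lhom_ext' fun s => LinearMap.ext_ring ?_
  have := h s.1 s.2
  rw [vec_of_valid s.2] at this
  exact this

theorem br_skew (a b : ℂ) (u v : GN n) : br n a b u v = - br n a b v u := by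
  have : br n a b + (br n a b).flip = 0 := by
    refine hom_ext fun s hs => hom_ext fun t ht => ?_
    simp [br_vec hs ht, br_vec ht hs]
  have h := LinearMap.congr_fun (LinearMap.congr_fun this u) v
  simpa [add_eq_zero_iff_eq_neg] using h

theorem br_self (a b : ℂ) (u : GN n) : br n a b u u = 0 := by
  have := br_skew a b u u
  exact self_eq_neg.mp this

/-- `y^{n-1}` and `c` are central. -/
theorem br_y_last (h5 : 5 ≤ n) (a b : ℂ) (u : GN n) (i : ℕ) : br n a b u (vec n (.y (n - 1) i)) = 0 := by
  by_cases hv : (Sym.y (n - 1) i).Valid n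
  swap
  · simp [vec_of_not_valid hv]
  have : (br n a b).flip (vec n (.y (n - 1) i)) = 0 := by
    refine hom_ext fun s hs => ?_
    simp only [LinearMap.flip_apply, br_vec hs hv, LinearMap.zero_apply]
    rcases s with _ | ⟨p, j⟩ | ⟨p, j⟩ <;> simp only [half, Sym.Valid] at * <;>
      grind
  exact LinearMap.congr_fun this u

theorem br_c (a b : ℂ) (u : GN n) : br n a b u (vec n .c) = 0 := by
  have : (br n a b).flip (vec n .c) = 0 := by
    refine hom_ext fun s hs => ?_
    simp only [LinearMap.flip_apply, br_vec hs (t := .c) trivial, LinearMap.zero_apply]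
    rcases s with _ | ⟨p, j⟩ | ⟨p, j⟩ <;> simp [half]
  exact LinearMap.congr_fun this u


theorem pow_sub_one {p : ℕ} (hp : 1 ≤ p) : (-1 : ℂ) ^ (p - 1) = - (-1 : ℂ) ^ p := by
  obtain ⟨m, rfl⟩ := Nat.exists_eq_add_of_le' hp
  simp [pow_succ]

theorem pow_of_add_odd {p q : ℕ} (h : Odd (p + q)) : (-1 : ℂ) ^ q = - (-1 : ℂ) ^ p := by
  rcases Nat.even_or_odd p with hp | hp
  · have hq : Odd q := by grind
    simp [hp.neg_one_pow, hq.neg_one_pow]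
  · have hq : Even q := by grind
    simp [hp.neg_one_pow, hq.neg_one_pow]

theorem pow_of_add_even {p q : ℕ} (h : Even (p + q)) : (-1 : ℂ) ^ q = (-1 : ℂ) ^ p := by
  rcases Nat.even_or_odd p with hp | hp
  · have hq : Even q := by grind
    simp [hp.neg_one_pow, hq.neg_one_pow]
  · have hq : Odd q := by grind
    simp [hp.neg_one_pow, hq.neg_one_pow]

theorem br_x1_x1 (h5 : 5 ≤ n) (a : ℂ) {j i : ℕ} (hj : 1 ≤ j ∧ j ≤ 2) (hi : 1 ≤ i ∧ i ≤ 2) :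
    br n a a (vec n (.x 1 j)) (vec n (.x 1 i)) = ((i : ℂ) - j) • vec n .c := by
  rw [br_vec (by simp [Sym.Valid]; omega) (by simp [Sym.Valid]; omega)]
  obtain ⟨hj1, hj2⟩ := hj
  obtain ⟨hi1, hi2⟩ := hi
  interval_cases i <;> interval_cases j <;> simp [half] <;> norm_num

theorem br_y1_y1 (h5 : 5 ≤ n) (a : ℂ) {j i : ℕ} (hj : 1 ≤ j ∧ j ≤ 2) (hi : 1 ≤ i ∧ i ≤ 2) :
    br n a a (vec n (.y 1 j)) (vec n (.y 1 i)) = ((i : ℂ) - j) • vec n .c := by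
  rw [br_vec (by simp [Sym.Valid]; omega) (by simp [Sym.Valid]; omega)]
  obtain ⟨hj1, hj2⟩ := hj
  obtain ⟨hi1, hi2⟩ := hi
  interval_cases i <;> interval_cases j <;> simp [half] <;> norm_num

theorem br_x1_y1 (h5 : 5 ≤ n) (a : ℂ) {j i : ℕ} (hj : 1 ≤ j ∧ j ≤ 2) (hi : 1 ≤ i ∧ i ≤ 2) :
    br n a a (vec n (.x 1 j)) (vec n (.y 1 i)) = vec n (.x 2 (i + j - 1)) := by
  rw [br_vec (by simp [Sym.Valid]; omega) (by simp [Sym.Valid]; omega)]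
  simp only [half]
  grind

theorem br_x1_x (h5 : 5 ≤ n) (a : ℂ) {j q i : ℕ} (hj : 1 ≤ j ∧ j ≤ 2) (hq : 2 ≤ q ∧ q ≤ n - 1)
    (hi : 1 ≤ i ∧ i ≤ q + 1) :
    br n a a (vec n (.x 1 j)) (vec n (.x q i)) = vec n (.x (q + 1) (i + j - 1)) := by
  rw [br_vec (by simp [Sym.Valid]; omega) (by simp [Sym.Valid]; omega)]
  simp only [half]
  grind

theorem br_x1_xn (h5 : 5 ≤ n) (a : ℂ) {j i : ℕ} (hj : 1 ≤ j ∧ j ≤ 2) (hi : 1 ≤ i ∧ i ≤ n + 1) :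
    br n a a (vec n (.x 1 j)) (vec n (.x n i)) = 0 := by
  rw [br_vec (by simp [Sym.Valid]; omega) (by simp [Sym.Valid]; omega)]
  simp only [half]
  grind

theorem br_x1_y (h5 : 5 ≤ n) (a : ℂ) {j q i : ℕ} (hj : 1 ≤ j ∧ j ≤ 2) (hq : 3 ≤ q ∧ q ≤ n - 1)
    (hi : 1 ≤ i ∧ i ≤ q + 1) :
    br n a a (vec n (.x 1 j)) (vec n (.y q i)) = 0 := by
  rw [br_vec (by simp [Sym.Valid]; omega) (by simp [Sym.Valid]; omega)]
  simp only [half]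
  grind

theorem br_x1_yn (h5 : 5 ≤ n) (a : ℂ) {j i : ℕ} (hj : 1 ≤ j ∧ j ≤ 2) (hi : 1 ≤ i ∧ i ≤ n + 1) :
    br n a a (vec n (.x 1 j)) (vec n (.y n i)) =
      (a * ((i : ℂ) - 1 - ((j : ℂ) - 1) * n)) • vec n (.y (n - 1) (i + j - 2)) := by
  rw [br_vec (by simp [Sym.Valid]; omega) (by simp [Sym.Valid]; omega)]
  simp only [half]
  grind

theorem br_y1_x2 (h5 : 5 ≤ n) (a : ℂ) {j i : ℕ} (hj : 1 ≤ j ∧ j ≤ 2) (hi : 1 ≤ i ∧ i ≤ 3) :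
    br n a a (vec n (.y 1 j)) (vec n (.x 2 i)) = vec n (.y 3 (i + j - 1)) := by
  rw [br_vec (by simp [Sym.Valid]; omega) (by simp [Sym.Valid]; omega)]
  simp only [half]
  grind

theorem br_y1_x (h5 : 5 ≤ n) (a : ℂ) {j q i : ℕ} (hj : 1 ≤ j ∧ j ≤ 2) (hq : 3 ≤ q ∧ q ≤ n - 2)
    (hi : 1 ≤ i ∧ i ≤ q + 1) :
    br n a a (vec n (.y 1 j)) (vec n (.x q i)) = 0 := by
  rw [br_vec (by simp [Sym.Valid]; omega) (by simp [Sym.Valid]; omega)]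
  simp only [half]
  grind

theorem br_y1_xm (h5 : 5 ≤ n) (a : ℂ) {j i : ℕ} (hj : 1 ≤ j ∧ j ≤ 2) (hi : 1 ≤ i ∧ i ≤ n) :
    br n a a (vec n (.y 1 j)) (vec n (.x (n - 1) i)) = vec n (.y n (i + j - 1)) := by
  rw [br_vec (by simp [Sym.Valid]; omega) (by simp [Sym.Valid]; omega)]
  simp only [half]
  grind

theorem br_y1_xn (h5 : 5 ≤ n) (a : ℂ) {j i : ℕ} (hj : 1 ≤ j ∧ j ≤ 2) (hi : 1 ≤ i ∧ i ≤ n + 1) :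
    br n a a (vec n (.y 1 j)) (vec n (.x n i)) =
      (-a * ((i : ℂ) - 1 - ((j : ℂ) - 1) * n)) • vec n (.y (n - 1) (i + j - 2)) := by
  rw [br_vec (by simp [Sym.Valid]; omega) (by simp [Sym.Valid]; omega)]
  simp only [half]
  grind

theorem br_y1_y (h5 : 5 ≤ n) (a : ℂ) {j q i : ℕ} (hj : 1 ≤ j ∧ j ≤ 2) (hq : 3 ≤ q ∧ q ≤ n - 2)
    (hi : 1 ≤ i ∧ i ≤ q + 1) :
    br n a a (vec n (.y 1 j)) (vec n (.y q i)) = vec n (.y (q + 1) (i + j - 1)) := by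
  rw [br_vec (by simp [Sym.Valid]; omega) (by simp [Sym.Valid]; omega)]
  simp only [half]
  grind

theorem br_y1_yn (h5 : 5 ≤ n) (a : ℂ) {j i : ℕ} (hj : 1 ≤ j ∧ j ≤ 2) (hi : 1 ≤ i ∧ i ≤ n + 1) :
    br n a a (vec n (.y 1 j)) (vec n (.y n i)) = 0 := by
  rw [br_vec (by simp [Sym.Valid]; omega) (by simp [Sym.Valid]; omega)]
  simp only [half]
  grind

theorem br_x_y (a : ℂ) {p j q i : ℕ} (hp : 2 ≤ p) (hq : 2 ≤ q) :
    br n a a (vec n (.x p j)) (vec n (.y q i)) = 0 := by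
  by_cases hs : (Sym.x p j).Valid n
  swap
  · simp [vec_of_not_valid hs]
  by_cases ht : (Sym.y q i).Valid n
  swap
  · simp [vec_of_not_valid ht]
  rw [br_vec hs ht]
  simp only [half]
  grind

theorem br_y_y (a : ℂ) {p j q i : ℕ} (hp : 2 ≤ p) (hq : 2 ≤ q) :
    br n a a (vec n (.y p j)) (vec n (.y q i)) = 0 := by
  by_cases hs : (Sym.y p j).Valid n
  swap
  · simp [vec_of_not_valid hs]
  by_cases ht : (Sym.y q i).Valid n
  swap
  · simp [vec_of_not_valid ht]
  rw [br_vec hs ht]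
  simp only [half]
  grind

theorem br_x_x_zero (a : ℂ) {p j q i : ℕ} (hp : 2 ≤ p) (hq : 2 ≤ q)
    (h : p + q ≠ n) (h' : p + q ≠ n + 1) :
    br n a a (vec n (.x p j)) (vec n (.x q i)) = 0 := by
  by_cases hs : (Sym.x p j).Valid n
  swap
  · simp [vec_of_not_valid hs]
  by_cases ht : (Sym.x q i).Valid n
  swap
  · simp [vec_of_not_valid ht]
  rw [br_vec hs ht]
  simp only [half]
  grind

theorem br_x_x_n (hn : Odd n) (h5 : 5 ≤ n) (a : ℂ) {p j q i : ℕ} (hp : 2 ≤ p) (hq : 2 ≤ q)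
    (h : p + q = n) (hj : 1 ≤ j ∧ j ≤ p + 1) (hi : 1 ≤ i ∧ i ≤ q + 1) :
    br n a a (vec n (.x p j)) (vec n (.x q i)) =
      (-(-1 : ℂ) ^ p) • vec n (.y n (i + j - 1)) := by
  rw [br_vec (by simp [Sym.Valid]; omega) (by simp [Sym.Valid]; omega)]
  have hpq := pow_of_add_odd (h ▸ hn)
  have h1 := pow_sub_one (show 1 ≤ p by omega)
  have h2 := pow_sub_one (show 1 ≤ q by omega)
  have hne : p ≠ q := by rintro rfl; grind
  have c1 : ¬ (p = 1 ∧ q = 1) := by omega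
  have c2 : ¬ (p = 1 ∧ 2 ≤ q ∧ q ≤ n - 1) := by omega
  have d1 : ¬ (q = 1 ∧ p = 1) := by omega
  have d2 : ¬ (q = 1 ∧ 2 ≤ p ∧ p ≤ n - 1) := by omega
  simp only [half, if_neg c1, if_neg c2, if_neg d1, if_neg d2, h1, h2, hpq]
  rw [add_comm j i]
  rcases lt_or_gt_of_ne hne with hlt | hlt
  · rw [if_pos (by omega), if_neg (by omega), if_neg (by omega), sub_zero]
  · rw [if_neg (by omega), if_neg (by omega), if_pos (by omega), zero_sub, ← neg_smul, neg_neg]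

theorem br_x_x_n1 (hn : Odd n) (h5 : 5 ≤ n) (a : ℂ) {p j q i : ℕ} (hp : 2 ≤ p) (hq : 2 ≤ q)
    (h : p + q = n + 1) (hj : 1 ≤ j ∧ j ≤ p + 1) (hi : 1 ≤ i ∧ i ≤ q + 1) :
    br n a a (vec n (.x p j)) (vec n (.x q i)) =
      (a * (-1 : ℂ) ^ p * (((i : ℂ) - 1) * p - ((j : ℂ) - 1) * q)) •
        vec n (.y (n - 1) (i + j - 2)) := by
  rw [br_vec (by simp [Sym.Valid]; omega) (by simp [Sym.Valid]; omega)]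
  have hpq : (-1 : ℂ) ^ q = (-1 : ℂ) ^ p := pow_of_add_even (by rw [h]; exact hn.add_one)
  have hp0 : (p : ℂ) ≠ 0 := by exact_mod_cast (by omega : p ≠ 0)
  have hq0 : (q : ℂ) ≠ 0 := by exact_mod_cast (by omega : q ≠ 0)
  have hN : (n : ℂ) = p + q - 1 := by
    have : ((p + q : ℕ) : ℂ) = ((n + 1 : ℕ) : ℂ) := by rw [h]
    push_cast at this
    linear_combination -this
  have e1 : (((p : ℂ) - 1) * a + a) / p = a := by field_simp; ring
  have e2 : (((q : ℂ) - 1) * a + a) / q = a := by field_simp; ring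
  have c1 : ¬ (p = 1 ∧ q = 1) := by omega
  have c2 : ¬ (p = 1 ∧ 2 ≤ q ∧ q ≤ n - 1) := by omega
  have c3 : ¬ (2 ≤ p ∧ p < q ∧ p + q = n) := by omega
  have d1 : ¬ (q = 1 ∧ p = 1) := by omega
  have d2 : ¬ (q = 1 ∧ 2 ≤ p ∧ p ≤ n - 1) := by omega
  have d3 : ¬ (2 ≤ q ∧ q < p ∧ q + p = n) := by omega
  simp only [half, if_neg c1, if_neg c2, if_neg c3, if_neg d1, if_neg d2, if_neg d3, e1, e2]
  rw [add_comm j i, hpq, hN]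
  rcases lt_trichotomy p q with hlt | rfl | hlt
  · rw [if_pos (by omega), if_neg (by omega), sub_zero]
    congr 1; ring
  · rcases lt_trichotomy j i with hji | rfl | hji
    · rw [if_pos (by omega), if_neg (by omega), sub_zero]
      congr 1; ring
    · rw [if_neg (by omega)]
      simp
    · rw [if_neg (by omega), if_pos (by omega), zero_sub, ← neg_smul]
      congr 1; ring
  · rw [if_neg (by omega), if_pos (by omega), zero_sub, ← neg_smul]
    congr 1; ring


theorem br_c_left (a b : ℂ) (u : GN n) : br n a b (vec n .c) u = 0 := by
  rw [br_skew, br_c, neg_zero]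

theorem br_y_last_left (h5 : 5 ≤ n) (a b : ℂ) (u : GN n) (i : ℕ) :
    br n a b (vec n (.y (n - 1) i)) u = 0 := by
  rw [br_skew, br_y_last h5, neg_zero]

theorem br_x1_y_last (h5 : 5 ≤ n) (a : ℂ) {j q i : ℕ} (hj : 1 ≤ j ∧ j ≤ 2) (hq : 3 ≤ q ∧ q ≤ n)
    (hi : 1 ≤ i ∧ i ≤ q + 1) :
    ∃ (r : ℂ) (m : ℕ), br n a a (vec n (.x 1 j)) (vec n (.y q i)) = r • vec n (.y (n - 1) m) := by
  rcases eq_or_ne q n with rfl | hne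
  · exact ⟨_, _, br_x1_yn h5 a hj hi⟩
  · exact ⟨0, 0, by rw [br_x1_y h5 a hj (by omega) hi, zero_smul]⟩

theorem br_y1_x_mem (h5 : 5 ≤ n) (a : ℂ) {j q i : ℕ} (hj : 1 ≤ j ∧ j ≤ 2) (hq : 2 ≤ q ∧ q ≤ n)
    (hi : 1 ≤ i ∧ i ≤ q + 1) :
    ∃ (r : ℂ) (m l : ℕ), 2 ≤ l ∧
      br n a a (vec n (.y 1 j)) (vec n (.x q i)) = r • vec n (.y l m) := by
  by_cases h2 : q = 2
  · subst h2
    exact ⟨1, _, 3, by omega, by rw [br_y1_x2 h5 a hj hi, one_smul]⟩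
  by_cases h3 : q = n
  · subst h3
    exact ⟨_, _, q - 1, by omega, br_y1_xn h5 a hj hi⟩
  by_cases h4 : q = n - 1
  · subst h4
    exact ⟨1, _, n, by omega, by rw [br_y1_xm h5 a hj (by omega), one_smul]⟩
  · exact ⟨0, 0, 3, by omega, by rw [br_y1_x h5 a hj (by omega) hi, zero_smul]⟩

theorem br_y1_y_mem (h5 : 5 ≤ n) (a : ℂ) {j q i : ℕ} (hj : 1 ≤ j ∧ j ≤ 2) (hq : 3 ≤ q ∧ q ≤ n)
    (hi : 1 ≤ i ∧ i ≤ q + 1) :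
    ∃ (r : ℂ) (m l : ℕ), 2 ≤ l ∧
      br n a a (vec n (.y 1 j)) (vec n (.y q i)) = r • vec n (.y l m) := by
  by_cases h3 : q = n
  · subst h3
    exact ⟨0, 0, 3, by omega, by rw [br_y1_yn h5 a hj hi, zero_smul]⟩
  by_cases h4 : q = n - 1
  · subst h4
    exact ⟨0, 0, 3, by omega, by rw [br_y_last h5, zero_smul]⟩
  · exact ⟨1, _, q + 1, by omega, by rw [br_y1_y h5 a hj (by omega) hi, one_smul]⟩

/-- The Leibniz form of the Jacobi expression. -/
def jac (n : ℕ) (a : ℂ) (u v w : GN n) : GN n :=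
  br n a a u (br n a a v w) - br n a a v (br n a a u w) - br n a a (br n a a u v) w

theorem jac_swap₁ (a : ℂ) (u v w : GN n) : jac n a u v w = - jac n a v u w := by
  simp only [jac]
  rw [br_skew a a u v]
  simp only [map_neg, LinearMap.neg_apply]
  abel

theorem jac_swap₂ (a : ℂ) (u v w : GN n) : jac n a u v w = - jac n a u w v := by
  simp only [jac]
  rw [br_skew a a v w, br_skew a a v (br n a a u w), br_skew a a (br n a a u v) w]
  simp only [map_neg]
  abel

theorem jac_x1_x1_x1 (h5 : 5 ≤ n) (a : ℂ) {j i l : ℕ} (hj : 1 ≤ j ∧ j ≤ 2) (hi : 1 ≤ i ∧ i ≤ 2)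
    (hl : 1 ≤ l ∧ l ≤ 2) :
    jac n a (vec n (.x 1 j)) (vec n (.x 1 i)) (vec n (.x 1 l)) = 0 := by
  simp [jac, br_x1_x1 h5 a hi hl, br_x1_x1 h5 a hj hl, br_x1_x1 h5 a hj hi, br_c, br_c_left]

theorem jac_y1_y1_y1 (h5 : 5 ≤ n) (a : ℂ) {j i l : ℕ} (hj : 1 ≤ j ∧ j ≤ 2) (hi : 1 ≤ i ∧ i ≤ 2)
    (hl : 1 ≤ l ∧ l ≤ 2) :
    jac n a (vec n (.y 1 j)) (vec n (.y 1 i)) (vec n (.y 1 l)) = 0 := by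
  simp [jac, br_y1_y1 h5 a hi hl, br_y1_y1 h5 a hj hl, br_y1_y1 h5 a hj hi, br_c, br_c_left]

theorem jac_x1_x1_y1 (h5 : 5 ≤ n) (a : ℂ) {j i l : ℕ} (hj : 1 ≤ j ∧ j ≤ 2) (hi : 1 ≤ i ∧ i ≤ 2)
    (hl : 1 ≤ l ∧ l ≤ 2) :
    jac n a (vec n (.x 1 j)) (vec n (.x 1 i)) (vec n (.y 1 l)) = 0 := by
  simp only [jac]
  rw [br_x1_y1 h5 a hi hl, br_x1_y1 h5 a hj hl, br_x1_x1 h5 a hj hi,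
    br_x1_x h5 a hj (by omega) (by omega), br_x1_x h5 a hi (by omega) (by omega),
    show l + i - 1 + j - 1 = l + j - 1 + i - 1 by omega]
  simp [br_c_left]

theorem jac_x1_y1_y1 (h5 : 5 ≤ n) (a : ℂ) {j i l : ℕ} (hj : 1 ≤ j ∧ j ≤ 2) (hi : 1 ≤ i ∧ i ≤ 2)
    (hl : 1 ≤ l ∧ l ≤ 2) :
    jac n a (vec n (.x 1 j)) (vec n (.y 1 i)) (vec n (.y 1 l)) = 0 := by
  simp only [jac]
  rw [br_x1_y1 h5 a hj hi, br_x1_y1 h5 a hj hl, br_y1_y1 h5 a hi hl,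
    br_skew a a (vec n (.x 2 _)) (vec n (.y 1 l)),
    br_y1_x2 h5 a hi (by omega), br_y1_x2 h5 a hl (by omega),
    show l + j - 1 + i - 1 = i + j - 1 + l - 1 by omega]
  simp [br_c]

theorem jac_x1_x1_x (h5 : 5 ≤ n) (a : ℂ) {j i p l : ℕ} (hj : 1 ≤ j ∧ j ≤ 2) (hi : 1 ≤ i ∧ i ≤ 2)
    (hp : 2 ≤ p ∧ p ≤ n) (hl : 1 ≤ l ∧ l ≤ p + 1) :
    jac n a (vec n (.x 1 j)) (vec n (.x 1 i)) (vec n (.x p l)) = 0 := by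
  simp only [jac]
  rw [br_x1_x1 h5 a hj hi]
  simp only [map_smul, LinearMap.smul_apply, br_c_left, smul_zero, sub_zero]
  by_cases h : p = n
  · subst h
    rw [br_x1_xn h5 a hi hl, br_x1_xn h5 a hj hl]
    simp
  rw [br_x1_x h5 a hi (by omega) hl, br_x1_x h5 a hj (by omega) hl]
  by_cases h' : p + 1 = n
  · rw [h', br_x1_xn h5 a hi (by omega), br_x1_xn h5 a hj (by omega)]
    simp
  · rw [br_x1_x h5 a hi (by omega) (by omega), br_x1_x h5 a hj (by omega) (by omega),
      show l + i - 1 + j - 1 = l + j - 1 + i - 1 by omega, sub_self]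

theorem jac_x1_x1_y (h5 : 5 ≤ n) (a : ℂ) {j i p l : ℕ} (hj : 1 ≤ j ∧ j ≤ 2) (hi : 1 ≤ i ∧ i ≤ 2)
    (hp : 3 ≤ p ∧ p ≤ n) (hl : 1 ≤ l ∧ l ≤ p + 1) :
    jac n a (vec n (.x 1 j)) (vec n (.x 1 i)) (vec n (.y p l)) = 0 := by
  simp only [jac]
  obtain ⟨r, m, h1⟩ := br_x1_y_last h5 a hj hp hl
  obtain ⟨r', m', h2⟩ := br_x1_y_last h5 a hi hp hl
  rw [br_x1_x1 h5 a hj hi, h1, h2]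
  simp [br_c_left, br_y_last h5]

theorem jac_y1_y1_x (h5 : 5 ≤ n) (a : ℂ) {j i p l : ℕ} (hj : 1 ≤ j ∧ j ≤ 2) (hi : 1 ≤ i ∧ i ≤ 2)
    (hp : 2 ≤ p ∧ p ≤ n) (hl : 1 ≤ l ∧ l ≤ p + 1) :
    jac n a (vec n (.y 1 j)) (vec n (.y 1 i)) (vec n (.x p l)) = 0 := by
  simp only [jac]
  rw [br_y1_y1 h5 a hj hi]
  simp only [map_smul, LinearMap.smul_apply, br_c_left, smul_zero, sub_zero]
  by_cases h2 : p = 2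
  · subst h2
    rw [br_y1_x2 h5 a hj hl, br_y1_x2 h5 a hi hl, br_y1_y h5 a hj (by omega) (by omega),
      br_y1_y h5 a hi (by omega) (by omega),
      show l + i - 1 + j - 1 = l + j - 1 + i - 1 by omega, sub_self]
  by_cases h3 : p = n
  · subst h3
    rw [br_y1_xn h5 a hj hl, br_y1_xn h5 a hi hl]
    simp [br_y_last h5]
  by_cases h4 : p = n - 1
  · subst h4
    rw [br_y1_xm h5 a hj (by omega), br_y1_xm h5 a hi (by omega), br_y1_yn h5 a hj (by omega),
      br_y1_yn h5 a hi (by omega), sub_zero]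
  · rw [br_y1_x h5 a hj (by omega) hl, br_y1_x h5 a hi (by omega) hl]
    simp

theorem jac_y1_y1_y (h5 : 5 ≤ n) (a : ℂ) {j i p l : ℕ} (hj : 1 ≤ j ∧ j ≤ 2) (hi : 1 ≤ i ∧ i ≤ 2)
    (hp : 3 ≤ p ∧ p ≤ n) (hl : 1 ≤ l ∧ l ≤ p + 1) :
    jac n a (vec n (.y 1 j)) (vec n (.y 1 i)) (vec n (.y p l)) = 0 := by
  simp only [jac]
  rw [br_y1_y1 h5 a hj hi]
  simp only [map_smul, LinearMap.smul_apply, br_c_left, smul_zero, sub_zero]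
  by_cases h3 : p = n
  · subst h3
    rw [br_y1_yn h5 a hj hl, br_y1_yn h5 a hi hl]
    simp
  by_cases h4 : p = n - 1
  · subst h4
    simp [br_y_last h5]
  rw [br_y1_y h5 a hj (by omega) hl, br_y1_y h5 a hi (by omega) hl]
  by_cases h5' : p + 1 = n - 1
  · rw [h5']
    simp [br_y_last h5]
  · rw [br_y1_y h5 a hj (by omega) (by omega), br_y1_y h5 a hi (by omega) (by omega),
      show l + i - 1 + j - 1 = l + j - 1 + i - 1 by omega, sub_self]

theorem jac_x1_y1_y (h5 : 5 ≤ n) (a : ℂ) {j i p l : ℕ} (hj : 1 ≤ j ∧ j ≤ 2) (hi : 1 ≤ i ∧ i ≤ 2)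
    (hp : 3 ≤ p ∧ p ≤ n) (hl : 1 ≤ l ∧ l ≤ p + 1) :
    jac n a (vec n (.x 1 j)) (vec n (.y 1 i)) (vec n (.y p l)) = 0 := by
  simp only [jac]
  obtain ⟨r, m, h1⟩ := br_x1_y_last h5 a hj hp hl
  rw [br_x1_y1 h5 a hj hi, br_x_y (p := 2) (q := p) a (by omega) (by omega), h1]
  simp only [map_smul, br_y_last h5, smul_zero, sub_zero]
  by_cases h3 : p = n
  · subst h3
    rw [br_y1_yn h5 a hi hl]
    simp
  by_cases h4 : p = n - 1
  · subst h4
    simp [br_y_last h5]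
  rw [br_y1_y h5 a hi (by omega) hl, br_x1_y h5 a hj (by omega) (by omega)]

theorem jac_x1_y1_x (hn : Odd n) (h5 : 5 ≤ n) (a : ℂ) {j i p l : ℕ} (hj : 1 ≤ j ∧ j ≤ 2)
    (hi : 1 ≤ i ∧ i ≤ 2) (hp : 2 ≤ p ∧ p ≤ n) (hl : 1 ≤ l ∧ l ≤ p + 1) :
    jac n a (vec n (.x 1 j)) (vec n (.y 1 i)) (vec n (.x p l)) = 0 := by
  simp only [jac]
  rw [br_x1_y1 h5 a hj hi]
  by_cases h3 : p = n
  · subst h3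
    rw [br_y1_xn h5 a hi hl, br_x1_xn h5 a hj hl,
      br_x_x_zero a (by omega) (by omega) (by omega) (by omega)]
    simp [br_y_last h5]
  by_cases h4 : p = n - 1
  · subst h4
    have hN : ((n - 1 : ℕ) : ℂ) = (n : ℂ) - 1 := by
      rw [Nat.cast_sub (by omega)]
      simp
    have e1 : ((l + i - 1 : ℕ) : ℂ) = (l : ℂ) + i - 1 := by
      rw [Nat.cast_sub (by omega)]
      simp
    have e2 : ((l + j - 1 : ℕ) : ℂ) = (l : ℂ) + j - 1 := by
      rw [Nat.cast_sub (by omega)]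
      simp
    have e3 : ((i + j - 1 : ℕ) : ℂ) = (i : ℂ) + j - 1 := by
      rw [Nat.cast_sub (by omega)]
      simp
    rw [br_y1_xm h5 a hi (by omega), br_x1_x h5 a hj (by omega) hl,
      show n - 1 + 1 = n by omega, br_x1_yn h5 a hj (by omega), br_y1_xn h5 a hi (by omega),
      br_x_x_n1 hn h5 a (by omega) (by omega) (by omega) (by omega) (by omega),
      show l + i - 1 + j - 2 = l + (i + j - 1) - 2 by omega,
      show l + j - 1 + i - 2 = l + (i + j - 1) - 2 by omega, ← sub_smul, ← sub_smul, e1, e2, e3, hN]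
    rw [show (a * ((l : ℂ) + i - 1 - 1 - ((j : ℂ) - 1) * n) -
      -a * ((l : ℂ) + j - 1 - 1 - ((i : ℂ) - 1) * n) -
      a * (-1) ^ 2 * (((l : ℂ) - 1) * (2 : ℕ) - ((i : ℂ) + j - 1 - 1) * ((n : ℂ) - 1))) = 0 by
        push_cast; ring, zero_smul]
  rw [br_x1_x h5 a hj (by omega) hl]
  by_cases h6 : p = n - 2
  · subst h6
    rw [br_y1_x h5 a hi (by omega) hl, br_x_x_n hn h5 a (by omega) (by omega) (by omega) (by omega)
      (by omega), show n - 2 + 1 = n - 1 by omega, br_y1_xm h5 a hi (by omega),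
      show l + j - 1 + i - 1 = l + (i + j - 1) - 1 by omega]
    simp
  · rw [br_x_x_zero a (by omega) (by omega) (by omega) (by omega),
      br_y1_x (q := p + 1) h5 a hi (by omega) (by omega), sub_zero, sub_zero]
    by_cases h2 : p = 2
    · subst h2
      rw [br_y1_x2 h5 a hi hl, br_x1_y h5 a hj (by omega) (by omega)]
    · rw [br_y1_x h5 a hi (by omega) hl, map_zero]

theorem jac_x1_x_x (hn : Odd n) (h5 : 5 ≤ n) (a : ℂ) {j p i q l : ℕ} (hj : 1 ≤ j ∧ j ≤ 2)
    (hp : 2 ≤ p ∧ p ≤ n) (hi : 1 ≤ i ∧ i ≤ p + 1)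
    (hq : 2 ≤ q ∧ q ≤ n) (hl : 1 ≤ l ∧ l ≤ q + 1) :
    jac n a (vec n (.x 1 j)) (vec n (.x p i)) (vec n (.x q l)) = 0 := by
  simp only [jac]
  by_cases h1 : p + q + 1 = n
  · rw [br_x_x_zero a (by omega) (by omega) (by omega) (by omega),
      br_x1_x h5 a hj (by omega) hi, br_x1_x h5 a hj (by omega) hl,
      br_x_x_n hn h5 a (by omega) (by omega) (by omega) (by omega) (by omega),
      br_x_x_n hn h5 a (by omega) (by omega) (by omega) (by omega) (by omega),
      show l + j - 1 + i - 1 = l + (i + j - 1) - 1 by omega]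
    simp [pow_succ]
  by_cases h2 : p + q = n
  · have e1 : ((l + i - 1 : ℕ) : ℂ) = (l : ℂ) + i - 1 := by
      rw [Nat.cast_sub (by omega)]
      simp
    have e2 : ((l + j - 1 : ℕ) : ℂ) = (l : ℂ) + j - 1 := by
      rw [Nat.cast_sub (by omega)]
      simp
    have e3 : ((i + j - 1 : ℕ) : ℂ) = (i : ℂ) + j - 1 := by
      rw [Nat.cast_sub (by omega)]
      simp
    have hN : (n : ℂ) = p + q := by rw [← h2]; push_cast; rfl
    rw [br_x_x_n hn h5 a (by omega) (by omega) h2 hi hl,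
      br_x1_x h5 a hj (by omega) hi, br_x1_x h5 a hj (by omega) hl, map_smul,
      br_x1_yn h5 a hj (by omega),
      br_x_x_n1 hn h5 a (by omega) (by omega) (by omega) (by omega) (by omega),
      br_x_x_n1 hn h5 a (by omega) (by omega) (by omega) (by omega) (by omega),
      show l + j - 1 + i - 2 = l + (i + j - 1) - 2 by omega,
      show l + i - 1 + j - 2 = l + (i + j - 1) - 2 by omega, smul_smul, ← sub_smul, ← sub_smul,
      e1, e2, e3, hN]
    convert zero_smul ℂ _ using 2
    push_cast
    ring
  have h3 : br n a a (vec n (.x 1 j)) (br n a a (vec n (.x p i)) (vec n (.x q l))) = 0 := by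
    by_cases h4 : p + q = n + 1
    · rw [br_x_x_n1 hn h5 a (by omega) (by omega) h4 hi hl]
      simp [br_y_last h5]
    · rw [br_x_x_zero a (by omega) (by omega) h2 h4, map_zero]
  have h6 : br n a a (vec n (.x p i)) (br n a a (vec n (.x 1 j)) (vec n (.x q l))) = 0 := by
    by_cases h4 : q = n
    · subst h4
      rw [br_x1_xn h5 a hj hl, map_zero]
    · rw [br_x1_x h5 a hj (by omega) hl,
        br_x_x_zero a (by omega) (by omega) (by omega) (by omega)]
  have h7 : br n a a (br n a a (vec n (.x 1 j)) (vec n (.x p i))) (vec n (.x q l)) = 0 := by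
    by_cases h4 : p = n
    · subst h4
      rw [br_x1_xn h5 a hj hi, map_zero, LinearMap.zero_apply]
    · rw [br_x1_x h5 a hj (by omega) hi,
        br_x_x_zero a (by omega) (by omega) (by omega) (by omega)]
  rw [h3, h6, h7]
  simp

theorem jac_x1_x_y (h5 : 5 ≤ n) (a : ℂ) {j p i q l : ℕ} (hj : 1 ≤ j ∧ j ≤ 2)
    (hp : 2 ≤ p ∧ p ≤ n) (hi : 1 ≤ i ∧ i ≤ p + 1)
    (hq : 3 ≤ q ∧ q ≤ n) (hl : 1 ≤ l ∧ l ≤ q + 1) :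
    jac n a (vec n (.x 1 j)) (vec n (.x p i)) (vec n (.y q l)) = 0 := by
  simp only [jac]
  obtain ⟨r, m, h1⟩ := br_x1_y_last h5 a hj hq hl
  rw [h1, br_x_y a (by omega) (by omega)]
  simp only [map_smul, br_y_last h5, map_zero, smul_zero, zero_sub, neg_zero, neg_eq_zero]
  by_cases h4 : p = n
  · subst h4
    rw [br_x1_xn h5 a hj hi, map_zero, LinearMap.zero_apply]
  · rw [br_x1_x h5 a hj (by omega) hi, br_x_y a (by omega) (by omega)]

theorem jac_x1_y_y (h5 : 5 ≤ n) (a : ℂ) {j p i q l : ℕ} (hj : 1 ≤ j ∧ j ≤ 2)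
    (hp : 3 ≤ p ∧ p ≤ n) (hi : 1 ≤ i ∧ i ≤ p + 1)
    (hq : 3 ≤ q ∧ q ≤ n) (hl : 1 ≤ l ∧ l ≤ q + 1) :
    jac n a (vec n (.x 1 j)) (vec n (.y p i)) (vec n (.y q l)) = 0 := by
  simp only [jac]
  obtain ⟨r, m, h1⟩ := br_x1_y_last h5 a hj hq hl
  obtain ⟨r', m', h2⟩ := br_x1_y_last h5 a hj hp hi
  rw [h1, h2, br_y_y a (by omega) (by omega)]
  simp [br_y_last h5, br_y_last_left h5]

theorem jac_y1_x_x (hn : Odd n) (h5 : 5 ≤ n) (a : ℂ) {j p i q l : ℕ} (hj : 1 ≤ j ∧ j ≤ 2)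
    (hp : 2 ≤ p ∧ p ≤ n) (hi : 1 ≤ i ∧ i ≤ p + 1)
    (hq : 2 ≤ q ∧ q ≤ n) (hl : 1 ≤ l ∧ l ≤ q + 1) :
    jac n a (vec n (.y 1 j)) (vec n (.x p i)) (vec n (.x q l)) = 0 := by
  simp only [jac]
  obtain ⟨r, m, s, hs, h1⟩ := br_y1_x_mem h5 a hj hq hl
  obtain ⟨r', m', s', hs', h2⟩ := br_y1_x_mem h5 a hj hp hi
  rw [h1, h2]
  simp only [map_smul, LinearMap.smul_apply]
  rw [br_x_y a (by omega) (by omega), br_skew a a (vec n (.y s' m')), br_x_y a (by omega) (by omega)]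
  simp only [smul_zero, sub_zero, neg_zero]
  by_cases h4 : p + q = n + 1
  · rw [br_x_x_n1 hn h5 a (by omega) (by omega) h4 hi hl]
    simp [br_y_last h5]
  by_cases h6 : p + q = n
  · rw [br_x_x_n hn h5 a (by omega) (by omega) h6 hi hl, map_smul, br_y1_yn h5 a hj (by omega),
      smul_zero]
  · rw [br_x_x_zero a (by omega) (by omega) h6 h4, map_zero]

theorem jac_y1_x_y (h5 : 5 ≤ n) (a : ℂ) {j p i q l : ℕ} (hj : 1 ≤ j ∧ j ≤ 2)
    (hp : 2 ≤ p ∧ p ≤ n) (hi : 1 ≤ i ∧ i ≤ p + 1)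
    (hq : 3 ≤ q ∧ q ≤ n) (hl : 1 ≤ l ∧ l ≤ q + 1) :
    jac n a (vec n (.y 1 j)) (vec n (.x p i)) (vec n (.y q l)) = 0 := by
  simp only [jac]
  obtain ⟨r, m, s, hs, h1⟩ := br_y1_y_mem h5 a hj hq hl
  obtain ⟨r', m', s', hs', h2⟩ := br_y1_x_mem h5 a hj hp hi
  rw [h1, h2, br_x_y a (by omega) (by omega)]
  simp only [map_smul, LinearMap.smul_apply]
  rw [br_x_y a (by omega) (by omega), br_y_y a (by omega) (by omega)]
  simp

theorem jac_y1_y_y (h5 : 5 ≤ n) (a : ℂ) {j p i q l : ℕ} (hj : 1 ≤ j ∧ j ≤ 2)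
    (hp : 3 ≤ p ∧ p ≤ n) (hi : 1 ≤ i ∧ i ≤ p + 1)
    (hq : 3 ≤ q ∧ q ≤ n) (hl : 1 ≤ l ∧ l ≤ q + 1) :
    jac n a (vec n (.y 1 j)) (vec n (.y p i)) (vec n (.y q l)) = 0 := by
  simp only [jac]
  obtain ⟨r, m, s, hs, h1⟩ := br_y1_y_mem h5 a hj hq hl
  obtain ⟨r', m', s', hs', h2⟩ := br_y1_y_mem h5 a hj hp hi
  rw [h1, h2, br_y_y a (by omega) (by omega)]
  simp only [map_smul, LinearMap.smul_apply]
  rw [br_y_y a (by omega) (by omega), br_y_y a (by omega) (by omega)]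
  simp

/-- Brackets of elements of degree at least two are killed by such elements. -/
theorem jac_high (hn : Odd n) (h5 : 5 ≤ n) (a : ℂ) {s t r : Sym}
    (hs : s.Valid n) (ht : t.Valid n) (hr : r.Valid n)
    (hs' : ∀ i, s ≠ .x 1 i ∧ s ≠ .y 1 i) (ht' : ∀ i, t ≠ .x 1 i ∧ t ≠ .y 1 i)
    (hr' : ∀ i, r ≠ .x 1 i ∧ r ≠ .y 1 i) :
    br n a a (vec n s) (br n a a (vec n t) (vec n r)) = 0 := by
  have hmem : ∃ (c : ℂ) (l m : ℕ), 2 ≤ l ∧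
      br n a a (vec n t) (vec n r) = c • vec n (.y l m) := by
    rcases t with _ | ⟨p, i⟩ | ⟨p, i⟩
    · exact ⟨0, 3, 0, by omega, by rw [br_c_left, zero_smul]⟩
    · have hp : p ≠ 1 := fun h => (ht' i).1 (by rw [h])
      simp only [Sym.Valid] at ht
      rcases r with _ | ⟨q, l⟩ | ⟨q, l⟩
      · exact ⟨0, 3, 0, by omega, by rw [br_c, zero_smul]⟩
      · have hq : q ≠ 1 := fun h => (hr' l).1 (by rw [h])
        simp only [Sym.Valid] at hr
        by_cases h4 : p + q = n + 1
        · exact ⟨_, _, _, by omega, br_x_x_n1 hn h5 a (by omega) (by omega) h4 (by omega) (by omega)⟩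
        by_cases h6 : p + q = n
        · exact ⟨_, _, _, by omega, br_x_x_n hn h5 a (by omega) (by omega) h6 (by omega) (by omega)⟩
        · exact ⟨0, 3, 0, by omega, by
            rw [br_x_x_zero a (by omega) (by omega) h6 h4, zero_smul]⟩
      · have hq : q ≠ 1 := fun h => (hr' l).2 (by rw [h])
        simp only [Sym.Valid] at hr
        exact ⟨0, 3, 0, by omega, by rw [br_x_y a (by omega) (by omega), zero_smul]⟩
    · have hp : p ≠ 1 := fun h => (ht' i).2 (by rw [h])
      simp only [Sym.Valid] at ht
      rcases r with _ | ⟨q, l⟩ | ⟨q, l⟩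
      · exact ⟨0, 3, 0, by omega, by rw [br_c, zero_smul]⟩
      · have hq : q ≠ 1 := fun h => (hr' l).1 (by rw [h])
        simp only [Sym.Valid] at hr
        exact ⟨0, 3, 0, by omega, by
          rw [br_skew, br_x_y a (by omega) (by omega), zero_smul, neg_zero]⟩
      · have hq : q ≠ 1 := fun h => (hr' l).2 (by rw [h])
        simp only [Sym.Valid] at hr
        exact ⟨0, 3, 0, by omega, by rw [br_y_y a (by omega) (by omega), zero_smul]⟩
  obtain ⟨c, l, m, hl, h⟩ := hmem
  rw [h, map_smul]
  rcases s with _ | ⟨p, i⟩ | ⟨p, i⟩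
  · rw [br_c_left, smul_zero]
  · have hp : p ≠ 1 := fun h => (hs' i).1 (by rw [h])
    simp only [Sym.Valid] at hs
    rw [br_x_y a (by omega) hl, smul_zero]
  · have hp : p ≠ 1 := fun h => (hs' i).2 (by rw [h])
    simp only [Sym.Valid] at hs
    rw [br_y_y a (by omega) hl, smul_zero]


/-- The rank used to sort basis vectors in the proof of the Jacobi identity. -/
def rank : Sym → ℕ
  | .c => 4
  | .x k _ => if k = 1 then 0 else 2
  | .y k _ => if k = 1 then 1 else 3

theorem sym_cases {s : Sym} (hs : s.Valid n) :
    (s = .c ∧ rank s = 4) ∨ (∃ i, s = .x 1 i ∧ rank s = 0 ∧ 1 ≤ i ∧ i ≤ 2) ∨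
    (∃ i, s = .y 1 i ∧ rank s = 1 ∧ 1 ≤ i ∧ i ≤ 2) ∨
    (∃ k i, s = .x k i ∧ rank s = 2 ∧ (2 ≤ k ∧ k ≤ n) ∧ 1 ≤ i ∧ i ≤ k + 1) ∨
    (∃ k i, s = .y k i ∧ rank s = 3 ∧ (3 ≤ k ∧ k ≤ n) ∧ 1 ≤ i ∧ i ≤ k + 1) := by
  rcases s with _ | ⟨k, i⟩ | ⟨k, i⟩ <;> simp only [Sym.Valid] at hs
  · exact Or.inl ⟨rfl, rfl⟩
  · by_cases h : k = 1
    · subst h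
      exact Or.inr (Or.inl ⟨i, rfl, rfl, by omega, by omega⟩)
    · exact Or.inr (Or.inr (Or.inr (Or.inl ⟨k, i, rfl, by simp [rank, h], by omega, by omega⟩)))
  · by_cases h : k = 1
    · subst h
      exact Or.inr (Or.inr (Or.inl ⟨i, rfl, rfl, by omega, by omega⟩))
    · exact Or.inr (Or.inr (Or.inr (Or.inr ⟨k, i, rfl, by simp [rank, h], by omega, by omega⟩)))

theorem jac_sorted (hn : Odd n) (h5 : 5 ≤ n) (a : ℂ) {s t r : Sym}
    (hs : s.Valid n) (ht : t.Valid n) (hr : r.Valid n) (h1 : rank s ≤ rank t)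
    (h2 : rank t ≤ rank r) : jac n a (vec n s) (vec n t) (vec n r) = 0 := by
  have high (h : 2 ≤ rank s) : jac n a (vec n s) (vec n t) (vec n r) = 0 := by
    have aux : ∀ u : Sym, 2 ≤ rank u → ∀ i, u ≠ .x 1 i ∧ u ≠ .y 1 i := by
      intro u hu i
      constructor <;> (rintro rfl; simp [rank] at hu)
    simp only [jac]
    rw [br_skew a a (br n a a _ _),
      jac_high hn h5 a hs ht hr (aux s h) (aux t (by omega)) (aux r (by omega)),
      jac_high hn h5 a ht hs hr (aux t (by omega)) (aux s h) (aux r (by omega)),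
      jac_high hn h5 a hr hs ht (aux r (by omega)) (aux s h) (aux t (by omega))]
    simp
  rcases sym_cases hr with ⟨rfl, -⟩ | hr
  · simp [jac, br_c]
  rcases sym_cases hs with ⟨rfl, e⟩ | ⟨j, rfl, e, hj⟩ | ⟨j, rfl, e, hj⟩ | ⟨m, j, rfl, e, hm, hj⟩ |
    ⟨m, j, rfl, e, hm, hj⟩
  · exact high (by omega)
  · rcases sym_cases ht with ⟨rfl, e'⟩ | ⟨i, rfl, e', hi⟩ | ⟨i, rfl, e', hi⟩ | ⟨p, i, rfl, e', hp, hi⟩ |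
      ⟨p, i, rfl, e', hp, hi⟩
    · obtain ⟨i, -, e'', -⟩ | ⟨i, -, e'', -⟩ | ⟨p, i, -, e'', -⟩ | ⟨p, i, -, e'', -⟩ := hr <;>
        omega
    · obtain ⟨l, rfl, e'', hl⟩ | ⟨l, rfl, e'', hl⟩ | ⟨q, l, rfl, e'', hq, hl⟩ |
        ⟨q, l, rfl, e'', hq, hl⟩ := hr
      · exact jac_x1_x1_x1 h5 a hj hi hl
      · exact jac_x1_x1_y1 h5 a hj hi hl
      · exact jac_x1_x1_x h5 a hj hi hq hl
      · exact jac_x1_x1_y h5 a hj hi hq hl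
    · obtain ⟨l, rfl, e'', hl⟩ | ⟨l, rfl, e'', hl⟩ | ⟨q, l, rfl, e'', hq, hl⟩ |
        ⟨q, l, rfl, e'', hq, hl⟩ := hr
      · omega
      · exact jac_x1_y1_y1 h5 a hj hi hl
      · exact jac_x1_y1_x hn h5 a hj hi hq hl
      · exact jac_x1_y1_y h5 a hj hi hq hl
    · obtain ⟨l, rfl, e'', hl⟩ | ⟨l, rfl, e'', hl⟩ | ⟨q, l, rfl, e'', hq, hl⟩ |
        ⟨q, l, rfl, e'', hq, hl⟩ := hr
      · omega
      · omega
      · exact jac_x1_x_x hn h5 a hj hp hi hq hl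
      · exact jac_x1_x_y h5 a hj hp hi hq hl
    · obtain ⟨l, rfl, e'', hl⟩ | ⟨l, rfl, e'', hl⟩ | ⟨q, l, rfl, e'', hq, hl⟩ |
        ⟨q, l, rfl, e'', hq, hl⟩ := hr
      · omega
      · omega
      · omega
      · exact jac_x1_y_y h5 a hj hp hi hq hl
  · rcases sym_cases ht with ⟨rfl, e'⟩ | ⟨i, rfl, e', hi⟩ | ⟨i, rfl, e', hi⟩ | ⟨p, i, rfl, e', hp, hi⟩ |
      ⟨p, i, rfl, e', hp, hi⟩
    · obtain ⟨i, -, e'', -⟩ | ⟨i, -, e'', -⟩ | ⟨p, i, -, e'', -⟩ | ⟨p, i, -, e'', -⟩ := hr <;>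
        omega
    · omega
    · obtain ⟨l, rfl, e'', hl⟩ | ⟨l, rfl, e'', hl⟩ | ⟨q, l, rfl, e'', hq, hl⟩ |
        ⟨q, l, rfl, e'', hq, hl⟩ := hr
      · omega
      · exact jac_y1_y1_y1 h5 a hj hi hl
      · exact jac_y1_y1_x h5 a hj hi hq hl
      · exact jac_y1_y1_y h5 a hj hi hq hl
    · obtain ⟨l, rfl, e'', hl⟩ | ⟨l, rfl, e'', hl⟩ | ⟨q, l, rfl, e'', hq, hl⟩ |
        ⟨q, l, rfl, e'', hq, hl⟩ := hr
      · omega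
      · omega
      · exact jac_y1_x_x hn h5 a hj hp hi hq hl
      · exact jac_y1_x_y h5 a hj hp hi hq hl
    · obtain ⟨l, rfl, e'', hl⟩ | ⟨l, rfl, e'', hl⟩ | ⟨q, l, rfl, e'', hq, hl⟩ |
        ⟨q, l, rfl, e'', hq, hl⟩ := hr
      · omega
      · omega
      · omega
      · exact jac_y1_y_y h5 a hj hp hi hq hl
  · exact high (by omega)
  · exact high (by omega)

theorem jac_vec (hn : Odd n) (h5 : 5 ≤ n) (a : ℂ) {s t r : Sym}
    (hs : s.Valid n) (ht : t.Valid n) (hr : r.Valid n) :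
    jac n a (vec n s) (vec n t) (vec n r) = 0 := by
  rcases le_total (rank s) (rank t) with h1 | h1 <;>
  rcases le_total (rank t) (rank r) with h2 | h2 <;>
  rcases le_total (rank s) (rank r) with h3 | h3
  · exact jac_sorted hn h5 a hs ht hr h1 h2
  · exact jac_sorted hn h5 a hs ht hr h1 h2
  · rw [jac_swap₂, jac_sorted hn h5 a hs hr ht h3 h2, neg_zero]
  · rw [jac_swap₂, jac_swap₁, jac_sorted hn h5 a hr hs ht h3 h1, neg_zero, neg_zero]
  · rw [jac_swap₁, jac_sorted hn h5 a ht hs hr h1 h3, neg_zero]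
  · rw [jac_swap₁, jac_swap₂, jac_sorted hn h5 a ht hr hs h2 h3, neg_zero, neg_zero]
  · rw [jac_swap₁, jac_swap₂, jac_swap₁, jac_sorted hn h5 a hr ht hs h2 h1]
    simp
  · rw [jac_swap₁, jac_swap₂, jac_swap₁, jac_sorted hn h5 a hr ht hs h2 h1]
    simp

theorem br_leibniz (hn : Odd n) (h5 : 5 ≤ n) (a : ℂ) (u v w : GN n) :
    br n a a u (br n a a v w) = br n a a (br n a a u v) w + br n a a v (br n a a u w) := by
  induction u using Finsupp.induction_linear with
  | zero => simp
  | add u u' h h' => simp only [map_add, LinearMap.add_apply, h, h']; abel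
  | single s r =>
    induction v using Finsupp.induction_linear with
    | zero => simp
    | add u u' h h' => simp only [map_add, LinearMap.add_apply, h, h']; abel
    | single t r' =>
      induction w using Finsupp.induction_linear with
      | zero => simp
      | add u u' h h' => simp only [map_add, h, h']; abel
      | single q r'' =>
        have key := jac_vec hn h5 a s.2 t.2 q.2
        have hsm : ∀ (s : Idx n) (r : ℂ), Finsupp.single s r = r • vec n s.1 := by
          intro s r
          simp [vec_of_valid s.2]
        simp only [jac, sub_sub, sub_eq_zero] at key
        simp only [hsm, map_smul, LinearMap.smul_apply]
        rw [key]
        module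

theorem half_diff (a b a' b' : ℂ) (s t : Sym) :
    ∃ (r : ℂ) (i : ℕ), half n a b s t = half n a' b' s t + r • vec n (.y (n - 1) i) := by
  rcases s with _ | ⟨p, j⟩ | ⟨p, j⟩ <;> rcases t with _ | ⟨q, i⟩ | ⟨q, i⟩ <;>
    first
    | (refine ⟨0, 0, ?_⟩; simp [half]; done)
    | (simp only [half]
       split_ifs <;>
        first
        | (refine ⟨0, 0, ?_⟩; simp; done)
        | exact ⟨_, _, by rw [← add_smul]; congr 1; exact (add_sub_cancel _ _).symm⟩)

/-- Up to central elements the bracket of `𝒢𝒩(a,b)` does not depend on `a`, `b`. -/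
theorem br_br_indep (h5 : 5 ≤ n) (a b a₁ b₁ a₂ b₂ : ℂ) (u v w : GN n) :
    br n a b u (br n a₁ b₁ v w) = br n a b u (br n a₂ b₂ v w) := by
  have : (br n a₁ b₁).compr₂ (br n a b u) = (br n a₂ b₂).compr₂ (br n a b u) := by
    refine hom_ext fun s hs => hom_ext fun t ht => ?_
    simp only [LinearMap.compr₂_apply, br_vec hs ht]
    obtain ⟨r, i, h⟩ := half_diff a₁ b₁ a₂ b₂ s t
    obtain ⟨r', i', h'⟩ := half_diff a₁ b₁ a₂ b₂ t s
    rw [h, h']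
    simp [br_y_last h5]
  exact LinearMap.congr_fun (LinearMap.congr_fun this v) w


theorem actE_x {k i : ℕ} (h : (Sym.x k i).Valid n) :
    actE n (vec n (.x k i)) = ((i : ℂ) - 1) • vec n (.x k (i - 1)) := by
  simp [actE, vec_of_valid h]

theorem actE_y {k i : ℕ} (h : (Sym.y k i).Valid n) :
    actE n (vec n (.y k i)) = ((i : ℂ) - 1) • vec n (.y k (i - 1)) := by
  simp [actE, vec_of_valid h]

theorem actF_x {k i : ℕ} (h : (Sym.x k i).Valid n) :
    actF n (vec n (.x k i)) = ((k : ℂ) + 1 - i) • vec n (.x k (i + 1)) := by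
  simp [actF, vec_of_valid h]

theorem actF_y {k i : ℕ} (h : (Sym.y k i).Valid n) :
    actF n (vec n (.y k i)) = ((k : ℂ) + 1 - i) • vec n (.y k (i + 1)) := by
  simp [actF, vec_of_valid h]

theorem actH_x {k i : ℕ} (h : (Sym.x k i).Valid n) :
    actH n (vec n (.x k i)) = ((k : ℂ) + 2 - 2 * i) • vec n (.x k i) := by
  simp [actH, vec_of_valid h]

theorem actH_y {k i : ℕ} (h : (Sym.y k i).Valid n) :
    actH n (vec n (.y k i)) = ((k : ℂ) + 2 - 2 * i) • vec n (.y k i) := by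
  simp [actH, vec_of_valid h]

theorem actE_c : actE n (vec n .c) = 0 := by
  simp [actE, vec_of_valid (n := n) (s := .c) trivial]

theorem actF_c : actF n (vec n .c) = 0 := by
  simp [actF, vec_of_valid (n := n) (s := .c) trivial]

theorem actH_c : actH n (vec n .c) = 0 := by
  simp [actH, vec_of_valid (n := n) (s := .c) trivial]

/-- A family of vectors on which `e` and `f` act as on a standard basis of the irreducible module
of highest weight `k`. -/
def Fam (n k : ℕ) (U : ℕ → GN n) : Prop :=
  ∀ i, 1 ≤ i → i ≤ k + 1 → actE n (U i) = ((i : ℂ) - 1) • U (i - 1) ∧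
    actF n (U i) = ((k : ℂ) + 1 - i) • U (i + 1)

theorem fam_x {k : ℕ} (h1 : 1 ≤ k) (h2 : k ≤ n) : Fam n k fun i => vec n (.x k i) := by
  intro i hi hi'
  exact ⟨actE_x ⟨h1, h2, hi, hi'⟩, actF_x ⟨h1, h2, hi, hi'⟩⟩

theorem fam_y {k : ℕ} (h1 : 1 ≤ k) (h2 : k ≤ n) (h3 : k ≠ 2) :
    Fam n k fun i => vec n (.y k i) := by
  intro i hi hi'
  exact ⟨actE_y ⟨h1, h2, h3, hi, hi'⟩, actF_y ⟨h1, h2, h3, hi, hi'⟩⟩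

theorem fam_zero {k : ℕ} : Fam n k fun _ => 0 := by
  intro i hi hi'
  simp

theorem fam_c : Fam n 0 fun _ => vec n .c := by
  intro i hi hi'
  obtain rfl : i = 1 := by omega
  simp [actE_c, actF_c]

/-- The two ways in which two families are multiplied. -/
def Good (n : ℕ) (a : ℂ) (p q : ℕ) (U W : ℕ → GN n) : Prop :=
  (∃ (r : ℂ) (V : ℕ → GN n), Fam n (p + q) V ∧ ∀ j i, 1 ≤ j ∧ j ≤ p + 1 → 1 ≤ i ∧ i ≤ q + 1 →
    br n a a (U j) (W i) = r • V (i + j - 1)) ∨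
  (∃ (r : ℂ) (d : ℕ) (V : ℕ → GN n), d + 2 = p + q ∧ Fam n d V ∧
    ∀ j i, 1 ≤ j ∧ j ≤ p + 1 → 1 ≤ i ∧ i ≤ q + 1 →
    br n a a (U j) (W i) = (r * (((i : ℂ) - 1) * p - ((j : ℂ) - 1) * q)) • V (i + j - 2))

theorem good_zero {a : ℂ} {p q : ℕ} {U W : ℕ → GN n}
    (h : ∀ j i, 1 ≤ j ∧ j ≤ p + 1 → 1 ≤ i ∧ i ≤ q + 1 → br n a a (U j) (W i) = 0) :
    Good n a p q U W :=
  Or.inl ⟨0, _, fam_zero, fun j i hj hi => by rw [h j i hj hi, zero_smul]⟩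

theorem good_E {a : ℂ} {p q : ℕ} {U W : ℕ → GN n} (hU : Fam n p U) (hW : Fam n q W)
    (h : Good n a p q U W) {j i : ℕ} (hj : 1 ≤ j ∧ j ≤ p + 1) (hi : 1 ≤ i ∧ i ≤ q + 1) :
    actE n (br n a a (U j) (W i)) =
      br n a a (actE n (U j)) (W i) + br n a a (U j) (actE n (W i)) := by
  rw [(hU j hj.1 hj.2).1, (hW i hi.1 hi.2).1, map_smul, map_smul, LinearMap.smul_apply]
  obtain ⟨j, rfl⟩ := Nat.exists_eq_add_of_le' hj.1
  obtain ⟨i, rfl⟩ := Nat.exists_eq_add_of_le' hi.1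
  rcases h with ⟨r, V, hV, hB⟩ | ⟨r, d, V, hd, hV, hB⟩
  · rw [hB _ _ hj hi, map_smul, (hV _ (by omega) (by omega)).1]
    have e : i + 1 + (j + 1) - 1 = i + j + 1 := by omega
    rw [e]
    have h1 : ((j : ℂ)) • br n a a (U j) (W (i + 1)) = (j * r : ℂ) • V (i + j) := by
      rcases Nat.eq_zero_or_pos j with rfl | hj'
      · simp
      · rw [hB _ _ (by omega) hi, smul_smul, show i + 1 + j - 1 = i + j by omega]
    have h2 : ((i : ℂ)) • br n a a (U (j + 1)) (W i) = (i * r : ℂ) • V (i + j) := by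
      rcases Nat.eq_zero_or_pos i with rfl | hi'
      · simp
      · rw [hB _ _ hj (by omega), smul_smul, show i + (j + 1) - 1 = i + j by omega]
    simp only [Nat.add_sub_cancel, Nat.cast_add, Nat.cast_one, add_sub_cancel_right]
    rw [h1, h2]
    module
  · have h1 : ((j : ℂ)) • br n a a (U j) (W (i + 1)) =
        (j * (r * (i * p - ((j : ℂ) - 1) * q))) • V (i + j - 1) := by
      rcases Nat.eq_zero_or_pos j with rfl | hj'
      · simp
      · rw [hB _ _ (by omega) hi, smul_smul, show i + 1 + j - 2 = i + j - 1 by omega]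
        push_cast
        congr 3
        ring
    have h2 : ((i : ℂ)) • br n a a (U (j + 1)) (W i) =
        (i * (r * (((i : ℂ) - 1) * p - (j : ℂ) * q))) • V (i + j - 1) := by
      rcases Nat.eq_zero_or_pos i with rfl | hi'
      · simp
      · rw [hB _ _ hj (by omega), smul_smul, show i + (j + 1) - 2 = i + j - 1 by omega]
        push_cast
        congr 3
        ring
    have h3 : actE n (br n a a (U (j + 1)) (W (i + 1))) =
        (r * ((i : ℂ) * p - (j : ℂ) * q) * ((i : ℂ) + j - 1)) • V (i + j - 1) := by
      rw [hB _ _ hj hi, map_smul, show i + 1 + (j + 1) - 2 = i + j by omega]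
      rcases Nat.eq_zero_or_pos (i + j) with h0 | h0
      · obtain rfl : i = 0 := by omega
        obtain rfl : j = 0 := by omega
        simp
      by_cases h0' : i + j = d + 2
      · obtain rfl : i = q := by omega
        obtain rfl : j = p := by omega
        have : ((((i + 1 : ℕ) : ℂ) - 1) * j - (((j + 1 : ℕ) : ℂ) - 1) * i) = 0 := by
          push_cast; ring
        rw [this, mul_comm (i : ℂ)]
        simp
      · rw [(hV _ h0 (by omega)).1, smul_smul]
        push_cast
        congr 1
        ring
    simp only [Nat.add_sub_cancel, Nat.cast_add, Nat.cast_one, add_sub_cancel_right]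
    rw [h1, h2, h3, ← add_smul]
    congr 1
    ring

theorem good_F {a : ℂ} {p q : ℕ} {U W : ℕ → GN n} (hU : Fam n p U) (hW : Fam n q W)
    (h : Good n a p q U W) {j i : ℕ} (hj : 1 ≤ j ∧ j ≤ p + 1) (hi : 1 ≤ i ∧ i ≤ q + 1) :
    actF n (br n a a (U j) (W i)) =
      br n a a (actF n (U j)) (W i) + br n a a (U j) (actF n (W i)) := by
  rw [(hU j hj.1 hj.2).2, (hW i hi.1 hi.2).2, map_smul, map_smul, LinearMap.smul_apply]
  rcases h with ⟨r, V, hV, hB⟩ | ⟨r, d, V, hd, hV, hB⟩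
  · rw [hB _ _ hj hi, map_smul, (hV _ (by omega) (by omega)).2]
    have e : ((i + j - 1 : ℕ) : ℂ) = (i : ℂ) + j - 1 := by
      rw [Nat.cast_sub (by omega)]
      simp
    rw [e, show i + j - 1 + 1 = i + j by omega]
    have h1 : ((p : ℂ) + 1 - j) • br n a a (U (j + 1)) (W i) =
        (((p : ℂ) + 1 - j) * r) • V (i + j) := by
      by_cases hj' : j = p + 1
      · subst hj'; simp
      · rw [hB _ _ (by omega) hi, smul_smul, show i + (j + 1) - 1 = i + j by omega]
    have h2 : ((q : ℂ) + 1 - i) • br n a a (U j) (W (i + 1)) =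
        (((q : ℂ) + 1 - i) * r) • V (i + j) := by
      by_cases hi' : i = q + 1
      · subst hi'; simp
      · rw [hB _ _ hj (by omega), smul_smul, show i + 1 + j - 1 = i + j by omega]
    rw [h1, h2]
    push_cast
    module
  · have hdc : (d : ℂ) = p + q - 2 := by
      have : ((d + 2 : ℕ) : ℂ) = ((p + q : ℕ) : ℂ) := by rw [hd]
      push_cast at this
      linear_combination this
    have h1 : ((p : ℂ) + 1 - j) • br n a a (U (j + 1)) (W i) =
        (((p : ℂ) + 1 - j) * (r * (((i : ℂ) - 1) * p - j * q))) • V (i + j - 1) := by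
      by_cases hj' : j = p + 1
      · subst hj'; simp
      · rw [hB _ _ (by omega) hi, smul_smul, show i + (j + 1) - 2 = i + j - 1 by omega]
        push_cast
        congr 3
        ring
    have h2 : ((q : ℂ) + 1 - i) • br n a a (U j) (W (i + 1)) =
        (((q : ℂ) + 1 - i) * (r * ((i : ℂ) * p - ((j : ℂ) - 1) * q))) • V (i + j - 1) := by
      by_cases hi' : i = q + 1
      · subst hi'; simp
      · rw [hB _ _ hj (by omega), smul_smul, show i + 1 + j - 2 = i + j - 1 by omega]
        push_cast
        congr 3
        ring
    have h3 : actF n (br n a a (U j) (W i)) =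
        (r * (((i : ℂ) - 1) * p - ((j : ℂ) - 1) * q) * ((p : ℂ) + q + 1 - i - j)) •
          V (i + j - 1) := by
      rw [hB _ _ hj hi, map_smul]
      rcases Nat.eq_zero_or_pos (i + j - 2) with h0 | h0
      · obtain rfl : i = 1 := by omega
        obtain rfl : j = 1 := by omega
        simp
      by_cases h0' : i + j = d + 4
      · obtain rfl : i = q + 1 := by omega
        obtain rfl : j = p + 1 := by omega
        have : ((((q + 1 : ℕ) : ℂ) - 1) * p - (((p + 1 : ℕ) : ℂ) - 1) * q) = 0 := by
          push_cast; ring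
        rw [this]
        simp
      · have e : ((i + j - 2 : ℕ) : ℂ) = (i : ℂ) + j - 2 := by
          rw [Nat.cast_sub (by omega)]
          simp
        rw [(hV _ h0 (by omega)).2, smul_smul, e, hdc, show i + j - 2 + 1 = i + j - 1 by omega]
        congr 1
        ring
    rw [h1, h2, h3, ← add_smul]
    congr 1
    ring

/-- The failure of `D` to be a derivation. -/
def dfail (n : ℕ) (a : ℂ) (D : GN n →ₗ[ℂ] GN n) (u v : GN n) : GN n :=
  D (br n a a u v) - (br n a a (D u) v + br n a a u (D v))

theorem dfail_swap (a : ℂ) (D : GN n →ₗ[ℂ] GN n) (u v : GN n) :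
    dfail n a D u v = - dfail n a D v u := by
  simp only [dfail]
  rw [br_skew a a u v, br_skew a a u (D v), br_skew a a (D u) v, map_neg]
  abel

theorem good_xx (hn : Odd n) (h5 : 5 ≤ n) (a : ℂ) {p q : ℕ} (hp : 1 ≤ p ∧ p ≤ n)
    (hq : 1 ≤ q ∧ q ≤ n) (hpq : p = 1 ∨ q ≠ 1) :
    Good n a p q (fun i => vec n (.x p i)) (fun i => vec n (.x q i)) := by
  by_cases h1 : p = 1
  · subst h1
    by_cases h2 : q = 1
    · subst h2
      exact Or.inr ⟨1, 0, _, rfl, fam_c, fun j i hj hi => by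
        rw [br_x1_x1 h5 a (by omega) (by omega)]; push_cast; congr 1; ring⟩
    by_cases h3 : q = n
    · subst h3
      exact good_zero fun j i hj hi => br_x1_xn h5 a (by omega) (by omega)
    · exact Or.inl ⟨1, _, fam_x (k := 1 + q) (by omega) (by omega), fun j i hj hi => by
        rw [br_x1_x h5 a (by omega) (by omega) (by omega), one_smul, add_comm 1 q]⟩
  · by_cases h4 : p + q = n + 1
    · exact Or.inr ⟨_, n - 1, _, by omega, fam_y (by omega) (by omega) (by omega),
        fun j i hj hi => br_x_x_n1 hn h5 a (by omega) (by omega) h4 hj hi⟩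
    by_cases h6 : p + q = n
    · exact Or.inl ⟨_, fun i => vec n (.y n i), h6 ▸ fam_y (by omega) (by omega) (by omega),
        fun j i hj hi => br_x_x_n hn h5 a (by omega) (by omega) h6 hj hi⟩
    · exact good_zero fun j i hj hi => br_x_x_zero a (by omega) (by omega) h6 h4

theorem good_xy (h5 : 5 ≤ n) (a : ℂ) {p q : ℕ} (hp : 1 ≤ p ∧ p ≤ n)
    (hq : 1 ≤ q ∧ q ≤ n ∧ q ≠ 2) (hpq : p = 1 ∨ q ≠ 1) :
    Good n a p q (fun i => vec n (.x p i)) (fun i => vec n (.y q i)) := by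
  by_cases h1 : p = 1
  · subst h1
    by_cases h2 : q = 1
    · subst h2
      exact Or.inl ⟨1, _, fam_x (k := 1 + 1) (by omega) (by omega), fun j i hj hi => by
        rw [br_x1_y1 h5 a (by omega) (by omega), one_smul]⟩
    by_cases h3 : q = n
    · subst h3
      exact Or.inr ⟨a, q - 1, _, by omega, fam_y (by omega) (by omega) (by omega),
        fun j i hj hi => by
          rw [br_x1_yn h5 a (by omega) (by omega)]; push_cast; rw [mul_one]⟩
    · exact good_zero fun j i hj hi => br_x1_y h5 a (by omega) (by omega) (by omega)
  · exact good_zero fun j i hj hi => br_x_y a (by omega) (by omega)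

theorem good_yx (h5 : 5 ≤ n) (a : ℂ) {q : ℕ} (hq : 2 ≤ q ∧ q ≤ n) :
    Good n a 1 q (fun i => vec n (.y 1 i)) (fun i => vec n (.x q i)) := by
  by_cases h2 : q = 2
  · subst h2
    exact Or.inl ⟨1, _, fam_y (k := 1 + 2) (by omega) (by omega) (by omega), fun j i hj hi => by
        rw [br_y1_x2 h5 a (by omega) (by omega), one_smul]⟩
  by_cases h3 : q = n
  · subst h3
    exact Or.inr ⟨-a, q - 1, _, by omega, fam_y (by omega) (by omega) (by omega),
        fun j i hj hi => by
          rw [br_y1_xn h5 a (by omega) (by omega)]; push_cast; rw [mul_one]⟩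
  by_cases h4 : q = n - 1
  · subst h4
    refine Or.inl ⟨1, fun i => vec n (.y n i), ?_, fun j i hj hi => by
        rw [br_y1_xm h5 a (by omega) (by omega), one_smul]⟩
    rw [show 1 + (n - 1) = n by omega]
    exact fam_y (by omega) (by omega) (by omega)
  · exact good_zero fun j i hj hi => br_y1_x h5 a (by omega) (by omega) (by omega)

theorem good_yy (h5 : 5 ≤ n) (a : ℂ) {p q : ℕ} (hp : 1 ≤ p ∧ p ≤ n)
    (hq : 1 ≤ q ∧ q ≤ n ∧ q ≠ 2) (hpq : p = 1 ∨ q ≠ 1) :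
    Good n a p q (fun i => vec n (.y p i)) (fun i => vec n (.y q i)) := by
  by_cases h1 : p = 1
  · subst h1
    by_cases h2 : q = 1
    · subst h2
      exact Or.inr ⟨1, 0, _, rfl, fam_c, fun j i hj hi => by
        rw [br_y1_y1 h5 a (by omega) (by omega)]; push_cast; congr 1; ring⟩
    by_cases h3 : q = n
    · subst h3
      exact good_zero fun j i hj hi => br_y1_yn h5 a (by omega) (by omega)
    by_cases h4 : q = n - 1
    · subst h4
      exact good_zero fun j i hj hi => br_y_last h5 a a _ _
    · exact Or.inl ⟨1, _, fam_y (k := 1 + q) (by omega) (by omega) (by omega), fun j i hj hi => by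
        rw [br_y1_y h5 a (by omega) (by omega) (by omega), one_smul, add_comm 1 q]⟩
  · exact good_zero fun j i hj hi => br_y_y a (by omega) (by omega)

theorem dfail_sorted (hn : Odd n) (h5 : 5 ≤ n) (a : ℂ) {s t : Sym}
    (hs : s.Valid n) (ht : t.Valid n) (h1 : rank s ≤ rank t) :
    dfail n a (actE n) (vec n s) (vec n t) = 0 ∧ dfail n a (actF n) (vec n s) (vec n t) = 0 := by
  simp only [dfail, sub_eq_zero]
  rcases t with _ | ⟨q, i⟩ | ⟨q, i⟩
  · simp [br_c, actE_c, actF_c]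
  all_goals
    obtain _ | ⟨p, j⟩ | ⟨p, j⟩ := s
    on_goal 1 => exfalso; revert h1; simp only [rank]; split_ifs <;> omega
    all_goals
      simp only [rank] at h1
      simp only [Sym.Valid] at hs ht
  · have hg := good_xx hn h5 a (p := p) (q := q) (by omega) (by omega) (by
      by_contra h; push Not at h; simp [h.1, h.2] at h1)
    exact ⟨good_E (fam_x (by omega) (by omega)) (fam_x (by omega) (by omega)) hg (by omega) (by omega), good_F (fam_x (by omega) (by omega)) (fam_x (by omega) (by omega))
      hg (by omega) (by omega)⟩
  · obtain rfl : p = 1 := by by_contra h; revert h1; simp [h]; split_ifs <;> omega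
    have hg := good_yx h5 a (q := q) (by
      refine ⟨?_, by omega⟩; by_contra h; obtain rfl : q = 1 := by omega
      simp at h1)
    exact ⟨good_E (fam_y (by omega) (by omega) (by omega)) (fam_x (by omega) (by omega)) hg (by omega) (by omega), good_F (fam_y (by omega) (by omega) (by omega))
      (fam_x (by omega) (by omega))
      hg (by omega) (by omega)⟩
  · have hg := good_xy h5 a (p := p) (q := q) (by omega) (by omega) (by
      by_contra h; push Not at h; simp [h.1, h.2] at h1)
    exact ⟨good_E (fam_x (by omega) (by omega)) (fam_y (by omega) (by omega) (by omega)) hg (by omega) (by omega), good_F (fam_x (by omega) (by omega))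
      (fam_y (by omega) (by omega) (by omega))
      hg (by omega) (by omega)⟩
  · have hg := good_yy h5 a (p := p) (q := q) (by omega) (by omega) (by
      by_contra h; push Not at h; simp [h.1, h.2] at h1)
    exact ⟨good_E (fam_y (by omega) (by omega) (by omega)) (fam_y (by omega) (by omega) (by omega))
      hg (by omega) (by omega), good_F (fam_y (by omega) (by omega) (by omega))
      (fam_y (by omega) (by omega) (by omega))
      hg (by omega) (by omega)⟩

theorem dfail_vec (hn : Odd n) (h5 : 5 ≤ n) (a : ℂ) {s t : Sym}
    (hs : s.Valid n) (ht : t.Valid n) :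
    dfail n a (actE n) (vec n s) (vec n t) = 0 ∧ dfail n a (actF n) (vec n s) (vec n t) = 0 := by
  rcases le_total (rank s) (rank t) with h1 | h1
  · exact dfail_sorted hn h5 a hs ht h1
  · rw [dfail_swap, dfail_swap _ (actF n)]
    simpa using dfail_sorted hn h5 a ht hs h1

theorem deriv_of_vec (a : ℂ) (D : GN n →ₗ[ℂ] GN n)
    (h : ∀ s t : Sym, s.Valid n → t.Valid n → dfail n a D (vec n s) (vec n t) = 0) (u v : GN n) :
    D (br n a a u v) = br n a a (D u) v + br n a a u (D v) := by
  have : (br n a a).compr₂ D = (br n a a).comp D + (br n a a).compl₂ D := by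
    refine hom_ext fun s hs => hom_ext fun t ht => ?_
    have := h s t hs ht
    rw [dfail, sub_eq_zero] at this
    simpa using this
  exact LinearMap.congr_fun (LinearMap.congr_fun this u) v

theorem act_comm_EF (u : GN n) : actE n (actF n u) - actF n (actE n u) = actH n u := by
  have : actE n ∘ₗ actF n - actF n ∘ₗ actE n = actH n := by
    refine hom_ext fun s hs => ?_
    simp only [LinearMap.sub_apply, LinearMap.comp_apply]
    rcases s with _ | ⟨k, i⟩ | ⟨k, i⟩
    · simp [actE_c, actF_c, actH_c]
    · rw [actE_x hs, actF_x hs, actH_x hs, map_smul, map_smul]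
      obtain ⟨h1, h2, h3, h4⟩ := hs
      have hF : ((k : ℂ) + 1 - i) • actE n (vec n (.x k (i + 1))) =
          (((k : ℂ) + 1 - i) * i) • vec n (.x k i) := by
        by_cases h : i = k + 1
        · subst h; simp
        · rw [actE_x ⟨h1, h2, by omega, by omega⟩, smul_smul]
          simp
      have hE : ((i : ℂ) - 1) • actF n (vec n (.x k (i - 1))) =
          (((i : ℂ) - 1) * (k + 2 - i)) • vec n (.x k i) := by
        by_cases h : i = 1
        · subst h; simp
        · rw [actF_x ⟨h1, h2, by omega, by omega⟩, smul_smul, Nat.cast_sub (by omega),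
            show i - 1 + 1 = i by omega]
          congr 1; push_cast; ring
      rw [hF, hE, ← sub_smul]
      congr 1; ring
    · rw [actE_y hs, actF_y hs, actH_y hs, map_smul, map_smul]
      obtain ⟨h1, h2, h2', h3, h4⟩ := hs
      have hF : ((k : ℂ) + 1 - i) • actE n (vec n (.y k (i + 1))) =
          (((k : ℂ) + 1 - i) * i) • vec n (.y k i) := by
        by_cases h : i = k + 1
        · subst h; simp
        · rw [actE_y ⟨h1, h2, h2', by omega, by omega⟩, smul_smul]
          simp
      have hE : ((i : ℂ) - 1) • actF n (vec n (.y k (i - 1))) =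
          (((i : ℂ) - 1) * (k + 2 - i)) • vec n (.y k i) := by
        by_cases h : i = 1
        · subst h; simp
        · rw [actF_y ⟨h1, h2, h2', by omega, by omega⟩, smul_smul, Nat.cast_sub (by omega),
            show i - 1 + 1 = i by omega]
          congr 1; push_cast; ring
      rw [hF, hE, ← sub_smul]
      congr 1; ring
  exact LinearMap.congr_fun this u

theorem act_comm_HE (u : GN n) : actH n (actE n u) - actE n (actH n u) = (2 : ℂ) • actE n u := by
  have : actH n ∘ₗ actE n - actE n ∘ₗ actH n = (2 : ℂ) • actE n := by
    refine hom_ext fun s hs => ?_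
    simp only [LinearMap.sub_apply, LinearMap.comp_apply, LinearMap.smul_apply]
    rcases s with _ | ⟨k, i⟩ | ⟨k, i⟩
    · simp [actE_c, actH_c]
    · rw [actH_x hs, map_smul, actE_x hs, map_smul]
      obtain ⟨h1, h2, h3, h4⟩ := hs
      by_cases h : i = 1
      · subst h; simp
      · rw [actH_x ⟨h1, h2, by omega, by omega⟩, Nat.cast_sub (by omega)]
        push_cast
        module
    · rw [actH_y hs, map_smul, actE_y hs, map_smul]
      obtain ⟨h1, h2, h2', h3, h4⟩ := hs
      by_cases h : i = 1
      · subst h; simp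
      · rw [actH_y ⟨h1, h2, h2', by omega, by omega⟩, Nat.cast_sub (by omega)]
        push_cast
        module
  exact LinearMap.congr_fun this u

theorem act_comm_HF (u : GN n) :
    actH n (actF n u) - actF n (actH n u) = (-2 : ℂ) • actF n u := by
  have : actH n ∘ₗ actF n - actF n ∘ₗ actH n = (-2 : ℂ) • actF n := by
    refine hom_ext fun s hs => ?_
    simp only [LinearMap.sub_apply, LinearMap.comp_apply, LinearMap.smul_apply]
    rcases s with _ | ⟨k, i⟩ | ⟨k, i⟩
    · simp [actF_c, actH_c]
    · rw [actH_x hs, map_smul, actF_x hs, map_smul]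
      obtain ⟨h1, h2, h3, h4⟩ := hs
      by_cases h : i = k + 1
      · subst h; simp
      · rw [actH_x ⟨h1, h2, by omega, by omega⟩]
        push_cast
        module
    · rw [actH_y hs, map_smul, actF_y hs, map_smul]
      obtain ⟨h1, h2, h2', h3, h4⟩ := hs
      by_cases h : i = k + 1
      · subst h; simp
      · rw [actH_y ⟨h1, h2, h2', by omega, by omega⟩]
        push_cast
        module
  exact LinearMap.congr_fun this u

theorem act_br (hn : Odd n) (h5 : 5 ≤ n) (a : ℂ) (A : SL2) (u v : GN n) :
    act n A (br n a a u v) = br n a a (act n A u) v + br n a a u (act n A v) := by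
  have hE := deriv_of_vec a (actE n) fun s t hs ht => (dfail_vec hn h5 a hs ht).1
  have hF := deriv_of_vec a (actF n) fun s t hs ht => (dfail_vec hn h5 a hs ht).2
  have hH : ∀ u v, actH n (br n a a u v) = br n a a (actH n u) v + br n a a u (actH n v) := by
    intro u v
    simp only [← act_comm_EF, hE, hF, map_add, map_sub, LinearMap.sub_apply]
    abel
  simp only [act, LinearMap.add_apply, LinearMap.smul_apply, hE, hF, hH, map_add, map_smul]
  module

theorem act_lie (A B : SL2) (u : GN n) :
    act n ⁅A, B⁆ u = act n A (act n B u) - act n B (act n A u) := by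
  have hA : A.1 1 1 = - A.1 0 0 := by
    have : Matrix.trace A.1 = 0 := A.2
    rw [Matrix.trace_fin_two] at this
    linear_combination this
  have hB : B.1 1 1 = - B.1 0 0 := by
    have : Matrix.trace B.1 = 0 := B.2
    rw [Matrix.trace_fin_two] at this
    linear_combination this
  have h1 := act_comm_EF u
  have h2 := act_comm_HE u
  have h3 := act_comm_HF u
  simp only [act, LieAlgebra.SpecialLinear.sl_bracket, Matrix.sub_apply, Matrix.mul_apply,
    Fin.sum_univ_two, LinearMap.add_apply, LinearMap.smul_apply, map_add, map_smul, hA, hB]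
  rw [sub_eq_iff_eq_add] at h1 h2 h3
  rw [h1, h2, h3]
  module


theorem acts_irrefl (t : Fin k) : ¬ Acts star t t := by
  simp [Acts]

theorem acts_asymm {i j : Fin k} (h : Acts star i j) : ¬ Acts star j i := by
  unfold Acts at *
  rcases h with ⟨h, h'⟩ | ⟨h, h'⟩ <;> rintro (⟨g, g'⟩ | ⟨g, g'⟩)
  · omega
  · simp_all
  · simp_all
  · omega

theorem acts_total {i j : Fin k} (h : i ≠ j) : Acts star i j ∨ Acts star j i := by
  unfold Acts
  rcases lt_or_gt_of_ne h with h | h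
  · rcases hs : star i <;> simp [h]
  · rcases hs : star j <;> simp [h]

theorem acts_trans {i j t : Fin k} (h : Acts star i j) (h' : Acts star j t) : Acts star i t := by
  rcases eq_or_ne i t with rfl | hne
  · exact absurd h' (acts_asymm h)
  unfold Acts at *
  rcases h with ⟨h, e⟩ | ⟨h, e⟩ <;> rcases h' with ⟨h', e'⟩ | ⟨h', e'⟩
  · exact Or.inl ⟨h'.trans h, e'⟩
  · simp_all
  · rcases lt_or_gt_of_ne hne with g | g
    · exact Or.inr ⟨g, e⟩
    · exact Or.inl ⟨g, e'⟩
  · exact Or.inr ⟨h.trans h', e⟩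

open Classical in
theorem sum_acts {M : Type*} [AddCommGroup M] (t : Fin k) (f : Fin k → Fin k → M) :
    ∑ j with Acts star j t, (f j j + ∑ i with Acts star i j, (f i j + f j i)) =
      ∑ i with Acts star i t, ∑ j with Acts star j t, f i j := by
  simp only [Finset.sum_filter]
  have e1 : ∑ j, (if Acts star j t then f j j + (∑ i, (if Acts star i j then f i j + f j i else 0))
      else 0) = ∑ j, ∑ i, ((if Acts star j t then ((if i = j then f i j else 0) +
        (if Acts star i j then f i j else 0)) else 0)) +
        ∑ j, ∑ i, (if Acts star j t then (if Acts star i j then f j i else 0) else 0) := by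
    rw [← Finset.sum_add_distrib]
    refine Finset.sum_congr rfl fun j _ => ?_
    rw [← Finset.sum_add_distrib]
    split_ifs with h
    · simp only [add_assoc, Finset.sum_add_distrib]
      congr 1
      · simp
      · rw [← Finset.sum_add_distrib]
        refine Finset.sum_congr rfl fun i _ => ?_
        split_ifs <;> simp
    · simp
  rw [e1, Finset.sum_comm, ← Finset.sum_add_distrib]
  simp only [← Finset.sum_add_distrib]
  refine Finset.sum_congr rfl fun i _ => ?_
  by_cases hi : Acts star i t
  · rw [if_pos hi]
    refine Finset.sum_congr rfl fun j _ => ?_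
    by_cases hj : Acts star j t
    · by_cases hij : i = j
      · subst hij
        simp [hi, acts_irrefl]
      · rcases acts_total (star := star) hij with h | h
        · simp [hi, hj, h, acts_asymm h, hij]
        · simp [hi, hj, h, acts_asymm h, hij]
    · have : ¬ Acts star j i := fun h => hj (acts_trans h hi)
      simp [hj, this]
  · rw [if_neg hi]
    refine Finset.sum_eq_zero fun j _ => ?_
    by_cases hj : Acts star j t
    · have h1 : ¬ Acts star i j := fun h => hi (acts_trans h hj)
      have h2 : i ≠ j := fun h => hi (h ▸ hj)
      simp [hj, hi, h1, h2]
    · simp [hj, hi]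

open Classical in
/-- The sum of the components that act on the component `t`. -/
def up (star : Fin k → SemiDir) (F : Fin k → GN n) (t : Fin k) : GN n :=
  ∑ j with Acts star j t, F j

theorem nilBr_eq (F G : Fin k → GN n) (t : Fin k) :
    nilBr n star a b F G t = br n (a t) (b t) (F t + up star F t) (G t + up star G t) -
      br n (a t) (b t) (up star F t) (up star G t) := by
  classical
  have h1 : ∑ j with Acts star j t, (br n (a t) (b t) (F j) (G t) - br n (a t) (b t) (G j) (F t)) =
      br n (a t) (b t) (up star F t) (G t) - br n (a t) (b t) (up star G t) (F t) := by
    simp only [up, map_sum, LinearMap.sum_apply, Finset.sum_sub_distrib]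
  have h2 : nilBr n star a b F G t = br n (a t) (b t) (F t) (G t) +
      ∑ j with Acts star j t, (br n (a t) (b t) (F j) (G t) - br n (a t) (b t) (G j) (F t)) := rfl
  rw [h2, h1, br_skew (a t) (b t) (up star G t) (F t)]
  simp only [map_add, LinearMap.add_apply]
  abel

open Classical in
theorem br_nilBr (h5 : 5 ≤ n) (x y : ℂ) (Y : GN n) (F G : Fin k → GN n) (j : Fin k) :
    br n x y Y (nilBr n star a b F G j) = br n x y Y (br n x y (F j) (G j)) +
      ∑ i with Acts star i j,
        (br n x y Y (br n x y (F i) (G j)) + br n x y Y (br n x y (F j) (G i))) := by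
  have h2 : nilBr n star a b F G j = br n (a j) (b j) (F j) (G j) +
      ∑ i with Acts star i j, (br n (a j) (b j) (F i) (G j) - br n (a j) (b j) (G i) (F j)) := rfl
  rw [h2, map_add, map_sum, br_br_indep h5 x y (a j) (b j) x y]
  congr 1
  refine Finset.sum_congr rfl fun i _ => ?_
  rw [map_sub, br_br_indep h5 x y (a j) (b j) x y, br_br_indep h5 x y (a j) (b j) x y,
    br_skew x y (G i) (F j), map_neg, sub_neg_eq_add]

theorem br_up (h5 : 5 ≤ n) (x y : ℂ) (Y : GN n) (F G : Fin k → GN n) (t : Fin k) :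
    br n x y Y (up star (nilBr n star a b F G) t) =
      br n x y Y (br n x y (up star F t) (up star G t)) := by
  classical
  have key := sum_acts (star := star) t fun i j => br n x y Y (br n x y (F i) (G j))
  have h1 : br n x y Y (up star (nilBr n star a b F G) t) =
      ∑ j with Acts star j t, br n x y Y (nilBr n star a b F G j) := by
    rw [up, map_sum]
  have h2 : br n x y Y (br n x y (up star F t) (up star G t)) =
      ∑ i with Acts star i t, ∑ j with Acts star j t, br n x y Y (br n x y (F i) (G j)) := by
    simp only [up, map_sum, LinearMap.sum_apply]
    rw [Finset.sum_comm]
  rw [h1, h2, ← key]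
  exact Finset.sum_congr rfl fun j _ => br_nilBr h5 x y Y F G j

theorem br_nilBr_add_up (h5 : 5 ≤ n) (Y : GN n) (F G : Fin k → GN n) (t : Fin k) :
    br n (a t) (b t) Y (nilBr n star a b F G t + up star (nilBr n star a b F G) t) =
      br n (a t) (b t) Y (br n (a t) (b t) (F t + up star F t) (G t + up star G t)) := by
  rw [map_add, br_up h5, nilBr_eq, map_sub]
  abel

theorem nilBr_skew (F G : Fin k → GN n) : nilBr n star a b F G = - nilBr n star a b G F := by
  funext t
  rw [Pi.neg_apply, nilBr_eq, nilBr_eq, br_skew _ _ (F t + _), br_skew _ _ (up star F t)]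
  abel

theorem nilBr_self (F : Fin k → GN n) : nilBr n star a b F F = 0 := by
  funext t
  rw [nilBr_eq, br_self, br_self]
  simp

theorem up_add (F G : Fin k → GN n) (t : Fin k) : up star (F + G) t = up star F t + up star G t := by
  simp [up, Finset.sum_add_distrib]

theorem up_smul (r : ℂ) (F : Fin k → GN n) (t : Fin k) : up star (r • F) t = r • up star F t := by
  simp [up, Finset.smul_sum]

theorem nilBr_add (F G H : Fin k → GN n) :
    nilBr n star a b F (G + H) = nilBr n star a b F G + nilBr n star a b F H := by
  funext t
  simp only [Pi.add_apply, nilBr_eq, up_add, map_add, LinearMap.add_apply]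
  abel

theorem add_nilBr (F G H : Fin k → GN n) :
    nilBr n star a b (F + G) H = nilBr n star a b F H + nilBr n star a b G H := by
  rw [nilBr_skew, nilBr_add, nilBr_skew F, nilBr_skew G]
  abel

theorem nilBr_smul (r : ℂ) (F G : Fin k → GN n) :
    nilBr n star a b F (r • G) = r • nilBr n star a b F G := by
  funext t
  simp only [Pi.smul_apply, nilBr_eq, up_smul, ← smul_add, map_smul, smul_sub]

theorem nilBr_leibniz (hn : Odd n) (h5 : 5 ≤ n) (F G H : Fin k → GN n) :
    nilBr n star a a F (nilBr n star a a G H) =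
      nilBr n star a a (nilBr n star a a F G) H + nilBr n star a a G (nilBr n star a a F H) := by
  funext t
  rw [Pi.add_apply, nilBr_skew (nilBr n star a a F G) H, Pi.neg_apply,
    nilBr_eq F, nilBr_eq H, nilBr_eq G (nilBr n star a a F H)]
  simp only [br_nilBr_add_up h5, br_up h5]
  rw [br_leibniz hn h5 _ (F t + up star F t), br_leibniz hn h5 _ (up star F t),
    br_skew _ _ (H t + up star H t), br_skew _ _ (up star H t)]
  abel

theorem act_nilBr (hn : Odd n) (h5 : 5 ≤ n) (A : SL2) (F G : Fin k → GN n) (t : Fin k) :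
    act n A (nilBr n star a a F G t) =
      nilBr n star a a (fun s => act n A (F s)) G t +
        nilBr n star a a F (fun s => act n A (G s)) t := by
  have hup : ∀ F : Fin k → GN n, up star (fun s => act n A (F s)) t = act n A (up star F t) := by
    intro F
    simp [up]
  simp only [nilBr_eq, map_sub, act_br hn h5, hup, map_add, LinearMap.add_apply]
  abel

theorem act_add_left (A B : SL2) (u : GN n) : act n (A + B) u = act n A u + act n B u := by
  simp only [act, LinearMap.add_apply, LinearMap.smul_apply]
  have h : ∀ i j, (A + B).1 i j = A.1 i j + B.1 i j := fun _ _ => rfl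
  rw [h, h, h]
  module

theorem act_smul_left (r : ℂ) (A : SL2) (u : GN n) : act n (r • A) u = r • act n A u := by
  simp only [act, LinearMap.add_apply, LinearMap.smul_apply]
  have h : ∀ i j, (r • A).1 i j = r * A.1 i j := fun _ _ => rfl
  rw [h, h, h]
  module

end Proofs

theorem SlG.lie_def (u v : SlG n star a b) : ⁅u, v⁆ = ((⁅u.1, v.1⁆, fun t =>
    act n u.1 (v.2 t) - act n v.1 (u.2 t) + nilBr n star a b u.2 v.2 t) : SL2 × (Fin k → GN n)) :=
  rfl

/-- If `a_i = b_i` for all `i`, the product of `sl₂ ⋉ (N₀ * (N₁ * (⋯ * N_{k-1})))` satisfies the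
Jacobi identity, and we have a Lie algebra. -/
@[reducible]
def SlG.lieRing (hn : Odd n) (h5 : 5 ≤ n) (hab : ∀ i, a i = b i) : LieRing (SlG n star a b) where
  add_lie u v w := by
    refine Prod.ext (add_lie u.1 v.1 w.1) (funext fun t => ?_)
    change act n (u.1 + v.1) (w.2 t) - act n w.1 (u.2 t + v.2 t) +
      nilBr n star a b (u.2 + v.2) w.2 t =
      (act n u.1 (w.2 t) - act n w.1 (u.2 t) + nilBr n star a b u.2 w.2 t) +
      (act n v.1 (w.2 t) - act n w.1 (v.2 t) + nilBr n star a b v.2 w.2 t)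
    rw [act_add_left, map_add, add_nilBr, Pi.add_apply]
    abel
  lie_add u v w := by
    refine Prod.ext (lie_add u.1 v.1 w.1) (funext fun t => ?_)
    change act n u.1 (v.2 t + w.2 t) - act n (v.1 + w.1) (u.2 t) +
      nilBr n star a b u.2 (v.2 + w.2) t =
      (act n u.1 (v.2 t) - act n v.1 (u.2 t) + nilBr n star a b u.2 v.2 t) +
      (act n u.1 (w.2 t) - act n w.1 (u.2 t) + nilBr n star a b u.2 w.2 t)
    rw [act_add_left, map_add, nilBr_add, Pi.add_apply]
    abel
  lie_self u := by
    refine Prod.ext (lie_self u.1) (funext fun t => ?_)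
    change act n u.1 (u.2 t) - act n u.1 (u.2 t) + nilBr n star a b u.2 u.2 t = 0
    rw [nilBr_self]
    simp
  leibniz_lie u v w := by
    obtain rfl : a = b := funext hab
    refine Prod.ext (leibniz_lie u.1 v.1 w.1) (funext fun t => ?_)
    have hlie : ∀ (A B : SL2) (F G : Fin k → GN n) (H : Fin k → GN n),
        nilBr n star a a H (fun t => act n A (G t) - act n B (F t) + nilBr n star a a F G t) t =
          nilBr n star a a H (fun s => act n A (G s)) t -
            nilBr n star a a H (fun s => act n B (F s)) t +
            nilBr n star a a H (nilBr n star a a F G) t := by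
      intro A B F G H
      have e : (fun t => act n A (G t) - act n B (F t) + nilBr n star a a F G t) =
          (fun t => act n A (G t)) + (-1 : ℂ) • (fun t => act n B (F t)) +
            nilBr n star a a F G := by
        funext s
        simp [sub_eq_add_neg]
      rw [e, nilBr_add, nilBr_add, nilBr_smul]
      simp [sub_eq_add_neg]
    change act n u.1 (act n v.1 (w.2 t) - act n w.1 (v.2 t) + nilBr n star a a v.2 w.2 t) -
        act n ⁅v.1, w.1⁆ (u.2 t) + nilBr n star a a u.2
          (fun t => act n v.1 (w.2 t) - act n w.1 (v.2 t) + nilBr n star a a v.2 w.2 t) t =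
      (act n ⁅u.1, v.1⁆ (w.2 t) -
        act n w.1 (act n u.1 (v.2 t) - act n v.1 (u.2 t) + nilBr n star a a u.2 v.2 t) +
        nilBr n star a a
          (fun t => act n u.1 (v.2 t) - act n v.1 (u.2 t) + nilBr n star a a u.2 v.2 t) w.2 t) +
      (act n v.1 (act n u.1 (w.2 t) - act n w.1 (u.2 t) + nilBr n star a a u.2 w.2 t) -
        act n ⁅u.1, w.1⁆ (v.2 t) + nilBr n star a a v.2
          (fun t => act n u.1 (w.2 t) - act n w.1 (u.2 t) + nilBr n star a a u.2 w.2 t) t)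
    rw [nilBr_skew (fun t => act n u.1 (v.2 t) - act n v.1 (u.2 t) + nilBr n star a a u.2 v.2 t),
      Pi.neg_apply, hlie, hlie, hlie]
    have hJ := congrFun (nilBr_leibniz (star := star) (a := a) hn h5 u.2 v.2 w.2) t
    rw [Pi.add_apply, nilBr_skew (nilBr n star a a u.2 v.2), Pi.neg_apply] at hJ
    simp only [map_add, map_sub, act_lie, act_nilBr hn h5, hJ]
    rw [nilBr_skew w.2 (fun s => act n u.1 (v.2 s)), nilBr_skew w.2 (fun s => act n v.1 (u.2 s)),
      nilBr_skew v.2 (fun s => act n w.1 (u.2 s)), nilBr_skew u.2 (fun s => act n w.1 (v.2 s))]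
    simp only [Pi.neg_apply]
    abel

/-- The Lie algebra structure over `ℂ`. -/
@[reducible]
def SlG.lieAlgebra (hn : Odd n) (h5 : 5 ≤ n) (hab : ∀ i, a i = b i) :
    letI := SlG.lieRing (star := star) hn h5 hab
    LieAlgebra ℂ (SlG n star a b) :=
  letI := SlG.lieRing (star := star) hn h5 hab
  { (inferInstance : Module ℂ (SlG n star a b)) with
    lie_smul := fun r u v => by
      refine Prod.ext (lie_smul r u.1 v.1) (funext fun t => ?_)
      change act n u.1 (r • v.2 t) - act n (r • v.1) (u.2 t) + nilBr n star a b u.2 (r • v.2) t =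
        r • (act n u.1 (v.2 t) - act n v.1 (u.2 t) + nilBr n star a b u.2 v.2 t)
      rw [map_smul, act_smul_left, nilBr_smul, Pi.smul_apply]
      module }

/-- The first cohomology `H¹(L, L)` of a complex Lie algebra with coefficients in the adjoint
module: the kernel of `d : Hom(L, L) → Hom(Λ²L, L)` modulo the image of `d : L → Hom(L, L)`,
`(d m)(x) = [x, m]`. -/
abbrev H1 (L : Type*) [LieRing L] [LieAlgebra ℂ L] : Type _ :=
  LinearMap.ker (LieModule.Cohomology.d₁₂ ℂ L L) ⧸
    (LinearMap.range ((LieModule.toEnd ℂ L L : L →ₗ[ℂ] Module.End ℂ L).flip)).comap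
      (LinearMap.ker (LieModule.Cohomology.d₁₂ ℂ L L)).subtype

end SatoType

end

/-!
Write `L = sl₂ ⋉ N` with `N = N₀ * (N₁ * ⋯)`. Although `L` need not be a Lie algebra, its product is
`sl₂`-equivariant for all parameters: `br n x y - br n x x` multiplies irreducible `sl₂`-modules
by first transvectants (`act_br_general`). So every element of `sl₂` acts by a derivation
(`lieB_ofSl_leibniz`), and this is all that is needed of the Jacobi identity.

*Derivations.* A derivation `D` restricts to a cocycle on `sl₂` with values in `L`. Since the Casimir
operator is diagonal on the standard basis and vanishes only on the vectors `c`, Whitehead's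
argument gives `w` with `D A = [w, A]` for `A ∈ sl₂`. As `[D A, ·] = [D, [A, ·]]` is a derivation, and
`w` lies in the `sl₂`-module generated by the `D A`, also `[w, ·]` is a derivation
(`exists_inner_on_sl`). Hence it suffices that a derivation `D` that vanishes on `sl₂` is zero
(`IsDer.eq_zero`).

The relation "`N_j` acts on `N_t`" is a strict total order on the factors. After the unipotent change of
coordinates `cumul` in the coefficient space `ℂ^k`, the product of `N` is that of `ℂ^k ⊗ 𝒢𝒩`, except for
the components in the vectors `y^{n-1}`, which depend on the parameters (`lieB_eps_eps`). A `D` that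
commutes with `sl₂` maps the `x_i` and `y_i`, which are of highest weight `1`, to
combinations of such vectors. The relations `[x₁, x₁] = [y₁, y₁] = 0` and `[x₁, x₂] = [y₁, y₂] = c` show
that `D` respects the `k` factors and has the same diagonal coefficient `α` on `x` and `y`, and
`[y₁, x₁³] = 0` shows that there are no off-diagonal ones (`IsDer.exists_scalar`). So `D` is `q α` on the
layers of `x^q` and `y^q` (`IsDer.apply_top`). But `[x₂, y₁^n]` and `[y₂, x₁^n]` are `-a n y₁^{n-1}` and
`b n y₁^{n-1}`, so that `(n + 1) α = (n - 1) α` as soon as `(a, b) ≠ 0` (`IsDer.scalar_eq_zero`).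

*The other claims.* The vectors `c` are central (`lieB_emb_c`). All of `L` but these is in the image of
the Casimir operator, and they are products, so `L` is perfect (`span_lieB_eq_top`). The
Jacobi expression of `x₁`, `y₂`, `x₁^{n-1}` in `𝒢𝒩(a,b)` is `(a - b) (n + 1) / 2 · y₁^{n-1}`
(`br_jacobi`), so the Jacobi identity forces `a_i = b_i`.
-/

noncomputable section

namespace SatoType

variable {n k : ℕ} {star : Fin k → SemiDir} {a b : Fin k → ℂ}

/-! ### Equivariance of the bracket for arbitrary parameters -/

/-- A bilinear map `B` multiplies the families `U` (of highest weight `p`) and `W` (of highest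
weight `q`) by the first transvectant, with values in a family of highest weight `p + q - 2`. -/
def Transvectant (B : GN n →ₗ[ℂ] GN n →ₗ[ℂ] GN n) (p q : ℕ) (U W : ℕ → GN n) : Prop :=
  ∃ (r : ℂ) (d : ℕ) (V : ℕ → GN n), d + 2 = p + q ∧ Fam n d V ∧
    ∀ j i, 1 ≤ j ∧ j ≤ p + 1 → 1 ≤ i ∧ i ≤ q + 1 →
      B (U j) (W i) = (r * (((i : ℂ) - 1) * p - ((j : ℂ) - 1) * q)) • V (i + j - 2)

theorem Transvectant.swap {B : GN n →ₗ[ℂ] GN n →ₗ[ℂ] GN n} (hB : ∀ u v, B u v = -B v u)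
    {p q : ℕ} {U W : ℕ → GN n} (h : Transvectant B p q U W) : Transvectant B q p W U := by
  obtain ⟨r, d, V, hd, hV, h⟩ := h
  refine ⟨r, d, V, by omega, hV, fun j i hj hi => ?_⟩
  rw [hB, h i j hi hj, ← neg_smul, add_comm j i]
  congr 1
  ring

theorem transvectant_zero {B : GN n →ₗ[ℂ] GN n →ₗ[ℂ] GN n} {p q : ℕ} {U W : ℕ → GN n}
    (hpq : 2 ≤ p + q)
    (h : ∀ j i, 1 ≤ j ∧ j ≤ p + 1 → 1 ≤ i ∧ i ≤ q + 1 → B (U j) (W i) = 0) :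
    Transvectant B p q U W :=
  ⟨0, p + q - 2, _, by omega, fam_zero, fun j i hj hi => by rw [h j i hj hi, smul_zero]⟩

theorem Transvectant.actE {B : GN n →ₗ[ℂ] GN n →ₗ[ℂ] GN n} {p q : ℕ} {U W : ℕ → GN n}
    (hU : Fam n p U) (hW : Fam n q W) (h : Transvectant B p q U W) {j i : ℕ}
    (hj : 1 ≤ j ∧ j ≤ p + 1) (hi : 1 ≤ i ∧ i ≤ q + 1) :
    actE n (B (U j) (W i)) = B (actE n (U j)) (W i) + B (U j) (actE n (W i)) := by
  rw [(hU j hj.1 hj.2).1, (hW i hi.1 hi.2).1, map_smul, map_smul, LinearMap.smul_apply]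
  obtain ⟨j, rfl⟩ := Nat.exists_eq_add_of_le' hj.1
  obtain ⟨i, rfl⟩ := Nat.exists_eq_add_of_le' hi.1
  obtain ⟨r, d, V, hd, hV, hB⟩ := h
  have h1 : ((j : ℂ)) • B (U j) (W (i + 1)) =
      (j * (r * (i * p - ((j : ℂ) - 1) * q))) • V (i + j - 1) := by
    rcases Nat.eq_zero_or_pos j with rfl | hj'
    · simp
    · rw [hB _ _ (by omega) hi, smul_smul, show i + 1 + j - 2 = i + j - 1 by omega]
      push_cast
      congr 3
      ring
  have h2 : ((i : ℂ)) • B (U (j + 1)) (W i) =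
      (i * (r * (((i : ℂ) - 1) * p - (j : ℂ) * q))) • V (i + j - 1) := by
    rcases Nat.eq_zero_or_pos i with rfl | hi'
    · simp
    · rw [hB _ _ hj (by omega), smul_smul, show i + (j + 1) - 2 = i + j - 1 by omega]
      push_cast
      congr 3
      ring
  have h3 : SatoType.actE n (B (U (j + 1)) (W (i + 1))) =
      (r * ((i : ℂ) * p - (j : ℂ) * q) * ((i : ℂ) + j - 1)) • V (i + j - 1) := by
    rw [hB _ _ hj hi, map_smul, show i + 1 + (j + 1) - 2 = i + j by omega]
    rcases Nat.eq_zero_or_pos (i + j) with h0 | h0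
    · obtain rfl : i = 0 := by omega
      obtain rfl : j = 0 := by omega
      simp
    by_cases h0' : i + j = d + 2
    · obtain rfl : i = q := by omega
      obtain rfl : j = p := by omega
      have : ((((i + 1 : ℕ) : ℂ) - 1) * j - (((j + 1 : ℕ) : ℂ) - 1) * i) = 0 := by
        push_cast; ring
      rw [this, mul_comm (i : ℂ)]
      simp
    · rw [(hV _ h0 (by omega)).1, smul_smul]
      push_cast
      congr 1
      ring
  simp only [Nat.add_sub_cancel, Nat.cast_add, Nat.cast_one, add_sub_cancel_right]
  rw [h1, h2, h3, ← add_smul]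
  congr 1
  ring

theorem Transvectant.actF {B : GN n →ₗ[ℂ] GN n →ₗ[ℂ] GN n} {p q : ℕ} {U W : ℕ → GN n}
    (hU : Fam n p U) (hW : Fam n q W) (h : Transvectant B p q U W) {j i : ℕ}
    (hj : 1 ≤ j ∧ j ≤ p + 1) (hi : 1 ≤ i ∧ i ≤ q + 1) :
    actF n (B (U j) (W i)) = B (actF n (U j)) (W i) + B (U j) (actF n (W i)) := by
  rw [(hU j hj.1 hj.2).2, (hW i hi.1 hi.2).2, map_smul, map_smul, LinearMap.smul_apply]
  obtain ⟨r, d, V, hd, hV, hB⟩ := h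
  have hdc : (d : ℂ) = p + q - 2 := by
    have : ((d + 2 : ℕ) : ℂ) = ((p + q : ℕ) : ℂ) := by rw [hd]
    push_cast at this
    linear_combination this
  have h1 : ((p : ℂ) + 1 - j) • B (U (j + 1)) (W i) =
      (((p : ℂ) + 1 - j) * (r * (((i : ℂ) - 1) * p - j * q))) • V (i + j - 1) := by
    by_cases hj' : j = p + 1
    · subst hj'; simp
    · rw [hB _ _ (by omega) hi, smul_smul, show i + (j + 1) - 2 = i + j - 1 by omega]
      push_cast
      congr 3
      ring
  have h2 : ((q : ℂ) + 1 - i) • B (U j) (W (i + 1)) =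
      (((q : ℂ) + 1 - i) * (r * ((i : ℂ) * p - ((j : ℂ) - 1) * q))) • V (i + j - 1) := by
    by_cases hi' : i = q + 1
    · subst hi'; simp
    · rw [hB _ _ hj (by omega), smul_smul, show i + 1 + j - 2 = i + j - 1 by omega]
      push_cast
      congr 3
      ring
  have h3 : SatoType.actF n (B (U j) (W i)) =
      (r * (((i : ℂ) - 1) * p - ((j : ℂ) - 1) * q) * ((p : ℂ) + q + 1 - i - j)) •
        V (i + j - 1) := by
    rw [hB _ _ hj hi, map_smul]
    rcases Nat.eq_zero_or_pos (i + j - 2) with h0 | h0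
    · obtain rfl : i = 1 := by omega
      obtain rfl : j = 1 := by omega
      simp
    by_cases h0' : i + j = d + 4
    · obtain rfl : i = q + 1 := by omega
      obtain rfl : j = p + 1 := by omega
      have : ((((q + 1 : ℕ) : ℂ) - 1) * p - (((p + 1 : ℕ) : ℂ) - 1) * q) = 0 := by
        push_cast; ring
      rw [this]
      simp
    · have e : ((i + j - 2 : ℕ) : ℂ) = (i : ℂ) + j - 2 := by
        rw [Nat.cast_sub (by omega)]
        simp
      rw [(hV _ h0 (by omega)).2, smul_smul, e, hdc, show i + j - 2 + 1 = i + j - 1 by omega]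
      congr 1
      ring
  rw [h1, h2, h3, ← add_smul]
  congr 1
  ring

/-- The part of the bracket of `𝒢𝒩(x,y)` that measures the failure of `x = y`. -/
def brDiff (n : ℕ) (x y : ℂ) : GN n →ₗ[ℂ] GN n →ₗ[ℂ] GN n := br n x y + (-1 : ℂ) • br n x x

theorem brDiff_apply (x y : ℂ) (u v : GN n) : brDiff n x y u v = br n x y u v - br n x x u v := by
  simp only [brDiff, LinearMap.add_apply, LinearMap.smul_apply, neg_smul, one_smul, sub_eq_add_neg]

theorem brDiff_skew (x y : ℂ) (u v : GN n) : brDiff n x y u v = -brDiff n x y v u := by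
  rw [brDiff_apply, brDiff_apply, br_skew x y, br_skew x x]
  abel

theorem brDiff_vec {s t : Sym} (hs : s.Valid n) (ht : t.Valid n) (x y : ℂ) :
    brDiff n x y (vec n s) (vec n t) =
      half n x y s t - half n x y t s - (half n x x s t - half n x x t s) := by
  simp only [brDiff_apply, br_vec hs ht]

theorem brDiff_c (x y : ℂ) (u : GN n) : brDiff n x y u (vec n .c) = 0 := by
  simp [brDiff_apply, br_c]

theorem brDiff_xx_of_le (h5 : 5 ≤ n) (x y : ℂ) {p q : ℕ} (hp : 1 ≤ p ∧ p ≤ n)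
    (hq : 1 ≤ q ∧ q ≤ n) (hpq : p ≤ q) :
    Transvectant (brDiff n x y) p q (fun i => vec n (.x p i)) (fun i => vec n (.x q i)) := by
  by_cases h : 2 ≤ p ∧ p + q = n + 1
  swap
  · refine transvectant_zero (by omega) fun j i hj hi => ?_
    rw [brDiff_vec (by simp [Sym.Valid]; omega) (by simp [Sym.Valid]; omega)]
    simp only [half]
    split_ifs <;> first | omega | simp
  · obtain ⟨h2, h⟩ := h
    refine ⟨(y - x) / p * (-1) ^ p, n - 1, fun i => vec n (.y (n - 1) i), by omega,
      fam_y (by omega) (by omega) (by omega), fun j i hj hi => ?_⟩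
    rw [brDiff_vec (by simp [Sym.Valid]; omega) (by simp [Sym.Valid]; omega)]
    have hN : (n : ℂ) = p + q - 1 := by
      have : ((p + q : ℕ) : ℂ) = ((n + 1 : ℕ) : ℂ) := by rw [h]
      push_cast at this
      linear_combination -this
    have hp0 : (p : ℂ) ≠ 0 := by exact_mod_cast (by omega : p ≠ 0)
    have c1 : ¬ (p = 1 ∧ q = 1) := by omega
    have c2 : ¬ (p = 1 ∧ 2 ≤ q ∧ q ≤ n - 1) := by omega
    have c3 : ¬ (2 ≤ p ∧ p < q ∧ p + q = n) := by omega
    have d1 : ¬ (q = 1 ∧ p = 1) := by omega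
    have d2 : ¬ (q = 1 ∧ 2 ≤ p ∧ p ≤ n - 1) := by omega
    have d3 : ¬ (2 ≤ q ∧ q < p ∧ q + p = n) := by omega
    simp only [half, if_neg c1, if_neg c2, if_neg c3, if_neg d1, if_neg d2, if_neg d3]
    rw [add_comm j i, hN]
    rcases hpq.lt_or_eq with hlt | rfl
    · rw [if_pos (by omega), if_neg (by omega), if_pos (by omega), if_neg (by omega),
        sub_zero, sub_zero, ← sub_smul]
      congr 1
      field_simp
      ring
    · rcases lt_trichotomy j i with hji | rfl | hji
      · rw [if_pos (by omega), if_neg (by omega), if_pos (by omega), if_neg (by omega),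
          sub_zero, sub_zero, ← sub_smul]
        congr 1
        field_simp
        ring
      · rw [if_neg (by omega), if_neg (by omega)]
        simp
      · rw [if_neg (by omega), if_pos (by omega), if_neg (by omega), if_pos (by omega),
          zero_sub, zero_sub, sub_neg_eq_add, neg_add_eq_sub, ← sub_smul]
        congr 1
        field_simp
        ring

theorem brDiff_xx (h5 : 5 ≤ n) (x y : ℂ) {p q : ℕ} (hp : 1 ≤ p ∧ p ≤ n) (hq : 1 ≤ q ∧ q ≤ n) :
    Transvectant (brDiff n x y) p q (fun i => vec n (.x p i)) (fun i => vec n (.x q i)) := by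
  rcases le_total p q with h | h
  · exact brDiff_xx_of_le h5 x y hp hq h
  · exact (brDiff_xx_of_le h5 x y hq hp h).swap (brDiff_skew x y)

theorem brDiff_yx (h5 : 5 ≤ n) (x y : ℂ) {p q : ℕ} (hp : 1 ≤ p ∧ p ≤ n ∧ p ≠ 2)
    (hq : 1 ≤ q ∧ q ≤ n) :
    Transvectant (brDiff n x y) p q (fun i => vec n (.y p i)) (fun i => vec n (.x q i)) := by
  by_cases h : p = 1 ∧ q = n
  swap
  · refine transvectant_zero (by omega) fun j i hj hi => ?_
    rw [brDiff_vec (by simp [Sym.Valid]; omega) (by simp [Sym.Valid]; omega)]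
    simp only [half]
    split_ifs <;> first | omega | simp
  · obtain ⟨rfl, rfl⟩ := h
    refine ⟨x - y, q - 1, fun i => vec q (.y (q - 1) i), by omega,
      fam_y (by omega) (by omega) (by omega), fun j i hj hi => ?_⟩
    rw [brDiff_vec (s := .y 1 j) (t := .x q i) ⟨by omega, by omega, by omega, hj⟩ ⟨by omega, by omega, hi⟩]
    have c1 : ¬ q = 2 := by omega
    have c2 : ¬ q = q - 1 := by omega
    have c3 : ¬ q = 1 := by omega
    simp only [half, c1, c2, c3, and_false, false_and, and_self, if_true, if_false, sub_zero]
    rw [← sub_smul]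
    congr 1
    push_cast
    ring

theorem brDiff_yy (x y : ℂ) {p q : ℕ} (hp : 1 ≤ p ∧ p ≤ n ∧ p ≠ 2)
    (hq : 1 ≤ q ∧ q ≤ n ∧ q ≠ 2) :
    Transvectant (brDiff n x y) p q (fun i => vec n (.y p i)) (fun i => vec n (.y q i)) := by
  refine transvectant_zero (by omega) fun j i hj hi => ?_
  rw [brDiff_vec (by simp [Sym.Valid]; omega) (by simp [Sym.Valid]; omega)]
  simp only [half]
  simp

theorem valid_cases {s : Sym} (hs : s.Valid n) : s = .c ∨
    (∃ p i, s = .x p i ∧ (1 ≤ p ∧ p ≤ n) ∧ 1 ≤ i ∧ i ≤ p + 1) ∨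
    ∃ p i, s = .y p i ∧ (1 ≤ p ∧ p ≤ n ∧ p ≠ 2) ∧ 1 ≤ i ∧ i ≤ p + 1 := by
  rcases s with _ | ⟨p, i⟩ | ⟨p, i⟩ <;> simp only [Sym.Valid] at hs <;> simp <;> omega

theorem brDiff_leibniz_vec (h5 : 5 ≤ n) (x y : ℂ) {s t : Sym} (hs : s.Valid n) (ht : t.Valid n) :
    (actE n (brDiff n x y (vec n s) (vec n t)) =
        brDiff n x y (actE n (vec n s)) (vec n t) + brDiff n x y (vec n s) (actE n (vec n t))) ∧
      actF n (brDiff n x y (vec n s) (vec n t)) =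
        brDiff n x y (actF n (vec n s)) (vec n t) +
          brDiff n x y (vec n s) (actF n (vec n t)) := by
  rcases valid_cases ht with rfl | ⟨q, i, rfl, hq, hi⟩ | ⟨q, i, rfl, hq, hi⟩
  · simp only [brDiff_c, actE_c, actF_c, map_zero, add_zero, and_self]
  · have hW := fam_x hq.1 hq.2
    rcases valid_cases hs with rfl | ⟨p, j, rfl, hp, hj⟩ | ⟨p, j, rfl, hp, hj⟩
    · simp only [brDiff_skew x y (vec n .c), brDiff_c, actE_c, actF_c, map_zero, add_zero, neg_zero,
        and_self, LinearMap.zero_apply]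
    · have h := brDiff_xx h5 x y hp hq
      exact ⟨h.actE (fam_x hp.1 hp.2) hW hj hi, h.actF (fam_x hp.1 hp.2) hW hj hi⟩
    · have h := brDiff_yx h5 x y hp hq
      have hU := fam_y hp.1 hp.2.1 hp.2.2
      exact ⟨h.actE hU hW hj hi, h.actF hU hW hj hi⟩
  · have hW := fam_y hq.1 hq.2.1 hq.2.2
    rcases valid_cases hs with rfl | ⟨p, j, rfl, hp, hj⟩ | ⟨p, j, rfl, hp, hj⟩
    · simp only [brDiff_skew x y (vec n .c), brDiff_c, actE_c, actF_c, map_zero, add_zero, neg_zero,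
        and_self, LinearMap.zero_apply]
    · have h := (brDiff_yx h5 x y hq hp).swap (brDiff_skew x y)
      exact ⟨h.actE (fam_x hp.1 hp.2) hW hj hi, h.actF (fam_x hp.1 hp.2) hW hj hi⟩
    · have h := brDiff_yy x y hp hq
      have hU := fam_y hp.1 hp.2.1 hp.2.2
      exact ⟨h.actE hU hW hj hi, h.actF hU hW hj hi⟩

/-- The action of `sl₂` on `𝒢𝒩(x,y)` is by derivations, whether or not `x = y`. -/
theorem act_br_general (hn : Odd n) (h5 : 5 ≤ n) (x y : ℂ) (A : SL2) (u v : GN n) :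
    act n A (br n x y u v) = br n x y (act n A u) v + br n x y u (act n A v) := by
  have ext : ∀ T : GN n →ₗ[ℂ] GN n, (∀ s t : Sym, s.Valid n → t.Valid n →
      T (brDiff n x y (vec n s) (vec n t)) =
        brDiff n x y (T (vec n s)) (vec n t) + brDiff n x y (vec n s) (T (vec n t))) →
      ∀ u v, T (brDiff n x y u v) = brDiff n x y (T u) v + brDiff n x y u (T v) := by
    intro T h u v
    have : (brDiff n x y).compr₂ T = (brDiff n x y).comp T + (brDiff n x y).compl₂ T :=
      hom_ext fun s hs => hom_ext fun t ht => by simpa using h s t hs ht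
    exact LinearMap.congr_fun (LinearMap.congr_fun this u) v
  have hE := ext (actE n) fun s t hs ht => (brDiff_leibniz_vec h5 x y hs ht).1
  have hF := ext (actF n) fun s t hs ht => (brDiff_leibniz_vec h5 x y hs ht).2
  have hH : ∀ u v, actH n (brDiff n x y u v) =
      brDiff n x y (actH n u) v + brDiff n x y u (actH n v) := by
    intro u v
    simp only [← act_comm_EF, hE, hF, map_add, map_sub, LinearMap.sub_apply]
    abel
  have hA : act n A (brDiff n x y u v) =
      brDiff n x y (act n A u) v + brDiff n x y u (act n A v) := by
    simp only [act, LinearMap.add_apply, LinearMap.smul_apply, hE, hF, hH, map_add, map_smul]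
    module
  have e : ∀ u v, br n x y u v = br n x x u v + brDiff n x y u v := fun u v => by
    rw [brDiff_apply, add_sub_cancel]
  simp only [e, map_add, act_br hn h5, hA]
  abel

/-! ### The product of `sl₂ ⋉ N` as a bilinear map -/

/-- An element of `sl₂` as an element of `sl₂ ⋉ N`. -/
def ofSl (A : SL2) : SlG n star a b := (A, 0)

/-- An element of the nilpotent part `N` as an element of `sl₂ ⋉ N`. -/
def ofN (F : Fin k → GN n) : SlG n star a b := (0, F)

theorem ofN_add (F G : Fin k → GN n) :
    (ofN (F + G) : SlG n star a b) = ofN F + ofN G :=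
  Prod.ext (add_zero 0).symm rfl

theorem ofN_smul (r : ℂ) (F : Fin k → GN n) :
    (ofN (r • F) : SlG n star a b) = r • ofN F :=
  Prod.ext (smul_zero r).symm rfl

theorem ofN_zero : (ofN 0 : SlG n star a b) = 0 := rfl

theorem ofN_injective : Function.Injective (ofN : (Fin k → GN n) → SlG n star a b) :=
  fun _ _ h => congrArg Prod.snd h

theorem eq_ofSl_add_ofN (u : SlG n star a b) : u = ofSl u.1 + ofN u.2 :=
  Prod.ext (add_zero u.1).symm (zero_add u.2).symm

theorem act_zero_left (u : GN n) : act n 0 u = 0 := by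
  rw [← zero_smul ℂ (0 : SL2), act_smul_left, zero_smul]

theorem zero_nilBr (F : Fin k → GN n) : nilBr n star a b 0 F = 0 := by
  have := add_nilBr (star := star) (a := a) (b := b) 0 0 F
  rwa [add_zero, left_eq_add] at this

theorem smul_nilBr (r : ℂ) (F G : Fin k → GN n) :
    nilBr n star a b (r • F) G = r • nilBr n star a b F G := by
  rw [nilBr_skew, nilBr_smul, nilBr_skew G, smul_neg, neg_neg]

/-- The product of `sl₂ ⋉ N` as a bilinear map. -/
def lieB (n : ℕ) (star : Fin k → SemiDir) (a b : Fin k → ℂ) :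
    SlG n star a b →ₗ[ℂ] SlG n star a b →ₗ[ℂ] SlG n star a b :=
  LinearMap.mk₂ ℂ (fun u v => ⁅u, v⁆)
    (fun u v w => by
      refine Prod.ext (add_lie u.1 v.1 w.1) (funext fun t => ?_)
      change act n (u.1 + v.1) (w.2 t) - act n w.1 (u.2 t + v.2 t) +
        nilBr n star a b (u.2 + v.2) w.2 t =
        (act n u.1 (w.2 t) - act n w.1 (u.2 t) + nilBr n star a b u.2 w.2 t) +
        (act n v.1 (w.2 t) - act n w.1 (v.2 t) + nilBr n star a b v.2 w.2 t)
      rw [act_add_left, map_add, add_nilBr, Pi.add_apply]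
      abel)
    (fun r u v => by
      refine Prod.ext (smul_lie r u.1 v.1) (funext fun t => ?_)
      change act n (r • u.1) (v.2 t) - act n v.1 (r • u.2 t) + nilBr n star a b (r • u.2) v.2 t =
        r • (act n u.1 (v.2 t) - act n v.1 (u.2 t) + nilBr n star a b u.2 v.2 t)
      rw [map_smul, act_smul_left, smul_nilBr, Pi.smul_apply]
      module)
    (fun u v w => by
      refine Prod.ext (lie_add u.1 v.1 w.1) (funext fun t => ?_)
      change act n u.1 (v.2 t + w.2 t) - act n (v.1 + w.1) (u.2 t) +
        nilBr n star a b u.2 (v.2 + w.2) t =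
        (act n u.1 (v.2 t) - act n v.1 (u.2 t) + nilBr n star a b u.2 v.2 t) +
        (act n u.1 (w.2 t) - act n w.1 (u.2 t) + nilBr n star a b u.2 w.2 t)
      rw [act_add_left, map_add, nilBr_add, Pi.add_apply]
      abel)
    (fun r u v => by
      refine Prod.ext (lie_smul r u.1 v.1) (funext fun t => ?_)
      change act n u.1 (r • v.2 t) - act n (r • v.1) (u.2 t) + nilBr n star a b u.2 (r • v.2) t =
        r • (act n u.1 (v.2 t) - act n v.1 (u.2 t) + nilBr n star a b u.2 v.2 t)
      rw [map_smul, act_smul_left, nilBr_smul, Pi.smul_apply]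
      module)

theorem lieB_apply (u v : SlG n star a b) : lieB n star a b u v = ⁅u, v⁆ := rfl

theorem lieB_skew (u v : SlG n star a b) : lieB n star a b u v = -lieB n star a b v u := by
  refine Prod.ext (lie_skew u.1 v.1).symm (funext fun t => ?_)
  change act n u.1 (v.2 t) - act n v.1 (u.2 t) + nilBr n star a b u.2 v.2 t =
    -(act n v.1 (u.2 t) - act n u.1 (v.2 t) + nilBr n star a b v.2 u.2 t)
  rw [nilBr_skew, Pi.neg_apply]
  abel

theorem lieB_ofSl_ofN (A : SL2) (F : Fin k → GN n) :
    lieB n star a b (ofSl A) (ofN F) = ofN fun t => act n A (F t) := by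
  refine Prod.ext (lie_zero A) (funext fun t => ?_)
  change act n A (F t) - act n 0 (0 : GN n) + nilBr n star a b 0 F t = act n A (F t)
  rw [zero_nilBr, map_zero, Pi.zero_apply, sub_zero, add_zero]

theorem lieB_ofSl_ofSl (A B : SL2) :
    lieB n star a b (ofSl A) (ofSl B) = ofSl ⁅A, B⁆ := by
  refine Prod.ext rfl (funext fun t => ?_)
  change act n A 0 - act n B (0 : GN n) + nilBr n star a b 0 0 t = 0
  rw [zero_nilBr, map_zero, map_zero, Pi.zero_apply, sub_zero, add_zero]

theorem lieB_ofN_ofN (F G : Fin k → GN n) :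
    lieB n star a b (ofN F) (ofN G) = ofN (nilBr n star a b F G) := by
  refine Prod.ext (lie_zero 0) (funext fun t => ?_)
  change act n 0 (G t) - act n 0 (F t) + nilBr n star a b F G t = nilBr n star a b F G t
  rw [act_zero_left, act_zero_left, sub_zero, zero_add]

theorem act_nilBr_general (hn : Odd n) (h5 : 5 ≤ n) (A : SL2) (F G : Fin k → GN n) :
    (fun t => act n A (nilBr n star a b F G t)) =
      nilBr n star a b (fun s => act n A (F s)) G +
        nilBr n star a b F (fun s => act n A (G s)) := by
  funext t
  have hup : ∀ F : Fin k → GN n, up star (fun s => act n A (F s)) t = act n A (up star F t) := by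
    intro F
    simp [up]
  simp only [Pi.add_apply, nilBr_eq, map_sub, act_br_general hn h5, hup, map_add,
    LinearMap.add_apply]
  abel

/-- The elements of `sl₂` act on `sl₂ ⋉ N` by derivations, even if `sl₂ ⋉ N` is not a Lie
algebra. -/
theorem lieB_ofSl_leibniz (hn : Odd n) (h5 : 5 ≤ n) (A : SL2) (u v : SlG n star a b) :
    lieB n star a b (ofSl A) (lieB n star a b u v) =
      lieB n star a b (lieB n star a b (ofSl A) u) v +
        lieB n star a b u (lieB n star a b (ofSl A) v) := by
  have aux : ∀ (B : SL2) (F : Fin k → GN n),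
      lieB n star a b (ofSl A) (lieB n star a b (ofSl B) (ofN F)) =
      lieB n star a b (lieB n star a b (ofSl A) (ofSl B)) (ofN F) +
        lieB n star a b (ofSl B) (lieB n star a b (ofSl A) (ofN F)) := by
    intro B F
    simp only [lieB_ofSl_ofN, lieB_ofSl_ofSl, ← ofN_add]
    congr 1
    funext t
    simp only [Pi.add_apply, act_lie]
    abel
  rw [eq_ofSl_add_ofN u, eq_ofSl_add_ofN v]
  generalize u.1 = B
  generalize u.2 = F
  generalize v.1 = C
  generalize v.2 = G
  have h1 : lieB n star a b (ofSl A) (lieB n star a b (ofSl B) (ofSl C)) =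
      lieB n star a b (lieB n star a b (ofSl A) (ofSl B)) (ofSl C) +
        lieB n star a b (ofSl B) (lieB n star a b (ofSl A) (ofSl C)) := by
    simp only [lieB_ofSl_ofSl, leibniz_lie A B C]
    exact Prod.ext rfl (add_zero 0).symm
  have h2 := aux B G
  have h3 := aux C F
  have h4 : lieB n star a b (ofSl A) (lieB n star a b (ofN F) (ofN G)) =
      lieB n star a b (lieB n star a b (ofSl A) (ofN F)) (ofN G) +
        lieB n star a b (ofN F) (lieB n star a b (ofSl A) (ofN G)) := by
    simp only [lieB_ofSl_ofN, lieB_ofN_ofN, ← ofN_add, act_nilBr_general hn h5]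
  simp only [map_add, LinearMap.add_apply]
  rw [lieB_skew (ofN F) (ofSl C), lieB_skew (lieB n star a b (ofSl A) (ofN F)) (ofSl C),
    lieB_skew (ofN F) (lieB n star a b (ofSl A) (ofSl C)), map_neg, h1, h2, h3, h4]
  abel

/-! ### The standard basis of `sl₂` and its action -/

/-- The element `e` of `sl₂`. -/
def slE : SL2 := ⟨!![0, 1; 0, 0], by simp [Matrix.trace_fin_two, LieAlgebra.SpecialLinear.sl]⟩

/-- The element `f` of `sl₂`. -/
def slF : SL2 := ⟨!![0, 0; 1, 0], by simp [Matrix.trace_fin_two, LieAlgebra.SpecialLinear.sl]⟩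

/-- The element `h` of `sl₂`. -/
def slH : SL2 := ⟨!![1, 0; 0, -1], by simp [Matrix.trace_fin_two, LieAlgebra.SpecialLinear.sl]⟩

theorem lie_slE_slF : ⁅slE, slF⁆ = slH := by
  refine Subtype.ext ?_
  rw [LieAlgebra.SpecialLinear.sl_bracket]
  simp [slE, slF, slH]

theorem lie_slH_slE : ⁅slH, slE⁆ = (2 : ℂ) • slE := by
  refine Subtype.ext ?_
  rw [LieAlgebra.SpecialLinear.sl_bracket]
  ext i j
  fin_cases i <;> fin_cases j <;> (simp [slE, slH]; try norm_num)

theorem lie_slH_slF : ⁅slH, slF⁆ = (-2 : ℂ) • slF := by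
  refine Subtype.ext ?_
  rw [LieAlgebra.SpecialLinear.sl_bracket]
  ext i j
  fin_cases i <;> fin_cases j <;> (simp [slF, slH]; try norm_num)

theorem sl_eq (A : SL2) : A = A.1 0 0 • slH + A.1 0 1 • slE + A.1 1 0 • slF := by
  have hA : A.1 1 1 = - A.1 0 0 := by
    have : Matrix.trace A.1 = 0 := A.2
    rw [Matrix.trace_fin_two] at this
    linear_combination this
  refine Subtype.ext (Matrix.ext fun i j => ?_)
  change A.1 i j = A.1 0 0 * slH.1 i j + A.1 0 1 * slE.1 i j + A.1 1 0 * slF.1 i j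
  fin_cases i <;> fin_cases j <;> simp [slE, slF, slH, hA]

theorem act_slE : act n slE = actE n := by simp [act, slE]

theorem act_slF : act n slF = actF n := by simp [act, slF]

theorem act_slH : act n slH = actH n := by simp [act, slH]

/-! ### Pure vectors of the nilpotent part -/

/-- The element of `N` whose component in `N_t` is `g t • v`. -/
def emb (n : ℕ) (star : Fin k → SemiDir) (a b : Fin k → ℂ) :
    (Fin k → ℂ) →ₗ[ℂ] GN n →ₗ[ℂ] SlG n star a b :=
  LinearMap.mk₂ ℂ (fun g v => ofN fun t => g t • v)
    (fun g g' v => by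
      rw [← ofN_add]
      congr 1
      exact funext fun t => add_smul _ _ _)
    (fun r g v => by
      rw [← ofN_smul]
      congr 1
      exact funext fun t => mul_smul _ _ _)
    (fun g v w => by
      rw [← ofN_add]
      congr 1
      exact funext fun t => smul_add _ _ _)
    (fun r g v => by
      rw [← ofN_smul]
      congr 1
      exact funext fun t => smul_comm _ _ _)

theorem emb_apply (g : Fin k → ℂ) (v : GN n) :
    emb n star a b g v = ofN fun t => g t • v := rfl

theorem lieB_ofSl_emb (A : SL2) (g : Fin k → ℂ) (v : GN n) :
    lieB n star a b (ofSl A) (emb n star a b g v) = emb n star a b g (act n A v) := by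
  simp only [emb_apply, lieB_ofSl_ofN, map_smul]

/-- `sl₂ ⋉ N` is spanned by `sl₂` and the pure vectors of `N`. -/
theorem slG_eq_top_of_emb {P : Submodule ℂ (SlG n star a b)} (h1 : ∀ A, ofSl A ∈ P)
    (h2 : ∀ g s, s.Valid n → emb n star a b g (vec n s) ∈ P) : P = ⊤ := by
  have h3 : ∀ g v, emb n star a b g v ∈ P := by
    intro g v
    have : P.mkQ ∘ₗ emb n star a b g = 0 := by
      refine hom_ext fun s hs => ?_
      simpa using h2 g s hs
    simpa using LinearMap.congr_fun this v
  refine eq_top_iff.mpr fun u _ => ?_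
  rw [eq_ofSl_add_ofN u]
  refine P.add_mem (h1 _) ?_
  have : (ofN u.2 : SlG n star a b) = ∑ t, emb n star a b (Pi.single t 1) (u.2 t) := by
    have e : ∀ t, emb n star a b (Pi.single t 1) (u.2 t) = ofN (Pi.single t (u.2 t)) := by
      intro t
      rw [emb_apply]
      congr 1
      funext r
      by_cases h : r = t
      · subst h; simp
      · simp [h]
    let ι : (Fin k → GN n) →ₗ[ℂ] SlG n star a b := ⟨⟨ofN, ofN_add⟩, ofN_smul⟩
    calc (ofN u.2 : SlG n star a b) = ι (∑ t, Pi.single t (u.2 t)) := by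
          rw [Finset.univ_sum_single]; rfl
      _ = ∑ t, ι (Pi.single t (u.2 t)) := map_sum _ _ _
      _ = _ := Finset.sum_congr rfl fun t _ => (e t).symm
  rw [this]
  exact P.sum_mem fun t _ => h3 _ _

theorem slG_hom_ext {M : Type*} [AddCommGroup M] [Module ℂ M] {f g : SlG n star a b →ₗ[ℂ] M}
    (h1 : ∀ A, f (ofSl A) = g (ofSl A))
    (h2 : ∀ c s, s.Valid n → f (emb n star a b c (vec n s)) = g (emb n star a b c (vec n s))) :
    f = g := by
  have : LinearMap.eqLocus f g = ⊤ := slG_eq_top_of_emb h1 h2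
  exact LinearMap.eqLocus_eq_top.mp this

/-! ### The Casimir operator and Whitehead's first lemma -/

section

open Polynomial

section Abstract

variable {M : Type*} [AddCommGroup M] [Module ℂ M]

/-- The Casimir operator of three operators, normalized to be `k (k + 2)` on the irreducible
`sl₂`-module of highest weight `k`. -/
def casimir (E F H : Module.End ℂ M) : Module.End ℂ M := (2 : ℂ) • (E * F + F * E) + H * H

/-- The Casimir operator of a cocycle on `sl₂` is the coboundary of an explicit element. -/
theorem casimir_cocycle {E F H : Module.End ℂ M} (hEF : ∀ u, E (F u) = F (E u) + H u)
    (hHE : ∀ u, H (E u) = E (H u) + (2 : ℂ) • E u)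
    (hHF : ∀ u, H (F u) = F (H u) - (2 : ℂ) • F u) {e f h : M} (h1 : h = E f - F e)
    (h2 : (2 : ℂ) • e = H e - E h) (h3 : -((2 : ℂ) • f) = H f - F h) :
    E ((2 : ℂ) • (E f + F e) + H h) = casimir E F H e ∧
      F ((2 : ℂ) • (E f + F e) + H h) = casimir E F H f ∧
      H ((2 : ℂ) • (E f + F e) + H h) = casimir E F H h := by
  have e1 : E f = h + F e := by rw [h1]; abel
  have e2 : H e = (2 : ℂ) • e + E h := by rw [h2]; abel
  have e3 : H f = F h - (2 : ℂ) • f := by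
    rw [eq_comm, sub_eq_iff_eq_add] at h3
    rw [h3]
    abel
  have d2 : E h = H e - (2 : ℂ) • e := by rw [e2]; abel
  have d3 : F h = H f + (2 : ℂ) • f := by rw [e3]; abel
  have d1 : F e = E f - h := by rw [e1]; abel
  simp only [casimir, LinearMap.add_apply, LinearMap.smul_apply, Module.End.mul_apply, map_add,
    map_smul]
  refine ⟨?_, ?_, ?_⟩
  · have k1 : E (H h) = H (E h) - (2 : ℂ) • E h := by rw [hHE]; abel
    rw [k1, e1, map_add, d2, hEF e, map_sub, map_smul]
    module
  · have k1 : F (H h) = H (F h) + (2 : ℂ) • F h := by rw [hHF]; abel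
    rw [k1, d1, map_sub, d3, hEF f, map_add, map_smul]
    module
  · rw [hHE, hHF, e2, e3]
    simp only [map_add, map_sub, map_smul]
    module

theorem casimir_comm {E F H : Module.End ℂ M} (hEF : ∀ u, E (F u) = F (E u) + H u)
    (hHE : ∀ u, H (E u) = E (H u) + (2 : ℂ) • E u)
    (hHF : ∀ u, H (F u) = F (H u) - (2 : ℂ) • F u) (u : M) :
    casimir E F H (E u) = E (casimir E F H u) ∧ casimir E F H (F u) = F (casimir E F H u) ∧
      casimir E F H (H u) = H (casimir E F H u) := by
  simp only [casimir, LinearMap.add_apply, LinearMap.smul_apply, Module.End.mul_apply, map_add,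
    map_smul, hEF, hHE, hHF, map_sub]
  refine ⟨?_, ?_, ?_⟩ <;> module

theorem aeval_apply_of_eigen {T : Module.End ℂ M} {μ : ℂ} {v : M} (h : T v = μ • v) (p : ℂ[X]) :
    aeval T p v = p.eval μ • v := by
  induction p using Polynomial.induction_on' with
  | add p q hp hq => simp [hp, hq, add_smul]
  | monomial m r =>
    rw [aeval_monomial, eval_monomial, Module.End.mul_apply, Module.algebraMap_end_apply, mul_smul]
    congr 1
    induction m with
    | zero => simp
    | succ m ih => rw [pow_succ', Module.End.mul_apply, ih, map_smul, h, smul_smul, pow_succ]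

theorem aeval_apply_comm {T S : Module.End ℂ M} (h : ∀ u, T (S u) = S (T u)) (p : ℂ[X]) (u : M) :
    aeval T p (S u) = S (aeval T p u) := by
  have h1 : Commute T S := LinearMap.ext h
  have h2 : Commute (aeval T p) S := by
    induction p using Polynomial.induction_on' with
    | add p q hp hq => rw [map_add]; exact hp.add_left hq
    | monomial m r =>
      rw [aeval_monomial]
      have h3 : Commute (algebraMap ℂ (Module.End ℂ M) r) S := Algebra.commutes r S
      exact h3.mul_left (h1.pow_left m)
  exact LinearMap.congr_fun h2 u

theorem aeval_apply_mem {T : Module.End ℂ M} {P : Submodule ℂ M} (h : ∀ u ∈ P, T u ∈ P)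
    (p : ℂ[X]) {u : M} (hu : u ∈ P) : aeval T p u ∈ P := by
  induction p using Polynomial.induction_on' with
  | add p q hp hq => rw [map_add]; exact P.add_mem hp hq
  | monomial m r =>
    rw [aeval_monomial, Module.End.mul_apply, Module.algebraMap_end_apply]
    refine P.smul_mem r ?_
    induction m with
    | zero => simpa using hu
    | succ m ih => rw [pow_succ', Module.End.mul_apply]; exact h _ ih

/-- If a polynomial `p` of the Casimir operator with `p(0) ≠ 0` takes values in the invariants,
then every cocycle on `sl₂` is a coboundary, of an element of every
`sl₂`-submodule that contains its values. -/
theorem cocycle_eq_coboundary {E F H : Module.End ℂ M} (hEF : ∀ u, E (F u) = F (E u) + H u)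
    (hHE : ∀ u, H (E u) = E (H u) + (2 : ℂ) • E u)
    (hHF : ∀ u, H (F u) = F (H u) - (2 : ℂ) • F u) {p : ℂ[X]} (hp : p.coeff 0 ≠ 0)
    (hE : ∀ u, E (aeval (casimir E F H) p u) = 0) (hF : ∀ u, F (aeval (casimir E F H) p u) = 0)
    (hH : ∀ u, H (aeval (casimir E F H) p u) = 0) {e f h : M} (h1 : h = E f - F e)
    (h2 : (2 : ℂ) • e = H e - E h) (h3 : -((2 : ℂ) • f) = H f - F h) {P : Submodule ℂ M}
    (PE : ∀ u ∈ P, E u ∈ P) (PF : ∀ u ∈ P, F u ∈ P) (PH : ∀ u ∈ P, H u ∈ P) (he : e ∈ P)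
    (hf : f ∈ P) (hh : h ∈ P) : ∃ w ∈ P, E w = e ∧ F w = f ∧ H w = h := by
  have Pm : (2 : ℂ) • (E f + F e) + H h ∈ P :=
    P.add_mem (P.smul_mem _ (P.add_mem (PE _ hf) (PF _ he))) (PH _ hh)
  have Pcas : ∀ u ∈ P, casimir E F H u ∈ P := fun u hu =>
    P.add_mem (P.smul_mem _ (P.add_mem (PE _ (PF _ hu)) (PF _ (PE _ hu)))) (PH _ (PH _ hu))
  obtain ⟨g1, g2, g3⟩ := casimir_cocycle hEF hHE hHF h1 h2 h3
  have hcomm := casimir_comm hEF hHE hHF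
  have kE : ∀ u, aeval (casimir E F H) p (E u) = 0 := fun u => by
    rw [aeval_apply_comm (fun u => (hcomm u).1), hE]
  have kF : ∀ u, aeval (casimir E F H) p (F u) = 0 := fun u => by
    rw [aeval_apply_comm (fun u => (hcomm u).2.1), hF]
  have kH : ∀ u, aeval (casimir E F H) p (H u) = 0 := fun u => by
    rw [aeval_apply_comm (fun u => (hcomm u).2.2), hH]
  have ke : aeval (casimir E F H) p e = 0 := by
    have : (2 : ℂ) • aeval (casimir E F H) p e = 0 := by
      rw [← map_smul, h2, map_sub, kH, kE, sub_zero]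
    exact (smul_eq_zero_iff_right two_ne_zero).mp this
  have kf : aeval (casimir E F H) p f = 0 := by
    have : -((2 : ℂ) • aeval (casimir E F H) p f) = 0 := by
      rw [← map_smul, ← map_neg, h3, map_sub, kH, kF, sub_zero]
    exact (smul_eq_zero_iff_right two_ne_zero).mp (neg_eq_zero.mp this)
  have kh : aeval (casimir E F H) p h = 0 := by rw [h1, map_sub, kE, kF, sub_zero]
  have inv : ∀ u, aeval (casimir E F H) p u = 0 →
      aeval (casimir E F H) (C (-(p.coeff 0)⁻¹) * p.divX) (casimir E F H u) = u := by
    intro u hu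
    rw [← p.divX_mul_X_add, map_add, map_mul, aeval_X, aeval_C, LinearMap.add_apply,
      Module.End.mul_apply, Module.algebraMap_end_apply, add_eq_zero_iff_eq_neg] at hu
    rw [map_mul, aeval_C, Module.End.mul_apply, Module.algebraMap_end_apply, hu, smul_neg,
      smul_smul, neg_mul, inv_mul_cancel₀ hp, neg_smul, one_smul, neg_neg]
  refine ⟨_, aeval_apply_mem Pcas (C (-(p.coeff 0)⁻¹) * p.divX) Pm, ?_, ?_, ?_⟩
  · rw [← aeval_apply_comm (fun u => (hcomm u).1), g1, inv e ke]
  · rw [← aeval_apply_comm (fun u => (hcomm u).2.1), g2, inv f kf]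
  · rw [← aeval_apply_comm (fun u => (hcomm u).2.2), g3, inv h kh]

end Abstract

/-- The Casimir operator of `sl₂` on `𝒢𝒩(a,b)`. -/
def casN (n : ℕ) : Module.End ℂ (GN n) := casimir (actE n) (actF n) (actH n)

theorem casN_c : casN n (vec n .c) = 0 := by
  simp [casN, casimir, actE_c, actF_c, actH_c]

theorem casN_x {p i : ℕ} (h : (Sym.x p i).Valid n) :
    casN n (vec n (.x p i)) = ((p : ℂ) * (p + 2)) • vec n (.x p i) := by
  have hEF : actE n (actF n (vec n (.x p i))) =
      actF n (actE n (vec n (.x p i))) + actH n (vec n (.x p i)) := by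
    rw [← act_comm_EF]; abel
  have hFE : actF n (actE n (vec n (.x p i))) =
      (((i : ℂ) - 1) * (p + 2 - i)) • vec n (.x p i) := by
    rw [actE_x h, map_smul]
    obtain ⟨h1, h2, h3, h4⟩ := h
    by_cases h : i = 1
    · subst h; simp
    · rw [actF_x ⟨h1, h2, by omega, by omega⟩, smul_smul, Nat.cast_sub (by omega),
        show i - 1 + 1 = i by omega]
      congr 1; push_cast; ring
  simp only [casN, casimir, LinearMap.add_apply, LinearMap.smul_apply, Module.End.mul_apply, hEF,
    hFE, actH_x h, map_smul]
  module

theorem casN_y {p i : ℕ} (h : (Sym.y p i).Valid n) :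
    casN n (vec n (.y p i)) = ((p : ℂ) * (p + 2)) • vec n (.y p i) := by
  have hEF : actE n (actF n (vec n (.y p i))) =
      actF n (actE n (vec n (.y p i))) + actH n (vec n (.y p i)) := by
    rw [← act_comm_EF]; abel
  have hFE : actF n (actE n (vec n (.y p i))) =
      (((i : ℂ) - 1) * (p + 2 - i)) • vec n (.y p i) := by
    rw [actE_y h, map_smul]
    obtain ⟨h1, h2, h2', h3, h4⟩ := h
    by_cases h : i = 1
    · subst h; simp
    · rw [actF_y ⟨h1, h2, h2', by omega, by omega⟩, smul_smul, Nat.cast_sub (by omega),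
        show i - 1 + 1 = i by omega]
      congr 1; push_cast; ring
  simp only [casN, casimir, LinearMap.add_apply, LinearMap.smul_apply, Module.End.mul_apply, hEF,
    hFE, actH_y h, map_smul]
  module

/-- The Casimir operator of `sl₂` on `sl₂ ⋉ N`. -/
def cas (n : ℕ) (star : Fin k → SemiDir) (a b : Fin k → ℂ) : Module.End ℂ (SlG n star a b) :=
  casimir (lieB n star a b (ofSl slE)) (lieB n star a b (ofSl slF)) (lieB n star a b (ofSl slH))

theorem ofSl_smul (r : ℂ) (A : SL2) : (ofSl (r • A) : SlG n star a b) = r • ofSl A :=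
  Prod.ext rfl (smul_zero r).symm

theorem ofSl_add (A B : SL2) : (ofSl (A + B) : SlG n star a b) = ofSl A + ofSl B :=
  Prod.ext rfl (add_zero 0).symm

theorem cas_ofSl (A : SL2) : cas n star a b (ofSl A) = (8 : ℂ) • ofSl A := by
  have h1 := lie_slE_slF
  have h2 := lie_slH_slE
  have h3 := lie_slH_slF
  have h4 : ⁅slF, slE⁆ = -slH := by rw [← lie_skew, h1]
  have h5 : ⁅slE, slH⁆ = -((2 : ℂ) • slE) := by rw [← lie_skew, h2]
  have h6 : ⁅slF, slH⁆ = -((-2 : ℂ) • slF) := by rw [← lie_skew, h3]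
  rw [sl_eq A]
  simp only [cas, casimir, LinearMap.add_apply, LinearMap.smul_apply, Module.End.mul_apply,
    lieB_ofSl_ofSl, ← ofSl_add, ← ofSl_smul]
  congr 1
  simp only [lie_add, lie_smul, lie_neg, lie_self, h1, h2, h3, h4, h5, h6, lie_zero]
  module

theorem cas_emb (g : Fin k → ℂ) (v : GN n) :
    cas n star a b (emb n star a b g v) = emb n star a b g (casN n v) := by
  simp only [cas, casN, casimir, LinearMap.add_apply, LinearMap.smul_apply, Module.End.mul_apply,
    lieB_ofSl_emb, act_slE, act_slF, act_slH, map_add, map_smul]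

/-- A polynomial that vanishes at all nonzero eigenvalues of the Casimir operator, but not
at `0`. -/
def casPoly (n : ℕ) : ℂ[X] := ∏ j ∈ Finset.Icc 1 n, (X - C ((j : ℂ) * (j + 2)))

theorem casPoly_eval {p : ℕ} (h : 1 ≤ p ∧ p ≤ n) : (casPoly n).eval ((p : ℂ) * (p + 2)) = 0 := by
  rw [casPoly, eval_prod]
  exact Finset.prod_eq_zero (Finset.mem_Icc.mpr h) (by simp)

theorem casPoly_coeff_zero : (casPoly n).coeff 0 ≠ 0 := by
  rw [coeff_zero_eq_eval_zero, casPoly, eval_prod]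
  refine Finset.prod_ne_zero_iff.mpr fun j hj => ?_
  have hj := (Finset.mem_Icc.mp hj).1
  simp only [eval_sub, eval_X, eval_C, zero_sub, neg_ne_zero]
  exact_mod_cast (by positivity : j * (j + 2) ≠ 0)

theorem lieB_casPoly (h5 : 5 ≤ n) (A : SL2) (u : SlG n star a b) :
    lieB n star a b (ofSl A) (aeval (cas n star a b) (casPoly n) u) = 0 := by
  have : lieB n star a b (ofSl A) ∘ₗ aeval (cas n star a b) (casPoly n) = 0 := by
    refine slG_hom_ext (fun B => ?_) fun g s hs => ?_
    · have h8 : (casPoly n).eval 8 = 0 := by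
        have := casPoly_eval (n := n) (p := 2) (by omega)
        norm_num at this
        exact this
      rw [LinearMap.comp_apply, aeval_apply_of_eigen (cas_ofSl B), h8, zero_smul, map_zero]
      rfl
    · rw [LinearMap.comp_apply]
      have h := cas_emb (star := star) (a := a) (b := b) g (vec n s)
      rcases s with _ | ⟨p, i⟩ | ⟨p, i⟩
      · rw [casN_c, map_zero, ← zero_smul ℂ] at h
        rw [aeval_apply_of_eigen h, map_smul, lieB_ofSl_emb]
        simp [act, actE_c, actF_c, actH_c]
      · rw [casN_x hs, map_smul] at h
        rw [aeval_apply_of_eigen h, casPoly_eval ⟨hs.1, hs.2.1⟩, zero_smul, map_zero]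
        rfl
      · rw [casN_y hs, map_smul] at h
        rw [aeval_apply_of_eigen h, casPoly_eval ⟨hs.1, hs.2.1⟩, zero_smul, map_zero]
        rfl
  exact LinearMap.congr_fun this u

/-- `T` is a derivation of `sl₂ ⋉ N`. -/
def IsDer (T : Module.End ℂ (SlG n star a b)) : Prop :=
  ∀ u v, T (lieB n star a b u v) = lieB n star a b (T u) v + lieB n star a b u (T v)

theorem IsDer.commutator {S T : Module.End ℂ (SlG n star a b)} (hS : IsDer S) (hT : IsDer T) :
    IsDer (S * T - T * S) := by
  intro u v
  simp only [LinearMap.sub_apply, Module.End.mul_apply, hS u v, hT u v, map_add, map_sub]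
  rw [hS (T u), hS u, hT (S u), hT u]
  abel

theorem isDer_ofSl (hn : Odd n) (h5 : 5 ≤ n) (A : SL2) : IsDer (lieB n star a b (ofSl A)) :=
  lieB_ofSl_leibniz hn h5 A

/-- The elements `m` of `sl₂ ⋉ N` for which `[m, ·]` is a derivation. If `sl₂ ⋉ N` is not a Lie
algebra, these need not be all elements. -/
def derElts (n : ℕ) (star : Fin k → SemiDir) (a b : Fin k → ℂ) : Submodule ℂ (SlG n star a b) where
  carrier := {m | IsDer (lieB n star a b m)}
  zero_mem' u v := by simp
  add_mem' {m m'} h h' u v := by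
    simp only [map_add, LinearMap.add_apply, h u v, h' u v]
    abel
  smul_mem' r m h u v := by
    simp only [map_smul, LinearMap.smul_apply, h u v, smul_add]

theorem lieB_mem_derElts (hn : Odd n) (h5 : 5 ≤ n) (A : SL2) {m : SlG n star a b}
    (hm : m ∈ derElts n star a b) : lieB n star a b (ofSl A) m ∈ derElts n star a b := by
  have h : lieB n star a b (lieB n star a b (ofSl A) m) =
      lieB n star a b (ofSl A) * lieB n star a b m -
        lieB n star a b m * lieB n star a b (ofSl A) := by
    refine LinearMap.ext fun u => ?_
    rw [LinearMap.sub_apply, Module.End.mul_apply, Module.End.mul_apply, lieB_ofSl_leibniz hn h5]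
    abel
  change IsDer _
  rw [h]
  exact (isDer_ofSl hn h5 A).commutator hm

theorem lieB_lie (hn : Odd n) (h5 : 5 ≤ n) (A B : SL2) (u : SlG n star a b) :
    lieB n star a b (ofSl A) (lieB n star a b (ofSl B) u) =
      lieB n star a b (ofSl B) (lieB n star a b (ofSl A) u) + lieB n star a b (ofSl ⁅A, B⁆) u := by
  rw [lieB_ofSl_leibniz hn h5 A, lieB_ofSl_ofSl, add_comm]

/-- Whitehead's first lemma for a derivation `D` of `sl₂ ⋉ N`: on `sl₂` it is inner, and it is so
by an element that itself acts by a derivation. -/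
theorem exists_inner_on_sl (hn : Odd n) (h5 : 5 ≤ n) {D : Module.End ℂ (SlG n star a b)}
    (hD : IsDer D) :
    ∃ w ∈ derElts n star a b, ∀ A, D (ofSl A) = lieB n star a b w (ofSl A) := by
  -- `[D A, ·]` is the commutator of the derivations `D` and `[A, ·]`
  have hmem : ∀ A, D (ofSl A) ∈ derElts n star a b := by
    intro A
    have h : lieB n star a b (D (ofSl A)) =
        D * lieB n star a b (ofSl A) - lieB n star a b (ofSl A) * D := by
      refine LinearMap.ext fun u => ?_
      rw [LinearMap.sub_apply, Module.End.mul_apply, Module.End.mul_apply, hD]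
      abel
    change IsDer _
    rw [h]
    exact hD.commutator (isDer_ofSl hn h5 A)
  have hco : ∀ A B, D (ofSl ⁅A, B⁆) =
      lieB n star a b (ofSl A) (D (ofSl B)) - lieB n star a b (ofSl B) (D (ofSl A)) := by
    intro A B
    rw [← lieB_ofSl_ofSl, hD, lieB_skew (D (ofSl A))]
    abel
  have hE := lieB_casPoly (star := star) (a := a) (b := b) h5 slE
  have hF := lieB_casPoly (star := star) (a := a) (b := b) h5 slF
  have hH := lieB_casPoly (star := star) (a := a) (b := b) h5 slH
  have mE := fun u => lieB_mem_derElts (star := star) (a := a) (b := b) hn h5 slE (m := u)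
  have mF := fun u => lieB_mem_derElts (star := star) (a := a) (b := b) hn h5 slF (m := u)
  have mH := fun u => lieB_mem_derElts (star := star) (a := a) (b := b) hn h5 slH (m := u)
  have cEF := lieB_lie (star := star) (a := a) (b := b) hn h5 slE slF
  have cHE := lieB_lie (star := star) (a := a) (b := b) hn h5 slH slE
  have cHF := lieB_lie (star := star) (a := a) (b := b) hn h5 slH slF
  have dEF := hco slE slF
  have dHE := hco slH slE
  have dHF := hco slH slF
  rw [lie_slE_slF] at cEF dEF
  rw [lie_slH_slE, ofSl_smul, map_smul] at cHE dHE
  rw [lie_slH_slF, ofSl_smul, neg_smul, map_neg, map_smul] at cHF dHF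
  rw [cas] at hE hF hH
  obtain ⟨w, hw, g1, g2, g3⟩ : ∃ w ∈ derElts n star a b,
      lieB n star a b (ofSl slE) w = D (ofSl slE) ∧ lieB n star a b (ofSl slF) w = D (ofSl slF) ∧
        lieB n star a b (ofSl slH) w = D (ofSl slH) := by
    generalize lieB n star a b (ofSl slE) = E at *
    generalize lieB n star a b (ofSl slF) = F at *
    generalize lieB n star a b (ofSl slH) = H at *
    generalize derElts n star a b = P at *
    exact cocycle_eq_coboundary cEF cHE (fun u => by rw [sub_eq_add_neg]; exact cHF u)
      casPoly_coeff_zero hE hF hH dEF dHE dHF mE mF mH (hmem _) (hmem _) (hmem _)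
  refine ⟨-w, Submodule.neg_mem _ hw, fun A => ?_⟩
  rw [map_neg, LinearMap.neg_apply, lieB_skew, neg_neg, sl_eq A]
  simp only [ofSl_add, ofSl_smul, map_add, map_smul, LinearMap.add_apply, LinearMap.smul_apply,
    g1, g2, g3]

end

/-! ### Diagonalization of the iterated semidirect product -/

open Classical in
/-- The linear map on coefficients that adds to the coefficient of `N_t` those of all factors that
act on `N_t`. -/
def cumul (star : Fin k → SemiDir) : (Fin k → ℂ) →ₗ[ℂ] (Fin k → ℂ) where
  toFun c t := c t + ∑ j with Acts star j t, c j
  map_add' c d := by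
    funext t
    simp only [Pi.add_apply, Finset.sum_add_distrib]
    ring
  map_smul' r c := by
    funext t
    simp only [Pi.smul_apply, smul_eq_mul, RingHom.id_apply, mul_add, Finset.mul_sum]

open Classical in
theorem cumul_apply (c : Fin k → ℂ) (t : Fin k) :
    cumul star c t = c t + ∑ j with Acts star j t, c j := rfl

theorem acts_wellFounded (star : Fin k → SemiDir) : WellFounded (Acts star) := by
  have : IsTrans (Fin k) (Acts star) := ⟨fun _ _ _ => acts_trans⟩
  have : Std.Irrefl (Acts star) := ⟨acts_irrefl⟩
  exact Finite.wellFounded_of_trans_of_irrefl _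

theorem cumul_injective (star : Fin k → SemiDir) : Function.Injective (cumul star) := by
  classical
  refine (injective_iff_map_eq_zero _).mpr fun c hc => funext fun t => ?_
  induction t using (acts_wellFounded star).induction with
  | _ t ih =>
    have h := congrFun hc t
    rwa [cumul_apply, Finset.sum_eq_zero fun j hj => ih j (Finset.mem_filter.mp hj).2,
      add_zero] at h

/-- `cumul` as an automorphism of the coefficient space. -/
def cumulEquiv (star : Fin k → SemiDir) : (Fin k → ℂ) ≃ₗ[ℂ] (Fin k → ℂ) :=
  LinearEquiv.ofInjectiveEndo (cumul star) (cumul_injective star)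

theorem cumul_symm (g : Fin k → ℂ) : cumul star ((cumulEquiv star).symm g) = g :=
  (cumulEquiv star).apply_symm_apply g

/-- The element of `N` whose component in `N_t` is `g' t • v`, where `cumul g' = g`. In terms of
these elements, regarded as `g ⊗ v`, the product of `N` becomes that of `ℂ^k ⊗ 𝒢𝒩` up to
components in the vectors `y^{n-1}`. -/
def eps (n : ℕ) (star : Fin k → SemiDir) (a b : Fin k → ℂ) :
    (Fin k → ℂ) →ₗ[ℂ] GN n →ₗ[ℂ] SlG n star a b :=
  emb n star a b ∘ₗ (cumulEquiv star).symm.toLinearMap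

theorem eps_apply (g : Fin k → ℂ) (v : GN n) :
    eps n star a b g v = emb n star a b ((cumulEquiv star).symm g) v := rfl

theorem emb_eq_eps (g : Fin k → ℂ) (v : GN n) :
    emb n star a b g v = eps n star a b (cumul star g) v := by
  rw [eps_apply]
  congr 1
  exact congrArg _ ((cumulEquiv star).symm_apply_apply g).symm

theorem lieB_ofSl_eps (A : SL2) (g : Fin k → ℂ) (v : GN n) :
    lieB n star a b (ofSl A) (eps n star a b g v) = eps n star a b g (act n A v) :=
  lieB_ofSl_emb _ _ _

theorem cas_eps (g : Fin k → ℂ) (v : GN n) :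
    cas n star a b (eps n star a b g v) = eps n star a b g (casN n v) :=
  cas_emb _ _

theorem eps_injective {s : Sym} (hs : s.Valid n) :
    Function.Injective fun g => eps n star a b g (vec n s) := by
  intro g h hgh
  refine (cumulEquiv star).symm.injective (funext fun t => ?_)
  have := congrFun (ofN_injective hgh) t
  rw [vec_of_valid hs] at this
  simpa using DFunLike.congr_fun this ⟨s, hs⟩

open Classical in
/-- The product of two pure vectors of `N`. -/
theorem lieB_emb_emb (c d : Fin k → ℂ) (u v : GN n) :
    lieB n star a b (emb n star a b c u) (emb n star a b d v) =
      ofN fun t => (c t * d t + ∑ j with Acts star j t, (c j * d t + c t * d j)) •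
        br n (a t) (b t) u v := by
  rw [emb_apply, emb_apply, lieB_ofN_ofN]
  congr 1
  funext t
  have h2 : nilBr n star a b (fun t => c t • u) (fun t => d t • v) t =
      br n (a t) (b t) (c t • u) (d t • v) + ∑ j with Acts star j t,
        (br n (a t) (b t) (c j • u) (d t • v) - br n (a t) (b t) (d j • v) (c t • u)) := rfl
  rw [h2, add_smul, Finset.sum_smul]
  congr 1
  · simp only [map_smul, LinearMap.smul_apply]
    module
  · refine Finset.sum_congr rfl fun j _ => ?_
    rw [br_skew (a t) (b t) (d j • v)]
    simp only [map_smul, LinearMap.smul_apply]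
    module

theorem lieB_eps_eps (g h : Fin k → ℂ) (u v : GN n) :
    lieB n star a b (eps n star a b g u) (eps n star a b h v) =
      ofN fun t => (cumulEquiv star).symm (g * h) t • br n (a t) (b t) u v := by
  classical
  rw [eps_apply, eps_apply, lieB_emb_emb]
  set c := (cumulEquiv star).symm g with hc
  set d := (cumulEquiv star).symm h with hd
  have hg : cumul star c = g := cumul_symm g
  have hh : cumul star d = h := cumul_symm h
  -- the coefficients of the product form the product of `g` and `h` in the new coordinates,
  -- as `cumul` adds up the coefficients along the order of the factors
  have key : (fun t => c t * d t + ∑ j with Acts star j t, (c j * d t + c t * d j)) =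
      (cumulEquiv star).symm (g * h) := by
    rw [LinearEquiv.eq_symm_apply]
    change cumul star _ = g * h
    funext t
    rw [cumul_apply, sum_acts (star := star) t fun i j => c i * d j, Pi.mul_apply, ← hg, ← hh,
      cumul_apply, cumul_apply, ← Finset.sum_mul_sum, Finset.sum_add_distrib, ← Finset.sum_mul,
      ← Finset.mul_sum]
    ring
  rw [← key]

/-- If the product of `u` and `v` does not depend on the parameters, then the product
on `N` is that of `ℂ^k ⊗ 𝒢𝒩`. -/
theorem lieB_eps_eps_of_eq {u v w : GN n} (h : ∀ t, br n (a t) (b t) u v = w)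
    (g g' : Fin k → ℂ) :
    lieB n star a b (eps n star a b g u) (eps n star a b g' v) = eps n star a b (g * g') w := by
  rw [lieB_eps_eps]
  simp only [h]
  rfl

/-- If the product of `u` and `v` depends on the parameters by a factor `r`, this factor has to
be transported to the parametrization by `cumul`. -/
theorem lieB_eps_eps_of_smul {u v w : GN n} (r : Fin k → ℂ)
    (h : ∀ t, br n (a t) (b t) u v = r t • w) (g g' : Fin k → ℂ) :
    lieB n star a b (eps n star a b g u) (eps n star a b g' v) =
      eps n star a b (cumul star (r * (cumulEquiv star).symm (g * g'))) w := by
  rw [lieB_eps_eps, ← emb_eq_eps, emb_apply]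
  congr 1
  funext t
  rw [h, smul_smul, Pi.mul_apply, mul_comm]

/-- `cumul` is unipotent with respect to the order of the factors, so that conjugating
a diagonal matrix by it preserves the diagonal entries. -/
theorem cumul_mul_symm_single (r : Fin k → ℂ) (t : Fin k) :
    cumul star (r * (cumulEquiv star).symm (Pi.single t 1)) t = r t := by
  classical
  set c := (cumulEquiv star).symm (Pi.single t 1) with hc
  have h : cumul star c = Pi.single t 1 := cumul_symm _
  have h0 : ∀ s, Acts star s t → c s = 0 := by
    intro s
    induction s using (acts_wellFounded star).induction with
    | _ s ih =>
      intro hs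
      have h1 := congrFun h s
      rw [cumul_apply, Finset.sum_eq_zero fun j hj => ih j (Finset.mem_filter.mp hj).2
        (acts_trans (Finset.mem_filter.mp hj).2 hs), add_zero, Pi.single_eq_of_ne] at h1
      · exact h1
      · rintro rfl
        exact acts_irrefl _ hs
  have h1 : c t = 1 := by
    have h1 := congrFun h t
    rwa [cumul_apply, Finset.sum_eq_zero fun j hj => h0 j (Finset.mem_filter.mp hj).2, add_zero,
      Pi.single_eq_same] at h1
  rw [cumul_apply, Finset.sum_eq_zero fun j hj => by
    rw [Pi.mul_apply, h0 j (Finset.mem_filter.mp hj).2, mul_zero]]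
  simp [h1]

/-! ### Brackets of highest weight vectors -/

theorem valid_x {q : ℕ} (h : 1 ≤ q ∧ q ≤ n) : (Sym.x q 1).Valid n := ⟨h.1, h.2, le_rfl, by omega⟩

theorem valid_y {q : ℕ} (h : 1 ≤ q ∧ q ≤ n) (h2 : q ≠ 2) : (Sym.y q 1).Valid n :=
  ⟨h.1, h.2, h2, le_rfl, by omega⟩

theorem valid_x_two (h5 : 5 ≤ n) : (Sym.x 1 2).Valid n := ⟨le_rfl, by omega, by omega, le_rfl⟩

theorem valid_y_two (h5 : 5 ≤ n) : (Sym.y 1 2).Valid n :=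
  ⟨le_rfl, by omega, by omega, by omega, le_rfl⟩

theorem br_x1_x2_eq_c (h5 : 5 ≤ n) (x y : ℂ) :
    br n x y (vec n (.x 1 1)) (vec n (.x 1 2)) = vec n .c := by
  rw [br_vec (valid_x (by omega)) (valid_x_two h5)]
  simp [half]

theorem br_y1_y2_eq_c (h5 : 5 ≤ n) (x y : ℂ) :
    br n x y (vec n (.y 1 1)) (vec n (.y 1 2)) = vec n .c := by
  rw [br_vec (valid_y (by omega) (by omega)) (valid_y_two h5)]
  simp [half]

theorem br_x1_y1_eq_z (h5 : 5 ≤ n) (x y : ℂ) :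
    br n x y (vec n (.x 1 1)) (vec n (.y 1 1)) = vec n (.x 2 1) := by
  rw [br_vec (valid_x (by omega)) (valid_y (by omega) (by omega))]
  simp only [half]
  grind

theorem br_y1_x1_eq_z (h5 : 5 ≤ n) (x y : ℂ) :
    br n x y (vec n (.y 1 1)) (vec n (.x 1 1)) = -vec n (.x 2 1) := by
  rw [br_skew, br_x1_y1_eq_z h5]

theorem br_x1_y2_eq_z (h5 : 5 ≤ n) (x y : ℂ) :
    br n x y (vec n (.x 1 1)) (vec n (.y 1 2)) = vec n (.x 2 2) := by
  rw [br_vec (valid_x (by omega)) (valid_y_two h5)]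
  simp only [half]
  grind

theorem br_y1_x2_eq_z (h5 : 5 ≤ n) (x y : ℂ) :
    br n x y (vec n (.y 1 1)) (vec n (.x 1 2)) = -vec n (.x 2 2) := by
  rw [br_vec (valid_y (by omega) (by omega)) (valid_x_two h5)]
  simp only [half]
  grind

theorem br_x_x_top (h5 : 5 ≤ n) (x y : ℂ) {q : ℕ} (hq : 2 ≤ q ∧ q ≤ n - 1) :
    br n x y (vec n (.x 1 1)) (vec n (.x q 1)) = vec n (.x (q + 1) 1) := by
  rw [br_vec (valid_x (by omega)) (valid_x (by omega))]
  simp only [half]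
  grind

theorem br_y_y_top (h5 : 5 ≤ n) (x y : ℂ) {q : ℕ} (hq : 3 ≤ q ∧ q ≤ n - 2) :
    br n x y (vec n (.y 1 1)) (vec n (.y q 1)) = vec n (.y (q + 1) 1) := by
  rw [br_vec (valid_y (by omega) (by omega)) (valid_y (by omega) (by omega))]
  simp only [half]
  grind

theorem br_y_z_top (h5 : 5 ≤ n) (x y : ℂ) :
    br n x y (vec n (.y 1 1)) (vec n (.x 2 1)) = vec n (.y 3 1) := by
  rw [br_vec (valid_y (by omega) (by omega)) (valid_x (by omega))]
  simp [half]

theorem br_y_x3_top (h5 : 5 ≤ n) (x y : ℂ) :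
    br n x y (vec n (.y 1 1)) (vec n (.x 3 1)) = 0 := by
  rw [br_vec (valid_y (by omega) (by omega)) (valid_x (by omega))]
  simp only [half]
  grind

theorem br_y_x_pred_top (h5 : 5 ≤ n) (x y : ℂ) :
    br n x y (vec n (.y 1 1)) (vec n (.x (n - 1) 1)) = vec n (.y n 1) := by
  rw [br_vec (valid_y (by omega) (by omega)) (valid_x (by omega))]
  simp only [half]
  grind

theorem br_y2_xn_top (h5 : 5 ≤ n) (x y : ℂ) :
    br n x y (vec n (.y 1 2)) (vec n (.x n 1)) = (y * n) • vec n (.y (n - 1) 1) := by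
  rw [br_vec (valid_y_two h5) (valid_x (by omega))]
  have c1 : ¬ n = 2 := by omega
  have c2 : ¬ n = n - 1 := by omega
  have c3 : ¬ n = 1 := by omega
  simp only [half, c1, c2, c3, and_false, false_and, and_self, if_true, if_false, sub_zero]
  congr 1
  push_cast
  ring

theorem br_x2_yn_top (h5 : 5 ≤ n) (x y : ℂ) :
    br n x y (vec n (.x 1 2)) (vec n (.y n 1)) = (-x * n) • vec n (.y (n - 1) 1) := by
  rw [br_vec (valid_x_two h5) (valid_y (by omega) (by omega))]
  have c3 : ¬ n = 1 := by omega
  simp only [half, c3, and_false, false_and, and_self, if_true, if_false, sub_zero]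
  congr 1
  push_cast
  ring

/-! ### Derivations that vanish on `sl₂` -/

/-- The eigenvalue of the Casimir operator on a basis vector. -/
def casEig : Sym → ℂ
  | .c => 0
  | .x p _ => p * (p + 2)
  | .y p _ => p * (p + 2)

/-- The weight of a basis vector. -/
def weight : Sym → ℂ
  | .c => 0
  | .x p i => p + 2 - 2 * i
  | .y p i => p + 2 - 2 * i

theorem casN_vec {s : Sym} (hs : s.Valid n) : casN n (vec n s) = casEig s • vec n s := by
  rcases s with _ | ⟨p, i⟩ | ⟨p, i⟩
  · rw [casN_c, casEig, zero_smul]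
  · exact casN_x hs
  · exact casN_y hs

theorem actH_vec {s : Sym} (hs : s.Valid n) : actH n (vec n s) = weight s • vec n s := by
  rcases s with _ | ⟨p, i⟩ | ⟨p, i⟩
  · rw [actH_c, weight, zero_smul]
  · exact actH_x hs
  · exact actH_y hs

theorem apply_coord_of_diagonal {T : GN n →ₗ[ℂ] GN n} {μ : Sym → ℂ}
    (h : ∀ s : Sym, s.Valid n → T (vec n s) = μ s • vec n s) (v : GN n) (s : Idx n) :
    T v s = μ s.1 * v s := by
  classical
  have : Finsupp.lapply s ∘ₗ T = μ s.1 • (Finsupp.lapply s : GN n →ₗ[ℂ] ℂ) := by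
    refine hom_ext fun t ht => ?_
    rw [LinearMap.comp_apply, h t ht, map_smul, LinearMap.smul_apply, vec_of_valid ht]
    by_cases h : (⟨t, ht⟩ : Idx n) = s
    · subst h
      rfl
    · simp [Finsupp.single_eq_of_ne (Ne.symm h)]
  exact LinearMap.congr_fun this v

/-- The highest weight vectors of weight `1` in `𝒢𝒩(a,b)` are spanned by `x₁` and `y₁`. -/
theorem eq_of_casN_eq (h5 : 5 ≤ n) {v : GN n} (hc : casN n v = (3 : ℂ) • v) (hh : actH n v = v) :
    ∃ r r' : ℂ, v = r • vec n (.x 1 1) + r' • vec n (.y 1 1) := by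
  have hx := valid_x (n := n) (q := 1) (by omega)
  have hy := valid_y (n := n) (q := 1) (by omega) (by omega)
  refine ⟨v ⟨_, hx⟩, v ⟨_, hy⟩, Finsupp.ext fun s => ?_⟩
  have h1 : casN n v s = 3 * v s := by rw [hc]; rfl
  have h2 : actH n v s = v s := by rw [hh]
  rw [apply_coord_of_diagonal fun s hs => casN_vec hs] at h1
  rw [apply_coord_of_diagonal fun s hs => actH_vec hs] at h2
  have nat : ∀ {p i : ℕ} {z : ℂ}, (p : ℂ) * (p + 2) * z = 3 * z →
      ((p : ℂ) + 2 - 2 * i) * z = z → z = 0 ∨ p = 1 ∧ i = 1 := by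
    intro p i z h1 h2
    by_cases hz : z = 0
    · exact Or.inl hz
    · have e1 : (p : ℂ) * (p + 2) = 3 := mul_right_cancel₀ hz h1
      have e2 : (p : ℂ) + 2 - 2 * i = 1 := mul_right_cancel₀ hz (h2.trans (one_mul z).symm)
      have e1' : p * (p + 2) = 3 := by exact_mod_cast e1
      have hp : p = 1 := by nlinarith
      subst hp
      have e2' : (i : ℂ) = 1 := by push_cast at e2; linear_combination -e2 / 2
      exact Or.inr ⟨rfl, by exact_mod_cast e2'⟩
  obtain ⟨s, hs⟩ := s
  rw [Finsupp.add_apply, Finsupp.smul_apply, Finsupp.smul_apply, vec_of_valid hx, vec_of_valid hy]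
  rcases s with _ | ⟨p, i⟩ | ⟨p, i⟩
  · have : v ⟨.c, hs⟩ = 0 := by simpa [casEig] using h1
    rw [this, Finsupp.single_eq_of_ne (by simp), Finsupp.single_eq_of_ne (by simp)]
    simp
  · rcases nat h1 h2 with h | ⟨rfl, rfl⟩
    · rw [h, Finsupp.single_eq_of_ne (a := (⟨.y 1 1, hy⟩ : Idx n)) (by simp)]
      by_cases e : (⟨.x p i, hs⟩ : Idx n) = ⟨.x 1 1, hx⟩
      · rw [e] at h
        simp [h]
      · rw [Finsupp.single_eq_of_ne e]
        simp
    · simp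
  · rcases nat h1 h2 with h | ⟨rfl, rfl⟩
    · rw [h, Finsupp.single_eq_of_ne (a := (⟨.x 1 1, hx⟩ : Idx n)) (by simp)]
      by_cases e : (⟨.y p i, hs⟩ : Idx n) = ⟨.y 1 1, hy⟩
      · rw [e] at h
        simp [h]
      · rw [Finsupp.single_eq_of_ne e]
        simp
    · simp

/-- The highest weight vectors of weight `1` in `sl₂ ⋉ N`. -/
theorem eq_eps_of_cas_eq (h5 : 5 ≤ n) {w : SlG n star a b} (hc : cas n star a b w = (3 : ℂ) • w)
    (hh : lieB n star a b (ofSl slH) w = w) :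
    ∃ g h, w = eps n star a b g (vec n (.x 1 1)) + eps n star a b h (vec n (.y 1 1)) := by
  have e := eq_ofSl_add_ofN w
  have hofN : ∀ F : Fin k → GN n, cas n star a b (ofN F) = ofN fun t => casN n (F t) := by
    intro F
    simp only [cas, casN, casimir, LinearMap.add_apply, LinearMap.smul_apply,
      Module.End.mul_apply, lieB_ofSl_ofN, act_slE, act_slF, act_slH, ← ofN_add, ← ofN_smul]
    rfl
  have h1 : w.1 = 0 := by
    rw [e, map_add, cas_ofSl, hofN] at hc
    have h : (8 : ℂ) • w.1 + 0 = (3 : ℂ) • (w.1 + 0) := congrArg Prod.fst hc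
    rw [add_zero, add_zero, ← sub_eq_zero, ← sub_smul] at h
    exact (smul_eq_zero_iff_right (by norm_num)).mp h
  have e' : w = ofN w.2 := Prod.ext h1 rfl
  rw [e', hofN, ← ofN_smul] at hc
  rw [e', lieB_ofSl_ofN, act_slH] at hh
  have hc' := ofN_injective hc
  have hh' := ofN_injective hh
  choose r r' hr using fun t => eq_of_casN_eq h5 (congrFun hc' t) (congrFun hh' t)
  refine ⟨cumul star r, cumul star r', ?_⟩
  rw [← emb_eq_eps, ← emb_eq_eps, emb_apply, emb_apply, ← ofN_add, e']
  exact congrArg ofN (funext hr)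

theorem eps_eq_zero {g : Fin k → ℂ} (hg : g ≠ 0) {v : GN n} (h : eps n star a b g v = 0) :
    v = 0 := by
  have h1 : (cumulEquiv star).symm g ≠ 0 := fun h => hg (by simpa using h)
  obtain ⟨t, ht⟩ := Function.ne_iff.mp h1
  have := congrFun (ofN_injective (h.trans ofN_zero.symm)) t
  exact (smul_eq_zero_iff_right ht).mp this

variable {D : Module.End ℂ (SlG n star a b)}

theorem IsDer.comm_sl (hD : IsDer D) (h0 : ∀ A, D (ofSl A) = 0) (A : SL2) (u : SlG n star a b) :
    D (lieB n star a b (ofSl A) u) = lieB n star a b (ofSl A) (D u) := by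
  rw [hD, h0, map_zero, LinearMap.zero_apply, zero_add]

theorem IsDer.comm_cas (hD : IsDer D) (h0 : ∀ A, D (ofSl A) = 0) (u : SlG n star a b) :
    D (cas n star a b u) = cas n star a b (D u) := by
  simp only [cas, casimir, LinearMap.add_apply, LinearMap.smul_apply, Module.End.mul_apply,
    map_add, map_smul, hD.comm_sl h0]

/-- A derivation that vanishes on `sl₂` maps `g ⊗ x_i` and `g ⊗ y_i` to combinations of such
vectors. -/
theorem IsDer.exists_coeff (h5 : 5 ≤ n) (hD : IsDer D) (h0 : ∀ A, D (ofSl A) = 0) :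
    ∃ α β γ δ : (Fin k → ℂ) → (Fin k → ℂ), ∀ g, ∀ i, 1 ≤ i ∧ i ≤ 2 →
      D (eps n star a b g (vec n (.x 1 i))) =
        eps n star a b (α g) (vec n (.x 1 i)) + eps n star a b (β g) (vec n (.y 1 i)) ∧
      D (eps n star a b g (vec n (.y 1 i))) =
        eps n star a b (γ g) (vec n (.x 1 i)) + eps n star a b (δ g) (vec n (.y 1 i)) := by
  have hx := valid_x (n := n) (q := 1) (by omega)
  have hy := valid_y (n := n) (q := 1) (by omega) (by omega)
  have key : ∀ s : Sym, s.Valid n → casEig s = 3 → weight s = 1 → ∀ g, ∃ h h',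
      D (eps n star a b g (vec n s)) =
        eps n star a b h (vec n (.x 1 1)) + eps n star a b h' (vec n (.y 1 1)) := by
    intro s hs h3 h1 g
    refine eq_eps_of_cas_eq h5 ?_ ?_
    · rw [← hD.comm_cas h0, cas_eps, casN_vec hs, h3, map_smul, map_smul]
    · rw [← hD.comm_sl h0, lieB_ofSl_eps, act_slH, actH_vec hs, h1, one_smul]
  choose α β hαβ using key _ hx (by norm_num [casEig]) (by norm_num [weight])
  choose γ δ hγδ using key _ hy (by norm_num [casEig]) (by norm_num [weight])
  refine ⟨α, β, γ, δ, fun g i hi => ?_⟩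
  have fx : vec n (.x 1 2) = act n slF (vec n (.x 1 1)) := by
    rw [act_slF, actF_x hx]
    simp
  have fy : vec n (.y 1 2) = act n slF (vec n (.y 1 1)) := by
    rw [act_slF, actF_y hy]
    simp
  obtain rfl | rfl : i = 1 ∨ i = 2 := by omega
  · exact ⟨hαβ g, hγδ g⟩
  · rw [fx, fy]
    simp only [← lieB_ofSl_eps]
    rw [hD.comm_sl h0, hD.comm_sl h0, hαβ, hγδ, map_add, map_add]
    exact ⟨rfl, rfl⟩

theorem eps_zero_right (g : Fin k → ℂ) : eps n star a b g 0 = 0 := map_zero _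

/-- On the first layer, a derivation that vanishes on `sl₂` preserves the factors of
`ℂ^k ⊗ 𝒢𝒩`, and its diagonal coefficients on the `x_i` and `y_i` agree. -/
theorem IsDer.exists_scalars (h5 : 5 ≤ n) (hD : IsDer D) (h0 : ∀ A, D (ofSl A) = 0) :
    ∃ α β γ : Fin k → ℂ, ∀ t, ∀ i, 1 ≤ i ∧ i ≤ 2 →
      D (eps n star a b (Pi.single t 1) (vec n (.x 1 i))) =
        α t • eps n star a b (Pi.single t 1) (vec n (.x 1 i)) +
          β t • eps n star a b (Pi.single t 1) (vec n (.y 1 i)) ∧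
      D (eps n star a b (Pi.single t 1) (vec n (.y 1 i))) =
        γ t • eps n star a b (Pi.single t 1) (vec n (.x 1 i)) +
          α t • eps n star a b (Pi.single t 1) (vec n (.y 1 i)) := by
  obtain ⟨α, β, γ, δ, h⟩ := hD.exists_coeff h5 h0
  have hX := fun g i hi => (h g i hi).1
  have hY := fun g i hi => (h g i hi).2
  have B : ∀ {u v w : GN n}, (∀ x y, br n x y u v = w) → ∀ g g' : Fin k → ℂ,
      lieB n star a b (eps n star a b g u) (eps n star a b g' v) = eps n star a b (g * g') w :=
    fun h g g' => lieB_eps_eps_of_eq (fun t => h _ _) g g'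
  have bxx : ∀ x y, br n x y (vec n (.x 1 1)) (vec n (.x 1 1)) = 0 := fun x y => br_self x y _
  have byy : ∀ x y, br n x y (vec n (.y 1 1)) (vec n (.y 1 1)) = 0 := fun x y => br_self x y _
  have bxy := br_x1_y1_eq_z h5
  have byx := br_y1_x1_eq_z h5
  have bxx' := br_x1_x2_eq_c h5
  have byy' := br_y1_y2_eq_c h5
  have bxy' := br_x1_y2_eq_z h5
  have byx' := br_y1_x2_eq_z h5
  have vz : (Sym.x 2 1).Valid n := valid_x (by omega)
  -- the relations `[x₁, x₁] = 0` and `[y₁, y₁] = 0`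
  have hβ : ∀ g g', β g * g' = g * β g' := by
    intro g g'
    have := hD (eps n star a b g (vec n (.x 1 1))) (eps n star a b g' (vec n (.x 1 1)))
    rw [B bxx, hX _ _ (by omega), hX _ _ (by omega), map_add, LinearMap.add_apply, map_add, B bxx,
      B bxx, B byx, B bxy, eps_zero_right, eps_zero_right, eps_zero_right, map_zero, map_neg,
      zero_add, zero_add, neg_add_eq_sub, eq_comm, sub_eq_zero] at this
    exact (eps_injective vz this).symm
  have hγ : ∀ g g', γ g * g' = g * γ g' := by
    intro g g'
    have := hD (eps n star a b g (vec n (.y 1 1))) (eps n star a b g' (vec n (.y 1 1)))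
    rw [B byy, hY _ _ (by omega), hY _ _ (by omega), map_add, LinearMap.add_apply, map_add, B byy,
      B byy, B byx, B bxy, eps_zero_right, eps_zero_right, eps_zero_right, map_zero, map_neg,
      add_zero, add_zero, ← sub_eq_add_neg, eq_comm, sub_eq_zero] at this
    exact eps_injective vz this
  -- the relations `[x₁, x₂] = c` and `[y₁, y₂] = c`
  have hα : ∀ g g', D (eps n star a b (g * g') (vec n .c)) =
      eps n star a b (α g * g' + g * α g') (vec n .c) := by
    intro g g'
    rw [← B bxx', hD, hX _ _ (by omega), hX _ _ (by omega), map_add, LinearMap.add_apply, map_add,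
      B bxx', B bxx', B byx', B bxy', map_neg, hβ, map_add, LinearMap.add_apply]
    abel
  have hδ : ∀ g g', D (eps n star a b (g * g') (vec n .c)) =
      eps n star a b (δ g * g' + g * δ g') (vec n .c) := by
    intro g g'
    rw [← B byy', hD, hY _ _ (by omega), hY _ _ (by omega), map_add, LinearMap.add_apply, map_add,
      B byy', B byy', B bxy', B byx', map_neg, hγ, map_add, LinearMap.add_apply]
    abel
  have vc : (Sym.c).Valid n := trivial
  have h1 : α 1 = δ 1 := by
    have := eps_injective vc ((hα 1 1).symm.trans (hδ 1 1))
    simp only [one_mul, mul_one] at this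
    funext t
    have := congrFun this t
    simp only [Pi.add_apply] at this
    linear_combination this / 2
  have idem : ∀ (φ : (Fin k → ℂ) → (Fin k → ℂ)), (∀ g g', D (eps n star a b (g * g') (vec n .c)) =
      eps n star a b (φ g * g' + g * φ g') (vec n .c)) →
      ∀ t, φ (Pi.single t 1) = φ 1 t • Pi.single t 1 := by
    intro φ hφ t
    have hid : (Pi.single t 1 : Fin k → ℂ) * Pi.single t 1 = Pi.single t 1 * 1 := by
      rw [← Pi.single_mul]
      simp
    have h := eps_injective vc (((hφ (Pi.single t 1) (Pi.single t 1)).symm.trans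
      (by rw [hid])).trans (hφ (Pi.single t 1) 1))
    funext s
    have hs := congrFun h s
    simp only [Pi.add_apply, Pi.mul_apply, Pi.one_apply] at hs
    rw [Pi.smul_apply, smul_eq_mul]
    by_cases hst : s = t
    · subst hst
      simp only [Pi.single_eq_same] at hs ⊢
      linear_combination hs
    · simp only [Pi.single_eq_of_ne hst] at hs ⊢
      linear_combination -hs
  have mul : ∀ (φ : (Fin k → ℂ) → (Fin k → ℂ)), (∀ g g', φ g * g' = g * φ g') →
      ∀ t, φ (Pi.single t 1) = φ 1 t • Pi.single t 1 := by
    intro φ hφ t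
    have h := hφ (Pi.single t 1) 1
    rw [mul_one] at h
    rw [h]
    funext s
    by_cases hst : s = t
    · subst hst; simp
    · simp [Pi.single_eq_of_ne hst]
  refine ⟨α 1, β 1, γ 1, fun t i hi => ?_⟩
  rw [hX _ _ hi, hY _ _ hi, idem α hα, mul β hβ, mul γ hγ, idem δ hδ, h1]
  simp only [map_smul, LinearMap.smul_apply, and_self]

theorem lieB_single (t : Fin k) {u v w : GN n} (h : ∀ x y, br n x y u v = w) :
    lieB n star a b (eps n star a b (Pi.single t 1) u) (eps n star a b (Pi.single t 1) v) =
      eps n star a b (Pi.single t 1) w := by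
  rw [lieB_eps_eps_of_eq (fun t => h _ _), ← Pi.single_mul, mul_one]

theorem vec_x_vec_y_independent (h5 : 5 ≤ n) {r r' : ℂ}
    (h : r • vec n (.x 4 1) + r' • vec n (.y 4 1) = 0) : r = 0 ∧ r' = 0 := by
  have hx := valid_x (n := n) (q := 4) (by omega)
  have hy := valid_y (n := n) (q := 4) (by omega) (by omega)
  rw [vec_of_valid hx, vec_of_valid hy] at h
  have h1 := DFunLike.congr_fun h ⟨_, hx⟩
  have h2 := DFunLike.congr_fun h ⟨_, hy⟩
  rw [Finsupp.add_apply, Finsupp.smul_apply, Finsupp.smul_apply] at h1 h2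
  rw [Finsupp.single_eq_same, Finsupp.single_eq_of_ne (by simp)] at h1
  rw [Finsupp.single_eq_same, Finsupp.single_eq_of_ne (by simp)] at h2
  simpa using And.intro h1 h2

/-- On the first layer, a derivation that vanishes on `sl₂` multiplies each factor of
`ℂ^k ⊗ 𝒢𝒩` by a scalar. -/
theorem IsDer.exists_scalar (h5 : 5 ≤ n) (hD : IsDer D) (h0 : ∀ A, D (ofSl A) = 0) :
    ∃ α : Fin k → ℂ, ∀ t, ∀ i, 1 ≤ i ∧ i ≤ 2 →
      D (eps n star a b (Pi.single t 1) (vec n (.x 1 i))) =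
        α t • eps n star a b (Pi.single t 1) (vec n (.x 1 i)) ∧
      D (eps n star a b (Pi.single t 1) (vec n (.y 1 i))) =
        α t • eps n star a b (Pi.single t 1) (vec n (.y 1 i)) := by
  obtain ⟨α, β, γ, h⟩ := hD.exists_scalars h5 h0
  have key : ∀ t, γ t = 0 ∧ β t = 0 := by
    intro t
    obtain ⟨hX, hY⟩ := h t 1 (by omega)
    set e := eps n star a b (Pi.single t 1) with he
    have B : ∀ {u v w : GN n}, (∀ x y, br n x y u v = w) →
      lieB n star a b (e u) (e v) = e w := fun h => lieB_single t h
    have bxy := B (br_x1_y1_eq_z h5)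
    have bxx := B fun x y => br_self x y (vec n (.x 1 1))
    have byy := B fun x y => br_self x y (vec n (.y 1 1))
    have bxz := B fun x y => br_x_x_top h5 x y (q := 2) (by omega)
    have byz := B (br_y_z_top h5)
    have bx3 := B fun x y => br_x_x_top h5 x y (q := 3) (by omega)
    have by3 := B fun x y => br_y_y_top h5 x y (q := 3) (by omega)
    have byx3 := B (br_y_x3_top h5)
    have hz : D (e (vec n (.x 2 1))) = (2 * α t) • e (vec n (.x 2 1)) := by
      rw [← bxy, hD, hX, hY]
      simp only [map_add, map_smul, LinearMap.add_apply, LinearMap.smul_apply, bxy, bxx, byy,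
        map_zero]
      module
    have h3 : D (e (vec n (.x 3 1))) =
        (3 * α t) • e (vec n (.x 3 1)) + β t • e (vec n (.y 3 1)) := by
      rw [← bxz, hD, hX, hz]
      simp only [map_add, map_smul, LinearMap.add_apply, LinearMap.smul_apply, bxz, byz]
      module
    -- the relation `[y₁, x₁³] = 0`
    have h4 : e (γ t • vec n (.x 4 1) + β t • vec n (.y 4 1)) = 0 := by
      have := hD (e (vec n (.y 1 1))) (e (vec n (.x 3 1)))
      rw [byx3, map_zero, map_zero, hY, h3] at this
      simp only [map_add, map_smul, LinearMap.add_apply, LinearMap.smul_apply, bx3, by3, byx3,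
        map_zero, smul_zero, add_zero, zero_add] at this
      rw [map_add, map_smul, map_smul, ← this]
    exact vec_x_vec_y_independent h5 (eps_eq_zero (by simp) h4)
  refine ⟨α, fun t i hi => ?_⟩
  have := h t i hi
  rw [(key t).1, (key t).2, zero_smul, zero_smul, add_zero, zero_add] at this
  exact this

/-- A derivation that multiplies `x₁` and `y₁` in a factor of `ℂ^k ⊗ 𝒢𝒩` by `α` multiplies `x₁^q`
and `y₁^q` by `q α`, as these are iterated products of `x₁` and `y₁`. This includes `q = n - 1` for
`y₁^q`, although `y^{n-1}` occurs in products with the layers `n`, too. -/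
theorem IsDer.apply_top (h5 : 5 ≤ n) (hD : IsDer D) {α : ℂ} {t : Fin k}
    (hX : D (eps n star a b (Pi.single t 1) (vec n (.x 1 1))) =
        α • eps n star a b (Pi.single t 1) (vec n (.x 1 1)))
    (hY : D (eps n star a b (Pi.single t 1) (vec n (.y 1 1))) =
        α • eps n star a b (Pi.single t 1) (vec n (.y 1 1))) :
    (∀ q, 1 ≤ q → q ≤ n → D (eps n star a b (Pi.single t 1) (vec n (.x q 1))) =
        (q * α) • eps n star a b (Pi.single t 1) (vec n (.x q 1))) ∧
    (∀ q, 1 ≤ q → q ≠ 2 → q ≤ n → D (eps n star a b (Pi.single t 1) (vec n (.y q 1))) =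
        (q * α) • eps n star a b (Pi.single t 1) (vec n (.y q 1))) := by
  set e := eps n star a b (Pi.single t 1) with he
  have B : ∀ {u v w : GN n}, (∀ x y, br n x y u v = w) →
    lieB n star a b (e u) (e v) = e w := fun h => lieB_single t h
  have bxy := B (br_x1_y1_eq_z h5)
  have byz := B (br_y_z_top h5)
  have bym := B (br_y_x_pred_top h5)
  have step : ∀ {u v w : GN n} {r s : ℂ}, lieB n star a b (e u) (e v) = e w →
      D (e u) = r • e u → D (e v) = s • e v → D (e w) = (r + s) • e w := by
    intro u v w r s h hu hv
    rw [← h, hD, hu, hv]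
    simp only [map_smul, LinearMap.smul_apply, add_smul]
  have hx : ∀ q, 1 ≤ q → q ≤ n → D (e (vec n (.x q 1))) = (q * α) • e (vec n (.x q 1)) := by
    intro q h1
    induction q, h1 using Nat.le_induction with
    | base => intro _; rw [hX, Nat.cast_one, one_mul]
    | succ q h1 ih =>
      intro h
      rcases h1.eq_or_lt with rfl | h2
      · rw [step bxy hX hY]
        congr 1
        push_cast
        ring
      · rw [step (B fun x y => br_x_x_top h5 x y (q := q) (by omega)) hX (ih (by omega))]
        congr 1
        push_cast
        ring
  have hy : ∀ q, 3 ≤ q → q ≤ n - 1 → D (e (vec n (.y q 1))) = (q * α) • e (vec n (.y q 1)) := by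
    intro q h1
    induction q, h1 using Nat.le_induction with
    | base =>
      intro _
      rw [step byz hY (hx 2 (by omega) (by omega))]
      congr 1
      push_cast
      ring
    | succ q h1 ih =>
      intro h
      rw [step (B fun x y => br_y_y_top h5 x y (q := q) (by omega)) hY (ih (by omega))]
      congr 1
      push_cast
      ring
  refine ⟨hx, fun q h1 h2 h3 => ?_⟩
  rcases h1.eq_or_lt with rfl | h1
  · rw [hY, Nat.cast_one, one_mul]
  rcases h3.eq_or_lt with rfl | h3
  · rw [step bym hY (hx _ (by omega) (by omega))]
    congr 1
    rw [Nat.cast_sub (by omega)]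
    push_cast
    ring
  · exact hy q (by omega) (by omega)

/-- A linear map that multiplies `v` in each factor of `ℂ^k ⊗ 𝒢𝒩` by a scalar acts on
`ℂ^k ⊗ v` by a diagonal matrix. -/
theorem apply_eps_of_single {v : GN n} {r : Fin k → ℂ}
    (h : ∀ t, D (eps n star a b (Pi.single t 1) v) = r t • eps n star a b (Pi.single t 1) v)
    (g : Fin k → ℂ) : D (eps n star a b g v) = eps n star a b (r * g) v := by
  have hg : g = ∑ t, g t • (Pi.single t 1 : Fin k → ℂ) := by
    funext s
    simp [Finset.sum_apply, Pi.single_apply]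
  have hrg : r * g = ∑ t, (g t * r t) • (Pi.single t 1 : Fin k → ℂ) := by
    funext s
    simp [Finset.sum_apply, Pi.single_apply, mul_comm]
  rw [hrg]
  nth_rewrite 1 [hg]
  simp only [map_sum, LinearMap.sum_apply, map_smul, LinearMap.smul_apply, h, smul_smul]

theorem IsDer.scalar_eq_zero (h5 : 5 ≤ n) (hab : ∀ i, ¬ (a i = 0 ∧ b i = 0)) (hD : IsDer D)
    {α : Fin k → ℂ} (h : ∀ t, ∀ i, 1 ≤ i ∧ i ≤ 2 →
      D (eps n star a b (Pi.single t 1) (vec n (.x 1 i))) =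
        α t • eps n star a b (Pi.single t 1) (vec n (.x 1 i)) ∧
      D (eps n star a b (Pi.single t 1) (vec n (.y 1 i))) =
        α t • eps n star a b (Pi.single t 1) (vec n (.y 1 i))) (t : Fin k) : α t = 0 := by
  have hn0 : (n : ℂ) ≠ 0 := by exact_mod_cast (by omega : n ≠ 0)
  have vy : (Sym.y (n - 1) 1).Valid n := valid_y (by omega) (by omega)
  have top := fun t => hD.apply_top h5 (h t 1 (by omega)).1 (h t 1 (by omega)).2
  have hy : ∀ g, D (eps n star a b g (vec n (.y (n - 1) 1))) =
      eps n star a b (((n : ℂ) - 1) • (α * g)) (vec n (.y (n - 1) 1)) := by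
    intro g
    rw [apply_eps_of_single (r := ((n : ℂ) - 1) • α) (fun t => ?_) g, smul_mul_assoc]
    rw [(top t).2 (n - 1) (by omega) (by omega) (by omega), Nat.cast_sub (by omega), Nat.cast_one]
    rfl
  -- compares the two sides of `D [u, v] = [D u, v] + [u, D v]` if `[u, v]` lies in the
  -- layer of `y^{n-1}`, whereas `u` and `v` are in the layers `1` and `n`
  have key : ∀ (u v : GN n) (r : Fin k → ℂ),
      (∀ t, br n (a t) (b t) u v = r t • vec n (.y (n - 1) 1)) →
      D (eps n star a b (Pi.single t 1) u) = α t • eps n star a b (Pi.single t 1) u →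
      D (eps n star a b (Pi.single t 1) v) = ((n : ℂ) * α t) • eps n star a b (Pi.single t 1) v →
      r t * α t = 0 := by
    intro u v r hr hu hv
    have hB := lieB_eps_eps_of_smul (star := star) r hr (Pi.single t 1) (Pi.single t 1)
    have hid : (Pi.single t 1 : Fin k → ℂ) * Pi.single t 1 = Pi.single t 1 := by
      rw [← Pi.single_mul, mul_one]
    rw [hid] at hB
    have := hD (eps n star a b (Pi.single t 1) u) (eps n star a b (Pi.single t 1) v)
    rw [hu, hv, map_smul, map_smul, LinearMap.smul_apply, hB, hy, ← add_smul,
      ← LinearMap.smul_apply, ← map_smul] at this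
    have h1 := congrFun (eps_injective vy this) t
    simp only [Pi.smul_apply, Pi.mul_apply, smul_eq_mul, cumul_mul_symm_single] at h1
    linear_combination -h1 / 2
  have kx := key (vec n (.x 1 2)) (vec n (.y n 1)) (fun t => -a t * n)
    (fun t => br_x2_yn_top h5 _ _) (h t 2 (by omega)).1
    ((top t).2 n (by omega) (by omega) le_rfl)
  have ky := key (vec n (.y 1 2)) (vec n (.x n 1)) (fun t => b t * n)
    (fun t => br_y2_xn_top h5 _ _) (h t 2 (by omega)).2 ((top t).1 n (by omega) le_rfl)
  by_contra hα
  refine hab t ⟨?_, ?_⟩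
  · simpa [hα, hn0] using kx
  · simpa [hα, hn0] using ky

/-- A derivation of `sl₂ ⋉ N` that vanishes on `sl₂` is zero. -/
theorem IsDer.eq_zero (h5 : 5 ≤ n) (hab : ∀ i, ¬ (a i = 0 ∧ b i = 0)) (hD : IsDer D)
    (h0 : ∀ A, D (ofSl A) = 0) : D = 0 := by
  obtain ⟨α, hα⟩ := hD.exists_scalar h5 h0
  have hα0 := hD.scalar_eq_zero h5 hab hα
  have top := fun t => hD.apply_top h5 (hα t 1 (by omega)).1 (hα t 1 (by omega)).2
  have hvec : ∀ t (s : Sym), s.Valid n → D (eps n star a b (Pi.single t 1) (vec n s)) = 0 := by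
    intro t s hs
    -- `f` maps each basis vector to a multiple of the next one
    have step : ∀ {u v : GN n} {r : ℂ}, r ≠ 0 → actF n u = r • v →
        D (eps n star a b (Pi.single t 1) u) = 0 → D (eps n star a b (Pi.single t 1) v) = 0 := by
      intro u v r hr hv hu
      have := hD.comm_sl h0 slF (eps n star a b (Pi.single t 1) u)
      rw [hu, lieB_ofSl_eps, act_slF, hv, map_smul, map_smul, map_zero] at this
      exact (smul_eq_zero_iff_right hr).mp this
    have hne : ∀ {q i : ℕ}, i + 1 ≤ q + 1 → (q : ℂ) + 1 - i ≠ 0 := by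
      intro q i hi h
      rw [sub_eq_zero] at h
      have : q + 1 = i := by exact_mod_cast h
      omega
    rcases s with _ | ⟨q, i⟩ | ⟨q, i⟩
    · rw [← lieB_single t (br_x1_x2_eq_c h5), hD, (hα t 1 (by omega)).1, (hα t 2 (by omega)).1,
        hα0, zero_smul, zero_smul, map_zero, map_zero, LinearMap.zero_apply, add_zero]
    · obtain ⟨h1, h2, h3, h4⟩ := hs
      induction i, h3 using Nat.le_induction with
      | base => rw [(top t).1 q h1 h2, hα0, mul_zero, zero_smul]
      | succ i h3 ih =>
        exact step (hne h4) (actF_x ⟨h1, h2, h3, by omega⟩) (ih (by omega))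
    · obtain ⟨h1, h2, h2', h3, h4⟩ := hs
      induction i, h3 using Nat.le_induction with
      | base => rw [(top t).2 q h1 h2' h2, hα0, mul_zero, zero_smul]
      | succ i h3 ih =>
        exact step (hne h4) (actF_y ⟨h1, h2, h2', h3, by omega⟩) (ih (by omega))
  refine slG_hom_ext (fun A => h0 A) fun c s hs => ?_
  rw [emb_eq_eps]
  rw [apply_eps_of_single (r := 0) (fun t => by rw [hvec t s hs, Pi.zero_apply, zero_smul]),
    zero_mul, map_zero]
  rfl

/-- Every derivation of `sl₂ ⋉ N` is inner. -/
theorem IsDer.exists_eq (hn : Odd n) (h5 : 5 ≤ n) (hab : ∀ i, ¬ (a i = 0 ∧ b i = 0))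
    (hD : IsDer D) : ∃ w, D = lieB n star a b w := by
  obtain ⟨w, hw, h⟩ := exists_inner_on_sl hn h5 hD
  refine ⟨w, sub_eq_zero.mp (IsDer.eq_zero h5 hab (D := D - lieB n star a b w) ?_ fun A => ?_)⟩
  · intro u v
    have hw : ∀ u v, lieB n star a b w (lieB n star a b u v) =
      lieB n star a b (lieB n star a b w u) v + lieB n star a b u (lieB n star a b w v) := hw
    simp only [LinearMap.sub_apply, map_sub, hD u v, hw u v]
    abel
  · rw [LinearMap.sub_apply, h, sub_self]

/-! ### Center, perfectness and the Jacobi identity -/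

theorem vec_ne_zero {s : Sym} (hs : s.Valid n) : vec n s ≠ 0 := by
  rw [vec_of_valid hs]
  exact Finsupp.single_ne_zero.mpr one_ne_zero

theorem emb_c_ne_zero (t : Fin k) : emb n star a b (Pi.single t 1) (vec n .c) ≠ 0 := by
  intro h
  have := congrFun (ofN_injective (h.trans ofN_zero.symm)) t
  rw [Pi.single_eq_same, one_smul] at this
  exact vec_ne_zero (s := .c) trivial this

theorem lieB_emb_c (g : Fin k → ℂ) : lieB n star a b (emb n star a b g (vec n .c)) = 0 := by
  refine slG_hom_ext (fun A => ?_) fun d s _ => ?_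
  · rw [lieB_skew, lieB_ofSl_emb]
    simp [act, actE_c, actF_c, actH_c]
  · rw [lieB_emb_emb]
    simp only [br_c_left, smul_zero]
    rfl

theorem cas_apply (u : SlG n star a b) : cas n star a b u =
    (2 : ℂ) • (lieB n star a b (ofSl slE) (lieB n star a b (ofSl slF) u) +
      lieB n star a b (ofSl slF) (lieB n star a b (ofSl slE) u)) +
      lieB n star a b (ofSl slH) (lieB n star a b (ofSl slH) u) := rfl

/-- `sl₂ ⋉ N` is spanned by products, as the Casimir operator is invertible on all of it except
the `c`-components. -/
theorem span_lieB_eq_top (h5 : 5 ≤ n) :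
    Submodule.span ℂ {w | ∃ u v, lieB n star a b u v = w} = ⊤ := by
  set P := Submodule.span ℂ {w | ∃ u v, lieB n star a b u v = w} with hP
  have mem : ∀ u v, lieB n star a b u v ∈ P := fun u v => Submodule.subset_span ⟨u, v, rfl⟩
  clear_value P
  have hcas : ∀ u, cas n star a b u ∈ P := fun u => by
    rw [cas_apply]
    exact P.add_mem (P.smul_mem _ (P.add_mem (mem _ _) (mem _ _))) (mem _ _)
  have hsmul : ∀ {r : ℂ} {u : SlG n star a b}, r ≠ 0 → r • u ∈ P → u ∈ P := fun hr hu =>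
    (P.smul_mem_iff hr).mp hu
  refine slG_eq_top_of_emb (fun A => ?_) fun g s hs => ?_
  · have := hcas (ofSl A)
    rw [cas_ofSl] at this
    exact hsmul (by norm_num) this
  · have hne : ∀ {p : ℕ}, 1 ≤ p → (p : ℂ) * (p + 2) ≠ 0 := fun {p} hp => by
      exact_mod_cast (by positivity : p * (p + 2) ≠ 0)
    rcases s with _ | ⟨p, i⟩ | ⟨p, i⟩
    · have := mem (eps n star a b (cumul star g) (vec n (.x 1 1))) (eps n star a b 1 (vec n (.x 1 2)))
      rwa [lieB_eps_eps_of_eq (fun t => br_x1_x2_eq_c h5 _ _), mul_one, ← emb_eq_eps] at this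
    · have := hcas (emb n star a b g (vec n (.x p i)))
      rw [cas_emb, casN_x hs, map_smul] at this
      exact hsmul (hne hs.1) this
    · have := hcas (emb n star a b g (vec n (.y p i)))
      rw [cas_emb, casN_y hs, map_smul] at this
      exact hsmul (hne hs.1) this

/-- Each factor `N_t` is a subalgebra. -/
theorem lieB_emb_single (t : Fin k) (u v : GN n) :
    lieB n star a b (emb n star a b (Pi.single t 1) u) (emb n star a b (Pi.single t 1) v) =
      emb n star a b (Pi.single t 1) (br n (a t) (b t) u v) := by
  rw [lieB_emb_emb, emb_apply]
  refine congrArg ofN (funext fun s => ?_)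
  by_cases hs : s = t
  · rw [hs, Pi.single_eq_same, Finset.sum_eq_zero, mul_one, add_zero]
    intro j hj
    have hj : j ≠ t := by
      classical
      rintro rfl
      exact acts_irrefl _ (Finset.mem_filter.mp hj).2
    rw [Pi.single_eq_of_ne hj, mul_zero, zero_mul, add_zero]
  · rw [Pi.single_eq_of_ne hs, zero_smul, zero_mul, Finset.sum_eq_zero, add_zero, zero_smul]
    intro j _
    rw [mul_zero, zero_mul, add_zero]

/-- The Jacobi expression of `x₁`, `y₂` and `x₁^{n-1}`. -/
theorem br_jacobi (h5 : 5 ≤ n) (x y : ℂ) :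
    br n x y (vec n (.x 1 1)) (br n x y (vec n (.y 1 2)) (vec n (.x (n - 1) 1))) +
      br n x y (vec n (.y 1 2)) (br n x y (vec n (.x (n - 1) 1)) (vec n (.x 1 1))) +
      br n x y (vec n (.x (n - 1) 1)) (br n x y (vec n (.x 1 1)) (vec n (.y 1 2))) =
      ((x - y) * ((n + 1) / 2)) • vec n (.y (n - 1) 1) := by
  have vm : (Sym.x (n - 1) 1).Valid n := valid_x (by omega)
  have vz : (Sym.x 2 2).Valid n := ⟨by omega, by omega, by omega, by omega⟩
  have vyn : (Sym.y n 2).Valid n := ⟨by omega, by omega, by omega, by omega, by omega⟩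
  have h1 : br n x y (vec n (.y 1 2)) (vec n (.x (n - 1) 1)) = vec n (.y n 2) := by
    rw [br_vec (valid_y_two h5) vm]
    simp only [half]
    grind
  have h2 : br n x y (vec n (.x 1 1)) (vec n (.y n 2)) = x • vec n (.y (n - 1) 1) := by
    rw [br_vec (valid_x (by omega)) vyn]
    have c3 : ¬ n = 1 := by omega
    simp only [half, c3, and_false, false_and, and_self, if_true, if_false, sub_zero]
    congr 1
    push_cast
    ring
  have h3 : br n x y (vec n (.x (n - 1) 1)) (vec n (.x 1 1)) = -vec n (.x n 1) := by
    rw [br_skew, br_x_x_top h5 x y (q := n - 1) (by omega), show n - 1 + 1 = n by omega]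
  have h4 : br n x y (vec n (.x (n - 1) 1)) (vec n (.x 2 2)) =
      ((x + y) / 2 * (n - 1)) • vec n (.y (n - 1) 1) := by
    rw [br_skew, br_vec vz vm]
    have c1 : ¬ n - 1 = 1 := by omega
    have c2 : (2 < n - 1 ∨ 2 = n - 1 ∧ 2 < 1) ∧ 2 + (n - 1) = n + 1 := by omega
    have c3 : ¬ n + 1 = n := by omega
    have c4 : ¬ n - 1 < 2 := by omega
    have c5 : ¬ n - 1 = 2 := by omega
    have c6 : ¬ (2 = 1) := by omega
    simp only [half, c1, c2, c3, c4, c5, c6, and_false, false_and, and_self, if_true, if_false,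
      sub_zero, or_self, le_refl, true_and]
    rw [← neg_smul]
    congr 1
    push_cast
    ring
  rw [h1, h2, h3, br_x1_y2_eq_z h5, h4, map_neg, br_y2_xn_top h5]
  module

theorem eq_of_jacobi (h5 : 5 ≤ n)
    (h : ∀ u v w : SlG n star a b, ⁅u, ⁅v, w⁆⁆ + ⁅v, ⁅w, u⁆⁆ + ⁅w, ⁅u, v⁆⁆ = 0) (t : Fin k) :
    a t = b t := by
  have := h (emb n star a b (Pi.single t 1) (vec n (.x 1 1)))
    (emb n star a b (Pi.single t 1) (vec n (.y 1 2)))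
    (emb n star a b (Pi.single t 1) (vec n (.x (n - 1) 1)))
  simp only [← lieB_apply, lieB_emb_single] at this
  rw [← map_add, ← map_add, br_jacobi h5, emb_eq_eps] at this
  have h1 := eps_eq_zero (fun h => by
    have h' := cumul_injective star (h.trans (map_zero _).symm)
    simpa using congrFun h' t) this
  have h2 := (smul_eq_zero.mp h1).resolve_right (vec_ne_zero (valid_y (by omega) (by omega)))
  have h3 : ((n : ℂ) + 1) / 2 ≠ 0 := by
    have : ((n + 1 : ℕ) : ℂ) ≠ 0 := Nat.cast_ne_zero.mpr (by omega)
    push_cast at this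
    exact div_ne_zero this two_ne_zero
  exact sub_eq_zero.mp ((mul_eq_zero.mp h2).resolve_right h3)

end SatoType

end

theorem theorem2p9 (n : ℕ) (hn : Odd n) (h5 : 5 ≤ n) (k : ℕ) (hk : 1 ≤ k)
    (star : Fin k → SatoType.SemiDir) (a b : Fin k → ℂ) (hab : ∀ i, ¬ (a i = 0 ∧ b i = 0)) :
    -- every derivation is inner
    (∀ D : SatoType.SlG n star a b →ₗ[ℂ] SatoType.SlG n star a b,
      (∀ u v : SatoType.SlG n star a b, D ⁅u, v⁆ = ⁅D u, v⁆ + ⁅u, D v⁆) →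
        ∃ w : SatoType.SlG n star a b, ∀ u : SatoType.SlG n star a b, D u = ⁅w, u⁆) ∧
    -- the algebra is perfect
    Submodule.span ℂ {w : SatoType.SlG n star a b | ∃ u v : SatoType.SlG n star a b, ⁅u, v⁆ = w}
      = ⊤ ∧
    -- its center is nonzero
    (∃ z : SatoType.SlG n star a b, z ≠ 0 ∧ ∀ u : SatoType.SlG n star a b, ⁅z, u⁆ = 0) ∧
    -- the Jacobi identity holds exactly if `a_i = b_i` for all `i`
    ((∀ u v w : SatoType.SlG n star a b, ⁅u, ⁅v, w⁆⁆ + ⁅v, ⁅w, u⁆⁆ + ⁅w, ⁅u, v⁆⁆ = 0) ↔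
      ∀ i, a i = b i) ∧
    -- the same properties, and the vanishing of the first cohomology, for the Lie algebra
    (∀ h : ∀ i, a i = b i,
      letI : LieRing (SatoType.SlG n star a b) := SatoType.SlG.lieRing hn h5 h
      letI : LieAlgebra ℂ (SatoType.SlG n star a b) := SatoType.SlG.lieAlgebra hn h5 h
      (∀ D : LieDerivation ℂ (SatoType.SlG n star a b) (SatoType.SlG n star a b),
        ∃ w, LieDerivation.ad ℂ (SatoType.SlG n star a b) w = D) ∧
      ⁅(⊤ : LieIdeal ℂ (SatoType.SlG n star a b)), (⊤ : LieIdeal ℂ (SatoType.SlG n star a b))⁆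
        = ⊤ ∧
      LieAlgebra.center ℂ (SatoType.SlG n star a b) ≠ ⊥ ∧
      Subsingleton (SatoType.H1 (SatoType.SlG n star a b))) := by
  have inner : ∀ D : SatoType.SlG n star a b →ₗ[ℂ] SatoType.SlG n star a b,
      (∀ u v : SatoType.SlG n star a b, D ⁅u, v⁆ = ⁅D u, v⁆ + ⁅u, D v⁆) →
        ∃ w : SatoType.SlG n star a b, ∀ u : SatoType.SlG n star a b, D u = ⁅w, u⁆ := by
    intro D hD
    obtain ⟨w, hw⟩ := SatoType.IsDer.exists_eq hn h5 hab (D := D) hD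
    exact ⟨w, fun u => LinearMap.congr_fun hw u⟩
  have perfect : Submodule.span ℂ {w : SatoType.SlG n star a b |
      ∃ u v : SatoType.SlG n star a b, ⁅u, v⁆ = w} = ⊤ := SatoType.span_lieB_eq_top h5
  have central : ∃ z : SatoType.SlG n star a b, z ≠ 0 ∧
      ∀ u : SatoType.SlG n star a b, ⁅z, u⁆ = 0 :=
    ⟨_, SatoType.emb_c_ne_zero ⟨0, hk⟩, LinearMap.congr_fun (SatoType.lieB_emb_c _)⟩
  refine ⟨inner, perfect, central, ⟨SatoType.eq_of_jacobi h5, fun h u v w => ?_⟩, fun h => ?_⟩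
  · let _ : LieRing (SatoType.SlG n star a b) := SatoType.SlG.lieRing hn h5 h
    exact lie_jacobi u v w
  · let _ : LieRing (SatoType.SlG n star a b) := SatoType.SlG.lieRing hn h5 h
    let _ : LieAlgebra ℂ (SatoType.SlG n star a b) := SatoType.SlG.lieAlgebra hn h5 h
    refine ⟨fun D => ?_, ?_, ?_, ?_⟩
    · obtain ⟨w, hw⟩ := inner D.toLinearMap fun u v => by
        refine (D.apply_lie_eq_add u v).trans ?_
        exact add_comm _ _
      refine ⟨w, LieDerivation.ext fun u => ?_⟩
      rw [LieDerivation.ad_apply_apply]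
      exact (hw u).symm
    · rw [← LieSubmodule.toSubmodule_inj, LieSubmodule.lieIdeal_oper_eq_linear_span',
        LieSubmodule.top_toSubmodule, ← perfect]
      congr 1
      ext w
      simp
    · obtain ⟨z, hz, hzu⟩ := central
      intro hbot
      have : z ∈ LieAlgebra.center ℂ (SatoType.SlG n star a b) := by
        rw [LieAlgebra.center, LieModule.mem_maxTrivSubmodule]
        intro u
        rw [← lie_skew, neg_eq_zero]
        exact hzu u
      rw [hbot, LieSubmodule.mem_bot] at this
      exact hz this
    · rw [Submodule.Quotient.subsingleton_iff, eq_top_iff]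
      rintro ⟨φ, hφ⟩ -
      obtain ⟨w, hw⟩ := inner φ fun u v => by
        have h0 : ⁅u, φ v⁆ - ⁅v, φ u⁆ - φ ⁅u, v⁆ = 0 := by
          rw [← LieModule.Cohomology.d₁₂_apply_apply ℂ, LinearMap.mem_ker.mp hφ]
          rfl
        rw [← lie_skew (φ u) v, ← sub_eq_zero, ← neg_eq_zero, ← h0]
        abel
      refine ⟨-w, LinearMap.ext fun u => ?_⟩
      exact ((lie_neg u w).trans (lie_skew w u)).trans (hw u).symm
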